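/- \textbf{Theorem (rule commutation is the core of cut-elimination).} Consider multiplicative-additive linear logic (MALL) with units. Formulas are $A,B ::= X \mid X^\perp \mid A\otimes B \mid A\parr B \mid 1 \mid \bot \mid A\,\&\,B \mid A\oplus B \mid \top \mid 0$ ($X$ an atom), with $X^{\perp\perp}=X$, $1^\perp=\bot$, $\top^\perp=0$, $(A\otimes B)^\perp=B^\perp\parr A^\perp$, $(A\,\&\,B)^\perp=B^\perp\oplus A^\perp$, and dually. Proofs are the sequent calculus proofs of one-sided sequents built with the rules $ax$ ($\vdash A^\perp,A$ for an arbitrary formula $A$), $cut$ (from $\vdash A,\Gamma$ and $\vdash A^\perp,\Delta$ infer $\vdash\Gamma,\Delta$), $\otimes$, $\parr$, $1$, $\bot$, $\&$, $\oplus_1$, $\oplus_2$ and $\top$ ($\vdash\top,\Gamma$); exchange is incorporated in the rules (occurrences of formulas are tracked and each rule may act on any occurrence of its conclusion, so that the places where exchanges are performed are not part of a proof). \emph{Cut-elimination} $\to_\beta$ is the contextual rewriting relation on proofs of a given sequent which consists of the key cases $ax$, $\parr$-$\otimes$ (a cut of $A\otimes B$, introduced from $\pi_1:\,\vdash A,\Gamma$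 and $\pi_2:\,\vdash B,\Delta$, against $B^\perp\parr A^\perp$, introduced from $\pi_3:\,\vdash B^\perp,A^\perp,\Sigma$, becomes a cut on $A$ of $\pi_1$ with the cut on $B$ of $\pi_2$ with $\pi_3$), $\&$-$\oplus_1$, $\&$-$\oplus_2$ and $\bot$-$1$, and of the commutative cases which move a cut above the last rule of one of its premises when this rule does not introduce the cut formula: $\parr$-$cut$, $\otimes$-$cut$ (cut formula in the left or in the right premise), $\&$-$cut$ (duplicating the other premise of the cut), $\oplus_i$-$cut$, $\bot$-$cut$, $\top$-$cut$ (erasing the cut and its other premise), and $cut$-$cut$ (exchanging two successive cuts, on $B$ between $\pi_1:\,\vdash A,B,\Gamma$ and $\pi_2:\,\vdash B^\perp,\Delta$, then on $A$ with $\pi_3:\,\vdash A^\perp,\Sigma$); in all cases the two branches of any cut may be permuted. \emph{$\beta$-equality} is the equivalence relation generated by $\to_\beta$, and a \emph{normal form} of a proof $\pi$ is a proof $\pi'$ with $\pi\to_\beta^*\pi'$ such that no $\to_\beta$ step applies to $\pi'$. A \emph{rule commutation} (of cut-free MALL) is a step that replaces, at any place inside a proof, a sub-proof without $cut$-rule by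 another sub-proof without $cut$-rule of the same sequent, by exchanging two successive rules among $\otimes,\parr,\&,\oplus_1,\oplus_2,\bot,\top$ which introduce two different occurrences of the sequent: for each pair of such rules the standard permutation, where pushing a rule above a $\&$-rule duplicates it (together with the other premise, for a $\otimes$-rule), where pulling it below a $\&$-rule superimposes the two copies (for a $\otimes$-rule, including the identical sub-proofs above them), and where pulling a $\top$-rule below another rule erases this rule (together with the other sub-proof above it, for a $\otimes$-rule), and conversely creates it; two $\top$-rules commute by changing the occurrence of $\top$ which is introduced. There may be $cut$-rules below the two commuted rules. Let $\simeq$ be the reflexive transitive closure of the (symmetric) relation of rule commutation. If $\pi$ and $\tau$ are $\beta$-equal proofs of a sequent, $\pi'$ is a normal form of $\pi$ for $\to_\beta$ and $\tau'$ is a normal form of $\tau$ for $\to_\beta$, then $\pi'\simeq\tau'$. -/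

import Mathlib

open Relation

namespace MALL

universe u

/-- Formulas of multiplicative-additive linear logic with units, over a type `α` of atoms. -/
inductive Formula (α : Type u) : Type u
  | atom (x : α)
  | natom (x : α)
  | tens (A B : Formula α)
  | parr (A B : Formula α)
  | one
  | bot
  | wth (A B : Formula α)
  | plus (A B : Formula α)
  | top
  | zero

/-- Orthogonality, with the non-commutative De Morgan laws. -/
def Formula.dual {α : Type u} : Formula α → Formula α
  | .atom x => .natom x
  | .natom x => .atom x
  | .tens A B => .parr B.dual A.dual
  | .parr A B => .tens B.dual A.dual
  | .one => .bot
  | .bot => .one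
  | .wth A B => .plus B.dual A.dual
  | .plus A B => .wth B.dual A.dual
  | .top => .zero
  | .zero => .top

theorem Formula.dual_dual {α : Type u} (A : Formula α) : A.dual.dual = A := by
  induction A <;> simp_all [Formula.dual]

/-! ### Sequents with named occurrences

A sequent is handled as a partial map from names (natural numbers) to formulas: the occurrence
called `n` is the formula `Γ n`.  The list `A₀, …, Aₖ` is the sequent whose occurrence `n` is `Aₙ`.
Since occurrences are named, exchange needs no rule of its own: it is incorporated in the other
rules, each of which may act on any occurrence of its conclusion. -/

/-- Sequents: partial maps from names to formulas. -/
abbrev Ctx (α : Type u) : Type u := ℕ → Option (Formula α)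

namespace Ctx

variable {α : Type u}

/-- The sequent given by a list: names are positions. -/
def ofList (Γ : List (Formula α)) : Ctx α := fun n => Γ[n]?

/-- `A, Γ`: the new occurrence is called `0`, the other names are shifted by one. -/
def cons (A : Formula α) (Γ : Ctx α) : Ctx α
  | 0 => some A
  | n + 1 => Γ n

/-- `Γ` without its occurrence `i` (the names of the others do not change). -/
def erase (Γ : Ctx α) (i : ℕ) : Ctx α := fun n => if n = i then none else Γ n

/-- `Γ` is the disjoint union of `Δ` and `Θ`. -/
def Split (Γ Δ Θ : Ctx α) : Prop :=
  ∀ n, (Δ n = Γ n ∧ Θ n = none) ∨ (Δ n = none ∧ Θ n = Γ n)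

end Ctx

/-- Left or right: tells apart the two rules of `⊕`. -/
inductive Side
  | fst
  | snd

/-- Trees of rules.  A rule carries the name of the occurrence it introduces (an `ax`-rule: the
unordered pair of its two occurrences).  The occurrences that a rule adds to a premise get the
names `0` (and `1`, for the second one of a `⅋`-rule) in that premise, and all other names are
shifted accordingly.  A `⊤`-rule carries in addition the names of its context. -/
inductive PreProof (α : Type u) : Type u
  | ax (e : Sym2 ℕ)
  | cut (A : Formula α) (p q : PreProof α)
  | tens (i : ℕ) (p q : PreProof α)
  | parr (i : ℕ) (p : PreProof α)
  | one (i : ℕ)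
  | bot (i : ℕ) (p : PreProof α)
  | wth (i : ℕ) (p q : PreProof α)
  | plus (k : Side) (i : ℕ) (p : PreProof α)
  | top (i : ℕ) (S : Finset ℕ)

/-- `Derives p Γ`: the tree `p` is a correct proof of the sequent `Γ` in the sequent calculus. -/
inductive Derives {α : Type u} : PreProof α → Ctx α → Prop
  /-- `⊢ A, A^⊥` -/
  | ax {Γ : Ctx α} {A : Formula α} {i j : ℕ} (hij : i ≠ j)
      (hi : Γ i = some A) (hj : Γ j = some A.dual)
      (h : ∀ n, n ≠ i → n ≠ j → Γ n = none) : Derives (.ax s(i, j)) Γ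
  /-- from `⊢ A, Δ` and `⊢ A^⊥, Θ` infer `⊢ Δ, Θ` -/
  | cut {Γ Δ Θ : Ctx α} {A : Formula α} {p q : PreProof α} (h : Γ.Split Δ Θ)
      (hp : Derives p (.cons A Δ)) (hq : Derives q (.cons A.dual Θ)) : Derives (.cut A p q) Γ
  /-- from `⊢ A, Δ` and `⊢ B, Θ` infer `⊢ A ⊗ B, Δ, Θ` -/
  | tens {Γ Δ Θ : Ctx α} {A B : Formula α} {i : ℕ} {p q : PreProof α}
      (hi : Γ i = some (.tens A B)) (h : (Γ.erase i).Split Δ Θ)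
      (hp : Derives p (.cons A Δ)) (hq : Derives q (.cons B Θ)) : Derives (.tens i p q) Γ
  /-- from `⊢ A, B, Δ` infer `⊢ A ⅋ B, Δ` -/
  | parr {Γ : Ctx α} {A B : Formula α} {i : ℕ} {p : PreProof α}
      (hi : Γ i = some (.parr A B))
      (hp : Derives p (.cons A (.cons B (Γ.erase i)))) : Derives (.parr i p) Γ
  /-- `⊢ 1` -/
  | one {Γ : Ctx α} {i : ℕ} (hi : Γ i = some .one) (h : ∀ n, n ≠ i → Γ n = none) :
      Derives (.one i) Γ
  /-- from `⊢ Δ` infer `⊢ ⊥, Δ` -/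
  | bot {Γ : Ctx α} {i : ℕ} {p : PreProof α} (hi : Γ i = some .bot)
      (hp : Derives p (Γ.erase i)) : Derives (.bot i p) Γ
  /-- from `⊢ A, Δ` and `⊢ B, Δ` infer `⊢ A & B, Δ` -/
  | wth {Γ : Ctx α} {A B : Formula α} {i : ℕ} {p q : PreProof α}
      (hi : Γ i = some (.wth A B)) (hp : Derives p (.cons A (Γ.erase i)))
      (hq : Derives q (.cons B (Γ.erase i))) : Derives (.wth i p q) Γ
  /-- from `⊢ A, Δ` infer `⊢ A ⊕ B, Δ` -/
  | plus₁ {Γ : Ctx α} {A B : Formula α} {i : ℕ} {p : PreProof α}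
      (hi : Γ i = some (.plus A B)) (hp : Derives p (.cons A (Γ.erase i))) :
      Derives (.plus .fst i p) Γ
  /-- from `⊢ B, Δ` infer `⊢ A ⊕ B, Δ` -/
  | plus₂ {Γ : Ctx α} {A B : Formula α} {i : ℕ} {p : PreProof α}
      (hi : Γ i = some (.plus A B)) (hp : Derives p (.cons B (Γ.erase i))) :
      Derives (.plus .snd i p) Γ
  /-- `⊢ ⊤, Δ` -/
  | top {Γ : Ctx α} {i : ℕ} {S : Finset ℕ} (hi : Γ i = some .top)
      (h : ∀ n, n ∈ S ↔ Γ.erase i n ≠ none) : Derives (.top i S) Γ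

/-- Proofs of the sequent `⊢ Γ`. -/
def Proof {α : Type u} (Γ : List (Formula α)) : Type u :=
  { p : PreProof α // Derives p (Ctx.ofList Γ) }

/-! ### Names: renaming, and the set of names of the conclusion -/

/-- A map of names, below one more new occurrence. -/
def lift (f : ℕ → ℕ) : ℕ → ℕ
  | 0 => 0
  | n + 1 => f n + 1

/-- Exchange of the first `a` names with the next `b` names. -/
def swapBlocks (a b n : ℕ) : ℕ :=
  if n < a then n + b else if n < a + b then n - a else n

/-- Removal of the occurrence `0` in favour of the occurrence `i`. -/
def contract (i : ℕ) : ℕ → ℕ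
  | 0 => i
  | n + 1 => n

/-- `S` below `k` new occurrences, those included. -/
def up (k : ℕ) (S : Finset ℕ) : Finset ℕ := Finset.range k ∪ S.image (· + k)

/-- `S` without the first `k` names: the set of all `n` such that `n + k ∈ S`. -/
def down (k : ℕ) (S : Finset ℕ) : Finset ℕ := (S.filter (k ≤ ·)).image (· - k)

namespace PreProof

variable {α : Type u}

/-- The same tree, with the occurrences of its conclusion renamed. -/
def rename : (ℕ → ℕ) → PreProof α → PreProof α
  | f, .ax e => .ax (e.map f)
  | f, .cut A p q => .cut A (rename (lift f) p) (rename (lift f) q)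
  | f, .tens i p q => .tens (f i) (rename (lift f) p) (rename (lift f) q)
  | f, .parr i p => .parr (f i) (rename (lift (lift f)) p)
  | f, .one i => .one (f i)
  | f, .bot i p => .bot (f i) (rename f p)
  | f, .wth i p q => .wth (f i) (rename (lift f) p) (rename (lift f) q)
  | f, .plus k i p => .plus k (f i) (rename (lift f) p)
  | f, .top i S => .top (f i) (S.image f)

/-- The names of the occurrences of the conclusion. -/
def names : PreProof α → Finset ℕ
  | .ax e => e.toFinset
  | .cut _ p q => down 1 (names p) ∪ down 1 (names q)
  | .tens i p q => insert i (down 1 (names p) ∪ down 1 (names q))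
  | .parr i p => insert i (down 2 (names p))
  | .one i => {i}
  | .bot i p => insert i (names p)
  | .wth i p q => insert i (down 1 (names p) ∪ down 1 (names q))
  | .plus _ i p => insert i (down 1 (names p))
  | .top i S => insert i S

/-- `p` (whose occurrence `0` is the active one), with all names except `0` shifted by `k`. -/
def shift (k : ℕ) (p : PreProof α) : PreProof α := p.rename (lift (· + k))

/-- `p`, with its first `a` names exchanged with the next `b` names. -/
def swap (a b : ℕ) (p : PreProof α) : PreProof α := p.rename (swapBlocks a b)

/-- No `cut`-rule occurs. -/
def CutFree : PreProof α → Prop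
  | .ax _ => True
  | .cut _ _ _ => False
  | .tens _ p q => CutFree p ∧ CutFree q
  | .parr _ p => CutFree p
  | .one _ => True
  | .bot _ p => CutFree p
  | .wth _ p q => CutFree p ∧ CutFree q
  | .plus _ _ p => CutFree p
  | .top _ _ => True

/-- The relation `R` applied to one sub-proof, at any depth. -/
inductive InContext (R : PreProof α → PreProof α → Prop) : PreProof α → PreProof α → Prop
  | root {p q} (h : R p q) : InContext R p q
  | cutL {A p p₁ q} (h : InContext R p p₁) : InContext R (.cut A p q) (.cut A p₁ q)
  | cutR {A p q q₁} (h : InContext R q q₁) : InContext R (.cut A p q) (.cut A p q₁)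
  | tensL {i p p₁ q} (h : InContext R p p₁) : InContext R (.tens i p q) (.tens i p₁ q)
  | tensR {i p q q₁} (h : InContext R q q₁) : InContext R (.tens i p q) (.tens i p q₁)
  | parr {i p p₁} (h : InContext R p p₁) : InContext R (.parr i p) (.parr i p₁)
  | bot {i p p₁} (h : InContext R p p₁) : InContext R (.bot i p) (.bot i p₁)
  | wthL {i p p₁ q} (h : InContext R p p₁) : InContext R (.wth i p q) (.wth i p₁ q)
  | wthR {i p q q₁} (h : InContext R q q₁) : InContext R (.wth i p q) (.wth i p q₁)
  | plus {k i p p₁} (h : InContext R p p₁) : InContext R (.plus k i p) (.plus k i p₁)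

/-! ### Cut-elimination -/

/-- `c` is a cut on `A` between `p`, whose occurrence `0` is `A`, and `q`, whose occurrence `0` is
`A^⊥`, with the two branches in either order. -/
inductive IsCut (A : Formula α) (p q : PreProof α) : PreProof α → Prop
  | straight : IsCut A p q (.cut A p q)
  | switched : IsCut A p q (.cut A.dual q p)

/-- One step of cut-elimination at the root.  In every case `c` is the cut that is eliminated and
`c₁`, `c₂` are the cuts produced.  A premise is written `p.shift 1` where it has to be a proof in
which the cut formula (respectively the formula introduced by the rule below) is absent. -/
inductive BetaRoot : PreProof α → PreProof α → Prop
  -- key cases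
  | ax {A : Formula α} {i : ℕ} {q c : PreProof α}
      (h : IsCut A (.ax s(0, i + 1)) q c) : BetaRoot c (q.rename (contract i))
  | tens_parr {A B : Formula α} {p₁ p₂ p₃ c c₁ c₂ : PreProof α}
      (h : IsCut (.tens A B) (.tens 0 (p₁.shift 1) (p₂.shift 1))
        (.parr 0 (p₃.rename (lift (lift (· + 1))))) c)
      (h₂ : IsCut B (p₂.shift 1) p₃ c₂) (h₁ : IsCut A p₁ c₂ c₁) : BetaRoot c c₁
  | wth_plus₁ {A B : Formula α} {p₁ p₂ p₃ c c₁ : PreProof α}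
      (h : IsCut (.wth A B) (.wth 0 (p₁.shift 1) (p₂.shift 1)) (.plus .fst 0 (p₃.shift 1)) c)
      (h₁ : IsCut B p₂ p₃ c₁) : BetaRoot c c₁
  | wth_plus₂ {A B : Formula α} {p₁ p₂ p₃ c c₁ : PreProof α}
      (h : IsCut (.wth A B) (.wth 0 (p₁.shift 1) (p₂.shift 1)) (.plus .snd 0 (p₃.shift 1)) c)
      (h₁ : IsCut A p₁ p₃ c₁) : BetaRoot c c₁
  | one_bot {p c : PreProof α}
      (h : IsCut .one (.one 0) (.bot 0 (p.rename (· + 1))) c) : BetaRoot c p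
  -- commutative cases
  | parr_cut {A : Formula α} {i : ℕ} {p q c c₁ : PreProof α} (h : IsCut A (.parr (i + 1) p) q c)
      (h₁ : IsCut A (p.swap 2 1) (q.shift 2) c₁) : BetaRoot c (.parr i c₁)
  | tens_cut₁ {A : Formula α} {i : ℕ} {p₁ p₂ q c c₁ : PreProof α}
      (h : IsCut A (.tens (i + 1) p₁ (p₂.shift 1)) q c)
      (h₁ : IsCut A (p₁.swap 1 1) (q.shift 1) c₁) : BetaRoot c (.tens i c₁ p₂)
  | tens_cut₂ {A : Formula α} {i : ℕ} {p₁ p₂ q c c₁ : PreProof α}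
      (h : IsCut A (.tens (i + 1) (p₁.shift 1) p₂) q c)
      (h₁ : IsCut A (p₂.swap 1 1) (q.shift 1) c₁) : BetaRoot c (.tens i p₁ c₁)
  | wth_cut {A : Formula α} {i : ℕ} {p₁ p₂ q c c₁ c₂ : PreProof α}
      (h : IsCut A (.wth (i + 1) p₁ p₂) q c)
      (h₁ : IsCut A (p₁.swap 1 1) (q.shift 1) c₁)
      (h₂ : IsCut A (p₂.swap 1 1) (q.shift 1) c₂) : BetaRoot c (.wth i c₁ c₂)
  | plus_cut {A : Formula α} {k : Side} {i : ℕ} {p q c c₁ : PreProof α}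
      (h : IsCut A (.plus k (i + 1) p) q c)
      (h₁ : IsCut A (p.swap 1 1) (q.shift 1) c₁) : BetaRoot c (.plus k i c₁)
  | bot_cut {A : Formula α} {i : ℕ} {p q c c₁ : PreProof α} (h : IsCut A (.bot (i + 1) p) q c)
      (h₁ : IsCut A p q c₁) : BetaRoot c (.bot i c₁)
  | top_cut {A : Formula α} {i : ℕ} {S : Finset ℕ} {q c : PreProof α}
      (h : IsCut A (.top (i + 1) S) q c) :
      BetaRoot c (.top i (down 1 S ∪ down 1 q.names))
  | cut_cut {A B : Formula α} {p₁ p₂ p₃ d c c₁ c₂ : PreProof α}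
      (hd : IsCut B p₁ (p₂.shift 1) d) (h : IsCut A d p₃ c)
      (h₁ : IsCut A (p₁.swap 1 1) (p₃.shift 1) c₁) (h₂ : IsCut B c₁ p₂ c₂) : BetaRoot c c₂

/-! ### Rule commutations -/

/-- One rule commutation at the root, read in one direction; without its restriction to cut-free
proofs. -/
inductive CommRoot : PreProof α → PreProof α → Prop
  -- commutations that do not involve a unit rule
  | parr_parr (i j : ℕ) (p : PreProof α) :
      CommRoot (.parr j (.parr (i + 2) p)) (.parr i (.parr (j + 2) (p.swap 2 2)))
  | tens_tens₁ (i j : ℕ) (p₁ p₂ p₃ : PreProof α) :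
      CommRoot (.tens i p₁ (.tens (j + 1) p₂ (p₃.shift 1)))
        (.tens j (.tens (i + 1) (p₁.shift 1) (p₂.swap 1 1)) p₃)
  | tens_tens₂ (i j : ℕ) (p₁ p₂ p₃ : PreProof α) :
      CommRoot (.tens i p₁ (.tens (j + 1) (p₂.shift 1) p₃))
        (.tens j p₂ (.tens (i + 1) (p₁.shift 1) (p₃.swap 1 1)))
  | tens_tens₃ (i j : ℕ) (p₁ p₂ p₃ : PreProof α) :
      CommRoot (.tens i (.tens (j + 1) p₁ (p₂.shift 1)) p₃)
        (.tens j (.tens (i + 1) (p₁.swap 1 1) (p₃.shift 1)) p₂)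
  | tens_tens₄ (i j : ℕ) (p₁ p₂ p₃ : PreProof α) :
      CommRoot (.tens i (.tens (j + 1) (p₁.shift 1) p₂) p₃)
        (.tens j p₁ (.tens (i + 1) (p₂.swap 1 1) (p₃.shift 1)))
  | wth_wth (i j : ℕ) (p₁ p₂ p₃ p₄ : PreProof α) :
      CommRoot (.wth j (.wth (i + 1) p₁ p₂) (.wth (i + 1) p₃ p₄))
        (.wth i (.wth (j + 1) (p₁.swap 1 1) (p₃.swap 1 1))
          (.wth (j + 1) (p₂.swap 1 1) (p₄.swap 1 1)))
  | plus_plus (k l : Side) (i j : ℕ) (p : PreProof α) :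
      CommRoot (.plus l j (.plus k (i + 1) p)) (.plus k i (.plus l (j + 1) (p.swap 1 1)))
  | parr_tens₁ (i j : ℕ) (p₁ p₂ : PreProof α) :
      CommRoot (.tens j (.parr (i + 1) p₁) p₂)
        (.parr i (.tens (j + 2) (p₁.swap 2 1) (p₂.shift 2)))
  | parr_tens₂ (i j : ℕ) (p₁ p₂ : PreProof α) :
      CommRoot (.tens j p₁ (.parr (i + 1) p₂))
        (.parr i (.tens (j + 2) (p₁.shift 2) (p₂.swap 2 1)))
  | parr_wth (i j : ℕ) (p₁ p₂ : PreProof α) :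
      CommRoot (.wth j (.parr (i + 1) p₁) (.parr (i + 1) p₂))
        (.parr i (.wth (j + 2) (p₁.swap 2 1) (p₂.swap 2 1)))
  | parr_plus (k : Side) (i j : ℕ) (p : PreProof α) :
      CommRoot (.plus k j (.parr (i + 1) p)) (.parr i (.plus k (j + 2) (p.swap 2 1)))
  | tens_wth₁ (i j : ℕ) (p₁ p₂ p₃ : PreProof α) :
      CommRoot (.wth j (.tens (i + 1) (p₁.shift 1) p₂) (.tens (i + 1) (p₁.shift 1) p₃))
        (.tens i p₁ (.wth (j + 1) (p₂.swap 1 1) (p₃.swap 1 1)))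
  | tens_wth₂ (i j : ℕ) (p₁ p₂ p₃ : PreProof α) :
      CommRoot (.wth j (.tens (i + 1) p₁ (p₂.shift 1)) (.tens (i + 1) p₃ (p₂.shift 1)))
        (.tens i (.wth (j + 1) (p₁.swap 1 1) (p₃.swap 1 1)) p₂)
  | tens_plus₁ (k : Side) (i j : ℕ) (p₁ p₂ : PreProof α) :
      CommRoot (.plus k j (.tens (i + 1) p₁ (p₂.shift 1)))
        (.tens i (.plus k (j + 1) (p₁.swap 1 1)) p₂)
  | tens_plus₂ (k : Side) (i j : ℕ) (p₁ p₂ : PreProof α) :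
      CommRoot (.plus k j (.tens (i + 1) (p₁.shift 1) p₂))
        (.tens i p₁ (.plus k (j + 1) (p₂.swap 1 1)))
  | wth_plus (k : Side) (i j : ℕ) (p₁ p₂ : PreProof α) :
      CommRoot (.plus k j (.wth (i + 1) p₁ p₂))
        (.wth i (.plus k (j + 1) (p₁.swap 1 1)) (.plus k (j + 1) (p₂.swap 1 1)))
  -- commutations that involve a unit rule
  | parr_top (i t : ℕ) (S : Finset ℕ) :
      CommRoot (.top t (insert i S)) (.parr i (.top (t + 2) (up 2 S)))
  | tens_top₁ (i t : ℕ) (S : Finset ℕ) (p : PreProof α) :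
      CommRoot (.top t (insert i (S ∪ down 1 p.names))) (.tens i (.top (t + 1) (up 1 S)) p)
  | tens_top₂ (i t : ℕ) (S : Finset ℕ) (p : PreProof α) :
      CommRoot (.top t (insert i (down 1 p.names ∪ S))) (.tens i p (.top (t + 1) (up 1 S)))
  | wth_top (i t : ℕ) (S : Finset ℕ) :
      CommRoot (.top t (insert i S)) (.wth i (.top (t + 1) (up 1 S)) (.top (t + 1) (up 1 S)))
  | plus_top (k : Side) (i t : ℕ) (S : Finset ℕ) :
      CommRoot (.top t (insert i S)) (.plus k i (.top (t + 1) (up 1 S)))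
  | top_top (s t : ℕ) (S : Finset ℕ) :
      CommRoot (.top s (insert t S)) (.top t (insert s S))
  | bot_top (i t : ℕ) (S : Finset ℕ) :
      CommRoot (.top t (insert i S)) (.bot i (.top t S))
  | parr_bot (i j : ℕ) (p : PreProof α) :
      CommRoot (.bot j (.parr i p)) (.parr i (.bot (j + 2) p))
  | tens_bot₁ (i j : ℕ) (p₁ p₂ : PreProof α) :
      CommRoot (.bot j (.tens i p₁ p₂)) (.tens i (.bot (j + 1) p₁) p₂)
  | tens_bot₂ (i j : ℕ) (p₁ p₂ : PreProof α) :
      CommRoot (.bot j (.tens i p₁ p₂)) (.tens i p₁ (.bot (j + 1) p₂))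
  | wth_bot (i j : ℕ) (p₁ p₂ : PreProof α) :
      CommRoot (.bot j (.wth i p₁ p₂)) (.wth i (.bot (j + 1) p₁) (.bot (j + 1) p₂))
  | plus_bot (k : Side) (i j : ℕ) (p : PreProof α) :
      CommRoot (.bot j (.plus k i p)) (.plus k i (.bot (j + 1) p))
  | bot_bot (i j : ℕ) (p : PreProof α) :
      CommRoot (.bot j (.bot i p)) (.bot i (.bot j p))

/-- A rule commutation of cut-free MALL at the root: no `cut`-rule on either side. -/
def CutFreeCommRoot (p q : PreProof α) : Prop :=
  (CommRoot p q ∨ CommRoot q p) ∧ p.CutFree ∧ q.CutFree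

end PreProof

namespace Proof

variable {α : Type u} {Γ : List (Formula α)}

/-- One step of cut-elimination, anywhere in a proof. -/
def Beta (π τ : Proof Γ) : Prop := PreProof.InContext PreProof.BetaRoot π.1 τ.1

/-- Equality up to cut-elimination. -/
def BetaEq : Proof Γ → Proof Γ → Prop := EqvGen Beta

/-- `ν` is a normal form of `π` for cut-elimination. -/
def IsNormalFormOf (ν π : Proof Γ) : Prop :=
  ReflTransGen Beta π ν ∧ ∀ τ : Proof Γ, ¬ Beta ν τ

/-- One rule commutation, anywhere in a proof: there may be `cut`-rules below the two commuted
rules, but none above them. -/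
def CommStep (π τ : Proof Γ) : Prop :=
  PreProof.InContext PreProof.CutFreeCommRoot π.1 τ.1

/-- Equality up to rule commutations. -/
def CommEq : Proof Γ → Proof Γ → Prop := ReflTransGen CommStep

end Proof

end MALL

namespace MALL

universe u

variable {α : Type u}

/-! ### Renaming of sequents -/

/-! The rewriting relation is replaced by a deterministic function. `elim A p q` eliminates a single
cut between two cut-free proofs, by recursion on the size of `A` and then on the number of rules: it
renames when a premise is an axiom on the cut formula, moves the last rule of a premise below the
cut when this rule does not introduce the cut formula, and performs the key case otherwise. `nf`
applies it to all cuts of a proof, the topmost ones first.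

The core is that a step of cut-elimination changes `nf` only up to rule commutations
(`InContext.commEquiv`). Moreover a normal form is cut-free, because a proof with a cut always has a
reduct (`Derives.exists_beta`), and `nf` fixes cut-free proofs. Hence `π' = nf π' ≃ nf π ≃ nf τ ≃ nf
τ' = τ'`. Neither termination nor confluence of the rewriting relation is needed.

The key cases and most commutative cases hold almost by definition of `elim`. What remains comes
from its arbitrary choices, and is settled up to rule commutations by three facts. The two premises
of a cut may be permuted (`elim_symm`): `elim` prefers the last rule of the left premise, and
preferring the right one differs by commuting the two rules. Rule commutations in a premise of a cut
give rule commutations in the result (`congr`): either both commuted rules go below the cut and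
commute there, or one of them introduces the cut formula and the cut becomes cuts on smaller
formulas, above which the other rule does not remain. Two successive cuts may be exchanged
(`cutExchange`), by induction on the cut formulas and on the proofs.

To avoid one argument for each pair of rules, rules are treated as operations (`Head`) with zero,
one or two premises, a `⊗`-rule being an operation on one premise with the other one fixed. An
operation consumes a part of the conclusion, and two operations commute when these parts are
disjoint. The one constructor `CommEquiv.comm` then covers all the permutations: duplication and
superposition for `&` come from its two premises, erasure and creation for `⊤` from its having none.
Renamings of occurrences have to be carried along everywhere, which is why `elim_rename` is used
throughout. -/

/-- `f` below `k` more new occurrences. -/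
def liftN (k : ℕ) (f : ℕ → ℕ) (n : ℕ) : ℕ := if n < k then n else f (n - k) + k

theorem lift_eq_liftN (f : ℕ → ℕ) : lift f = liftN 1 f := by
  funext n; cases n <;> simp [lift, liftN]

theorem liftN_lift (k : ℕ) (f : ℕ → ℕ) : lift (liftN k f) = liftN (k + 1) f := by
  funext n
  cases n with
  | zero => simp [lift, liftN]
  | succ n => simp only [lift, liftN]; split_ifs <;> grind

theorem liftN_one (f : ℕ → ℕ) : liftN 1 f = lift f := (lift_eq_liftN f).symm

theorem liftN_two (f : ℕ → ℕ) : liftN 2 f = lift (lift f) := by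
  rw [← liftN_lift, liftN_one]

theorem liftN_zero (f : ℕ → ℕ) : liftN 0 f = f := by funext n; simp [liftN]

theorem lift_comp (f g : ℕ → ℕ) : lift f ∘ lift g = lift (f ∘ g) := by
  funext n; cases n <;> rfl

theorem lift_id : lift id = id := by funext n; cases n <;> rfl

@[simp] theorem mem_down {k n : ℕ} {S : Finset ℕ} : n ∈ down k S ↔ n + k ∈ S := by
  simp only [down, Finset.mem_image, Finset.mem_filter]
  constructor
  · rintro ⟨a, ⟨h, hk⟩, rfl⟩; rwa [Nat.sub_add_cancel hk]
  · intro h; exact ⟨n + k, ⟨h, by omega⟩, by omega⟩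

@[simp] theorem mem_up {k n : ℕ} {S : Finset ℕ} : n ∈ up k S ↔ n < k ∨ (k ≤ n ∧ n - k ∈ S) := by
  simp only [up, Finset.mem_union, Finset.mem_range, Finset.mem_image]
  constructor
  · rintro (h | ⟨a, h, rfl⟩)
    · exact .inl h
    · right; simpa using h
  · rintro (h | ⟨h, h'⟩)
    · exact .inl h
    · exact .inr ⟨_, h', by omega⟩

namespace Ctx

@[simp] theorem cons_zero (A : Formula α) (Γ : Ctx α) : cons A Γ 0 = some A := rfl
@[simp] theorem cons_succ (A : Formula α) (Γ : Ctx α) (n : ℕ) : cons A Γ (n + 1) = Γ n := rfl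

theorem cons_eta {A : Formula α} {Γ : Ctx α} (h : Γ 0 = some A) :
    cons A (fun n => Γ (n + 1)) = Γ := by
  funext n; cases n <;> simp [h]

/-- The sequent `A` with its only occurrence called `i`. -/
def single (i : ℕ) (A : Formula α) : Ctx α := fun n => if n = i then some A else none

/-- The formulas of `L` become the first occurrences. -/
def push : List (Formula α) → Ctx α → Ctx α
  | [], Γ => Γ
  | A :: L, Γ => cons A (push L Γ)

theorem push_apply (L : List (Formula α)) (Γ : Ctx α) (n : ℕ) :
    push L Γ n = if n < L.length then L[n]? else Γ (n - L.length) := by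
  induction L generalizing n with
  | nil => simp [push]
  | cons A L ih =>
    cases n with
    | zero => simp [push]
    | succ n => simp [push, ih]

/-- All names are shifted by `k`. -/
def sh (k : ℕ) (Γ : Ctx α) : Ctx α := fun n => if n < k then none else Γ (n - k)

/-- The union of two sequents. -/
def join (Γ Δ : Ctx α) : Ctx α := fun n => if Γ n = none then Δ n else Γ n

/-- `D` is the set of names of `Γ`. -/
def IsDom (D : Finset ℕ) (Γ : Ctx α) : Prop := ∀ n, n ∈ D ↔ Γ n ≠ none

theorem IsDom.unique {D D' : Finset ℕ} {Γ : Ctx α} (h : IsDom D Γ) (h' : IsDom D' Γ) : D = D' := by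
  ext n; rw [h n, h' n]

/-- The renaming `f` transforms `Γ` into `Γ'`. -/
structure Ren (f : ℕ → ℕ) (Γ Γ' : Ctx α) : Prop where
  map : ∀ {n A}, Γ n = some A → Γ' (f n) = some A
  back : ∀ {m A}, Γ' m = some A → ∃ n, Γ n = some A ∧ f n = m
  inj : ∀ {n m A B}, Γ n = some A → Γ m = some B → f n = f m → n = m

open Classical in
/-- The image of a sequent by a renaming. -/
noncomputable def img (f : ℕ → ℕ) (Γ : Ctx α) : Ctx α :=
  fun m => if h : ∃ n A, Γ n = some A ∧ f n = m then Γ h.choose else none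

theorem split_iff {Γ Δ Θ : Ctx α} : Γ.Split Δ Θ ↔
    (∀ n A, Γ n = some A ↔ Δ n = some A ∨ Θ n = some A) ∧ ∀ n, Δ n = none ∨ Θ n = none := by
  constructor
  · intro h
    refine ⟨fun n A => ?_, fun n => ?_⟩ <;> rcases h n with ⟨h₁, h₂⟩ | ⟨h₁, h₂⟩ <;> simp_all
  · rintro ⟨h₁, h₂⟩ n
    have := h₁ n
    rcases h₂ n with h | h
    · right; refine ⟨h, Option.ext fun A => ?_⟩; simp_all
    · left; refine ⟨Option.ext fun A => ?_, h⟩; simp_all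

theorem img_ren {f : ℕ → ℕ} {Γ : Ctx α}
    (hf : ∀ {n m A B}, Γ n = some A → Γ m = some B → f n = f m → n = m) : Ren f Γ (img f Γ) where
  map := by
    intro n A h
    have hex : ∃ n' A, Γ n' = some A ∧ f n' = f n := ⟨n, A, h, rfl⟩
    obtain ⟨B, hB, hB'⟩ := hex.choose_spec
    simp only [img, dif_pos hex]
    rw [hf hB h hB', h]
  back := by
    intro m A h
    unfold img at h
    split_ifs at h with hex
    obtain ⟨B, hB, hB'⟩ := hex.choose_spec
    exact ⟨_, h, hB'⟩
  inj := hf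

/-- The two images stay disjoint because `f` is injective on the occurrences of the whole of `Γ`,
not only on those of each part. -/
theorem Ren.split {f : ℕ → ℕ} {Γ Γ' Δ Θ : Ctx α} (h : Ren f Γ Γ') (hs : Γ.Split Δ Θ) :
    Ren f Δ (img f Δ) ∧ Ren f Θ (img f Θ) ∧ Γ'.Split (img f Δ) (img f Θ) := by
  rw [split_iff] at hs
  obtain ⟨h₁, h₂⟩ := hs
  have hΔ : Ren f Δ (img f Δ) := img_ren fun hn hm e =>
    h.inj ((h₁ _ _).2 (.inl hn)) ((h₁ _ _).2 (.inl hm)) e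
  have hΘ : Ren f Θ (img f Θ) := img_ren fun hn hm e =>
    h.inj ((h₁ _ _).2 (.inr hn)) ((h₁ _ _).2 (.inr hm)) e
  refine ⟨hΔ, hΘ, ?_⟩
  rw [split_iff]
  refine ⟨fun m A => ⟨fun hm => ?_, ?_⟩, fun m => ?_⟩
  · obtain ⟨n, hn, rfl⟩ := h.back hm
    rcases (h₁ _ _).1 hn with hn | hn
    · exact .inl (hΔ.map hn)
    · exact .inr (hΘ.map hn)
  · rintro (hm | hm)
    · obtain ⟨n, hn, rfl⟩ := hΔ.back hm
      exact h.map ((h₁ _ _).2 (.inl hn))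
    · obtain ⟨n, hn, rfl⟩ := hΘ.back hm
      exact h.map ((h₁ _ _).2 (.inr hn))
  · by_contra hc
    push Not at hc
    obtain ⟨A, hA⟩ := Option.ne_none_iff_exists'.1 hc.1
    obtain ⟨B, hB⟩ := Option.ne_none_iff_exists'.1 hc.2
    obtain ⟨n, hn, rfl⟩ := hΔ.back hA
    obtain ⟨k, hk, e⟩ := hΘ.back hB
    have := h.inj ((h₁ _ _).2 (.inl hn)) ((h₁ _ _).2 (.inr hk)) e.symm
    subst this
    have := h₂ n
    simp_all

theorem Ren.cons {f : ℕ → ℕ} {Γ Γ' : Ctx α} (h : Ren f Γ Γ') (A : Formula α) :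
    Ren (lift f) (cons A Γ) (cons A Γ') where
  map := by
    rintro (_ | n) B hB
    · exact hB
    · exact h.map hB
  back := by
    rintro (_ | m) B hB
    · exact ⟨0, hB, rfl⟩
    · obtain ⟨n, hn, rfl⟩ := h.back hB
      exact ⟨n + 1, hn, rfl⟩
  inj := by
    rintro (_ | n) (_ | m) B C hB hC e <;> simp [lift] at e ⊢
    exact h.inj hB hC e

theorem Ren.push {f : ℕ → ℕ} {Γ Γ' : Ctx α} (h : Ren f Γ Γ') (L : List (Formula α)) :
    Ren (liftN L.length f) (push L Γ) (push L Γ') := by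
  induction L with
  | nil => simpa [liftN_zero, Ctx.push] using h
  | cons A L ih => rw [List.length_cons, ← liftN_lift]; exact ih.cons A

theorem Ren.erase {f : ℕ → ℕ} {Γ Γ' : Ctx α} {i : ℕ} {A : Formula α} (h : Ren f Γ Γ')
    (hi : Γ i = some A) : Ren f (Γ.erase i) (Γ'.erase (f i)) where
  map := by
    intro n B hn
    simp only [Ctx.erase] at hn ⊢
    split_ifs at hn with e
    rw [if_neg (fun e' => e (h.inj hn hi e')), h.map hn]
  back := by
    intro m B hm
    simp only [Ctx.erase] at hm ⊢
    split_ifs at hm with e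
    obtain ⟨n, hn, rfl⟩ := h.back hm
    exact ⟨n, by rw [if_neg (fun e' => e (by rw [e'])), hn], rfl⟩
  inj := by
    intro n m B C hn hm e
    simp only [Ctx.erase] at hn hm
    split_ifs at hn hm
    exact h.inj hn hm e

theorem Ren.single {f : ℕ → ℕ} (i : ℕ) (A : Formula α) : Ren f (single i A) (single (f i) A) where
  map := by intro n B; simp only [Ctx.single]; split_ifs <;> grind
  back := by
    intro m B; simp only [Ctx.single]; split_ifs with h <;> simp [h]
  inj := by intro n m B C; simp only [Ctx.single]; split_ifs <;> grind

theorem Ren.unique {f : ℕ → ℕ} {Γ Γ' Γ'' : Ctx α} (h : Ren f Γ Γ') (h' : Ren f Γ Γ'') :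
    Γ' = Γ'' := by
  funext m
  refine Option.ext fun A => ⟨fun hm => ?_, fun hm => ?_⟩
  · obtain ⟨n, hn, rfl⟩ := h.back hm; exact h'.map hn
  · obtain ⟨n, hn, rfl⟩ := h'.back hm; exact h.map hn

theorem Ren.dom {f : ℕ → ℕ} {Γ Γ' : Ctx α} {D : Finset ℕ} (h : Ren f Γ Γ') (hD : IsDom D Γ) :
    IsDom (D.image f) Γ' := by
  intro m
  simp only [Finset.mem_image, hD _, Option.ne_none_iff_exists']
  constructor
  · rintro ⟨n, ⟨A, hA⟩, rfl⟩; exact ⟨A, h.map hA⟩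
  · rintro ⟨A, hA⟩
    obtain ⟨n, hn, rfl⟩ := h.back hA
    exact ⟨n, ⟨A, hn⟩, rfl⟩

/-- Renaming along an injective map. -/
theorem Ren.of_injective {f : ℕ → ℕ} (hf : f.Injective) {Γ Γ' : Ctx α}
    (h : ∀ n, Γ' (f n) = Γ n) (h' : ∀ m, (∀ n, f n ≠ m) → Γ' m = none) : Ren f Γ Γ' where
  map := by intro n A hA; rw [h, hA]
  back := by
    intro m A hA
    by_contra hc
    push Not at hc
    rw [h' m] at hA
    · simp at hA
    · intro n e; exact hc n (by rw [← h, e, hA]) e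
  inj := fun _ _ e => hf e

end Ctx

open Ctx

/-! ### Renaming of proofs -/

namespace PreProof

theorem rename_rename (f g : ℕ → ℕ) (p : PreProof α) :
    (p.rename f).rename g = p.rename (g ∘ f) := by
  induction p generalizing f g <;> simp_all [rename, lift_comp, Sym2.map_map, Finset.image_image]

theorem rename_id (p : PreProof α) : p.rename id = p := by
  induction p <;> simp_all [rename, lift_id]

theorem names_rename (f : ℕ → ℕ) (p : PreProof α) : (p.rename f).names = p.names.image f := by
  have hd : ∀ (S : Finset ℕ) (f : ℕ → ℕ), down 1 (S.image (lift f)) = (down 1 S).image f := by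
    intro S f; ext n; simp only [mem_down, Finset.mem_image]
    constructor
    · rintro ⟨_ | a, h, e⟩ <;> simp [lift] at e; exact ⟨a, h, e⟩
    · rintro ⟨a, h, rfl⟩; exact ⟨a + 1, h, rfl⟩
  have hd₂ : ∀ (S : Finset ℕ) (f : ℕ → ℕ), down 2 (S.image (lift (lift f))) = (down 2 S).image f := by
    intro S f; ext n; simp only [mem_down, Finset.mem_image]
    constructor
    · rintro ⟨_ | _ | a, h, e⟩ <;> simp [lift] at e; exact ⟨a, h, e⟩
    · rintro ⟨a, h, rfl⟩; exact ⟨a + 2, h, rfl⟩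
  induction p generalizing f with
  | ax e =>
    induction e using Sym2.ind
    ext n; simp [rename, names, eq_comm]
  | _ => simp_all [rename, names, Finset.image_insert, Finset.image_union]

/-- Only the names of the conclusion matter. This allows non-injective maps such as `Nat.pred` to
act as inverses of shifts on proofs from which the relevant name is absent. -/
theorem rename_congr {f g : ℕ → ℕ} {p : PreProof α} (h : ∀ n ∈ p.names, f n = g n) :
    p.rename f = p.rename g := by
  have hl : ∀ {S : Finset ℕ} {f g : ℕ → ℕ}, (∀ n ∈ down 1 S, f n = g n) →
      ∀ n ∈ S, lift f n = lift g n := by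
    rintro S f g h (_ | n) hn
    · rfl
    · simp only [lift]; rw [h n (by simpa using hn)]
  have hl₂ : ∀ {S : Finset ℕ} {f g : ℕ → ℕ}, (∀ n ∈ down 2 S, f n = g n) →
      ∀ n ∈ S, lift (lift f) n = lift (lift g) n := by
    rintro S f g h (_ | _ | n) hn
    · rfl
    · rfl
    · simp only [lift]; rw [h n (by simpa using hn)]
  induction p generalizing f g with
  | ax e =>
    induction e using Sym2.ind with | _ x y
    simp only [names, Sym2.mem_toFinset, Sym2.mem_iff] at h
    simp [rename, h x (.inl rfl), h y (.inr rfl)]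
  | cut A p q ihp ihq =>
    simp only [names, Finset.mem_union] at h
    simp only [rename]
    rw [ihp (hl fun n hn => h n (.inl hn)), ihq (hl fun n hn => h n (.inr hn))]
  | tens i p q ihp ihq =>
    simp only [names, Finset.mem_insert, Finset.mem_union] at h
    simp only [rename]
    rw [ihp (hl fun n hn => h n (.inr (.inl hn))), ihq (hl fun n hn => h n (.inr (.inr hn))),
      h i (.inl rfl)]
  | parr i p ihp =>
    simp only [names, Finset.mem_insert] at h
    simp only [rename]
    rw [ihp (hl₂ fun n hn => h n (.inr hn)), h i (.inl rfl)]
  | one i => simp_all [rename, names]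
  | bot i p ihp =>
    simp only [names, Finset.mem_insert] at h
    simp only [rename]
    rw [ihp (fun n hn => h n (.inr hn)), h i (.inl rfl)]
  | wth i p q ihp ihq =>
    simp only [names, Finset.mem_insert, Finset.mem_union] at h
    simp only [rename]
    rw [ihp (hl fun n hn => h n (.inr (.inl hn))), ihq (hl fun n hn => h n (.inr (.inr hn))),
      h i (.inl rfl)]
  | plus k i p ihp =>
    simp only [names, Finset.mem_insert] at h
    simp only [rename]
    rw [ihp (hl fun n hn => h n (.inr hn)), h i (.inl rfl)]
  | top i S =>
    simp only [names, Finset.mem_insert] at h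
    simp only [rename]
    rw [h i (.inl rfl), Finset.image_congr (fun n hn => h n (.inr hn))]

theorem cutFree_rename (f : ℕ → ℕ) (p : PreProof α) : (p.rename f).CutFree ↔ p.CutFree := by
  induction p generalizing f <;> simp_all [rename, CutFree]

/-- The number of rules other than `ax` and `1`. -/
def sz : PreProof α → ℕ
  | .ax _ => 0
  | .cut _ p q => sz p + sz q + 1
  | .tens _ p q => sz p + sz q + 1
  | .parr _ p => sz p + 1
  | .one _ => 0
  | .bot _ p => sz p + 1
  | .wth _ p q => sz p + sz q + 1
  | .plus _ _ p => sz p + 1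
  -- Counted, unlike `ax` and `1`, so that the dummy premise `.one 0` which `view` attributes to a
  -- `⊤`-rule is strictly smaller; the recursion of `elim` also visits that premise.
  | .top _ _ => 1

@[simp] theorem sz_rename (f : ℕ → ℕ) (p : PreProof α) : (p.rename f).sz = p.sz := by
  induction p generalizing f <;> simp_all [rename, sz]

@[simp] theorem sz_shift (k : ℕ) (p : PreProof α) : (p.shift k).sz = p.sz := sz_rename _ _
@[simp] theorem sz_swap (k l : ℕ) (p : PreProof α) : (p.swap k l).sz = p.sz := sz_rename _ _

end PreProof

open PreProof

/-- The names can be read off the tree alone. Hence the splitting of a context by a binary rule, and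
the set of names carried by a `⊤`-rule, are forced by the sequents. -/
theorem Derives.names {p : PreProof α} {Γ : Ctx α} (h : Derives p Γ) : IsDom p.names Γ := by
  induction h with
  | @ax Γ A i j hij hi hj h =>
    intro n
    simp only [PreProof.names, Sym2.mem_toFinset, Sym2.mem_iff]
    constructor
    · rintro (rfl | rfl) <;> simp [*]
    · intro hn; by_contra hc; push Not at hc; exact hn (h n hc.1 hc.2)
  | @cut Γ Δ Θ A p q h hp hq ihp ihq =>
    intro n
    have h₁ := ihp (n + 1); have h₂ := ihq (n + 1)
    simp only [PreProof.names, Finset.mem_union, mem_down, h₁, h₂, cons_succ]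
    rcases h n with ⟨a, b⟩ | ⟨a, b⟩ <;> simp [a, b]
  | @tens Γ Δ Θ A B i p q hi h hp hq ihp ihq =>
    intro n
    have h₁ := ihp (n + 1); have h₂ := ihq (n + 1)
    simp only [PreProof.names, Finset.mem_insert, Finset.mem_union, mem_down, h₁, h₂, cons_succ]
    by_cases e : n = i
    · simp [e, hi]
    · rcases h n with ⟨a, b⟩ | ⟨a, b⟩ <;> simp [a, b, e, erase]
  | @parr Γ A B i p hi hp ihp =>
    intro n
    have h₁ := ihp (n + 2)
    simp only [PreProof.names, Finset.mem_insert, mem_down, h₁, cons_succ, erase]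
    by_cases e : n = i <;> simp [e, hi]
  | @one Γ i hi h =>
    intro n
    simp only [PreProof.names, Finset.mem_singleton]
    constructor
    · rintro rfl; simp [hi]
    · intro hn; by_contra hc; exact hn (h n hc)
  | @bot Γ i p hi hp ihp =>
    intro n
    have h₁ := ihp n
    simp only [PreProof.names, Finset.mem_insert, h₁, erase]
    by_cases e : n = i <;> simp [e, hi]
  | @wth Γ A B i p q hi hp hq ihp ihq =>
    intro n
    have h₁ := ihp (n + 1); have h₂ := ihq (n + 1)
    simp only [PreProof.names, Finset.mem_insert, Finset.mem_union, mem_down, h₁, h₂, cons_succ,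
      erase]
    by_cases e : n = i <;> simp [e, hi]
  | @plus₁ Γ A B i p hi hp ihp | @plus₂ Γ A B i p hi hp ihp =>
    intro n
    have h₁ := ihp (n + 1)
    simp only [PreProof.names, Finset.mem_insert, mem_down, h₁, cons_succ, erase]
    by_cases e : n = i <;> simp [e, hi]
  | @top Γ i S hi h =>
    intro n
    simp only [PreProof.names, Finset.mem_insert, h, erase]
    by_cases e : n = i <;> simp [e, hi]

/-- Injectivity is required on the occurrences of `Γ` only, so that this applies to shifts and block
exchanges, and also to `contract i` and `Nat.pred`, which are not injective on all names. -/
theorem Derives.rename {p : PreProof α} {Γ Γ' : Ctx α} {f : ℕ → ℕ} (h : Derives p Γ)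
    (hf : Ren f Γ Γ') : Derives (p.rename f) Γ' := by
  induction h generalizing f Γ' with
  | @ax Γ A i j hij hi hj h =>
    refine Derives.ax (fun e => hij (hf.inj hi hj e)) (hf.map hi) (hf.map hj) fun m hmi hmj => ?_
    by_contra hc
    obtain ⟨B, hB⟩ := Option.ne_none_iff_exists'.1 hc
    obtain ⟨n, hn, rfl⟩ := hf.back hB
    have := h n (by rintro rfl; exact hmi rfl) (by rintro rfl; exact hmj rfl)
    simp_all
  | @cut Γ Δ Θ A p q h hp hq ihp ihq =>
    obtain ⟨h₁, h₂, h₃⟩ := hf.split h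
    exact Derives.cut h₃ (ihp (h₁.cons _)) (ihq (h₂.cons _))
  | @tens Γ Δ Θ A B i p q hi h hp hq ihp ihq =>
    obtain ⟨h₁, h₂, h₃⟩ := (hf.erase hi).split h
    exact Derives.tens (hf.map hi) h₃ (ihp (h₁.cons _)) (ihq (h₂.cons _))
  | @parr Γ A B i p hi hp ihp =>
    exact Derives.parr (hf.map hi) (ihp (((hf.erase hi).cons _).cons _))
  | @one Γ i hi h =>
    refine Derives.one (hf.map hi) fun m hm => ?_
    by_contra hc
    obtain ⟨B, hB⟩ := Option.ne_none_iff_exists'.1 hc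
    obtain ⟨n, hn, rfl⟩ := hf.back hB
    have := h n (by rintro rfl; exact hm rfl)
    simp_all
  | @bot Γ i p hi hp ihp => exact Derives.bot (hf.map hi) (ihp (hf.erase hi))
  | @wth Γ A B i p q hi hp hq ihp ihq =>
    exact Derives.wth (hf.map hi) (ihp ((hf.erase hi).cons _)) (ihq ((hf.erase hi).cons _))
  | @plus₁ Γ A B i p hi hp ihp => exact Derives.plus₁ (hf.map hi) (ihp ((hf.erase hi).cons _))
  | @plus₂ Γ A B i p hi hp ihp => exact Derives.plus₂ (hf.map hi) (ihp ((hf.erase hi).cons _))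
  | @top Γ i S hi h => exact Derives.top (hf.map hi) ((hf.erase hi).dom h)

open Ctx PreProof

/-- `p` is a correct proof of `Γ` without `cut`-rule. -/
structure T (p : PreProof α) (Γ : Ctx α) : Prop where
  der : Derives p Γ
  cf : p.CutFree

theorem T.rename {p : PreProof α} {Γ Γ' : Ctx α} {f : ℕ → ℕ} (h : T p Γ) (hf : Ren f Γ Γ') :
    T (p.rename f) Γ' := ⟨h.der.rename hf, (cutFree_rename f p).2 h.cf⟩

theorem T.names {p : PreProof α} {Γ : Ctx α} (h : T p Γ) : IsDom p.names Γ := h.der.names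

/-! ### Rules as operations on proofs

A rule other than `ax` and `1` is an operation on the proofs of its premises.  A `⊗`-rule is
considered as an operation on one of its premises, the other one being fixed. -/

/-- The rules, considered as operations. -/
inductive Head (α : Type u) : Type u
  | parr
  | bot
  | wth
  | plus (k : Side)
  | top
  | tensL (q : PreProof α)
  | tensR (q : PreProof α)

namespace Head

/-- The number of occurrences added to the premises. -/
def k : Head α → ℕ
  | .parr => 2
  | .bot => 0
  | .top => 0
  | _ => 1

/-- The premises. -/
def Branch : Head α → Bool → Prop
  | .wth, _ => True
  | .top, _ => False
  | _, b => b = false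

/-- Renaming of the fixed premise. -/
def rename (f : ℕ → ℕ) : Head α → Head α
  | .tensL q => .tensL (q.rename (lift f))
  | .tensR q => .tensR (q.rename (lift f))
  | r => r

/-- The rule `r` introducing `i` with premises `ps`; for a `⊤`-rule, `D` is the set of names of its
context. -/
def mk (r : Head α) (i : ℕ) (D : Finset ℕ) (ps : Bool → PreProof α) : PreProof α :=
  match r with
  | .parr => .parr i (ps false)
  | .bot => .bot i (ps false)
  | .wth => .wth i (ps false) (ps true)
  | .plus k => .plus k i (ps false)
  | .top => .top i D
  | .tensL q => .tens i (ps false) q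
  | .tensR q => .tens i q (ps false)

/-- The rule `r` introducing `i` above the new occurrence `0`, which goes to the premises `ps`,
where it is called `0` as well. -/
def mk0 (r : Head α) (i : ℕ) (D : Finset ℕ) (ps : Bool → PreProof α) : PreProof α :=
  (r.rename (· + 1)).mk (i + 1) (up 1 D) fun b => (ps b).swap 1 r.k

@[simp] theorem k_rename (f : ℕ → ℕ) (r : Head α) : (r.rename f).k = r.k := by cases r <;> rfl

@[simp] theorem branch_rename (f : ℕ → ℕ) (r : Head α) (b : Bool) :
    (r.rename f).Branch b ↔ r.Branch b := by cases r <;> rfl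

theorem rename_rename (f g : ℕ → ℕ) (r : Head α) : (r.rename f).rename g = r.rename (g ∘ f) := by
  cases r <;> simp [rename, PreProof.rename_rename, lift_comp]

theorem mk_congr {r : Head α} {i : ℕ} {D : Finset ℕ} {ps ps' : Bool → PreProof α}
    (h : ∀ b, r.Branch b → ps b = ps' b) : r.mk i D ps = r.mk i D ps' := by
  cases r <;> simp_all [Branch, mk]

theorem rename_mk (f : ℕ → ℕ) (r : Head α) (i : ℕ) (D : Finset ℕ) (ps : Bool → PreProof α) :
    (r.mk i D ps).rename f =
      (r.rename f).mk (f i) (D.image f) fun b => (ps b).rename (liftN r.k f) := by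
  cases r <;> simp [mk, rename, PreProof.rename, k, liftN_zero, liftN_one, liftN_two]

theorem rename_mk0 (f : ℕ → ℕ) (r : Head α) (i : ℕ) (D : Finset ℕ) (ps : Bool → PreProof α) :
    (r.mk0 i D ps).rename (lift f) =
      (r.rename f).mk0 (f i) (D.image f) fun b => (ps b).rename (lift (liftN r.k f)) := by
  have hD : (up 1 D).image (lift f) = up 1 (D.image f) := by
    ext n
    simp only [Finset.mem_image, mem_up]
    constructor
    · rintro ⟨_ | n, h, rfl⟩
      · simp [lift]
      · simp at h; simp only [lift]; right; exact ⟨by omega, n, h, by omega⟩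
    · rintro (h | ⟨h, m, hm, e⟩)
      · exact ⟨0, by simp, by simp [lift]; omega⟩
      · exact ⟨m + 1, by simp [hm], by simp [lift]; omega⟩
  rw [mk0, rename_mk, mk0, rename_rename, rename_rename, hD, k_rename, k_rename]
  congr 1
  funext b
  rw [swap, swap, PreProof.rename_rename, PreProof.rename_rename]
  congr 1
  funext n
  simp only [Function.comp, swapBlocks, liftN, lift_eq_liftN]
  grind

theorem sz_mk (r : Head α) (i : ℕ) (D : Finset ℕ) (ps : Bool → PreProof α) {b : Bool}
    (h : r.Branch b) : (ps b).sz < (r.mk i D ps).sz := by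
  cases r <;> cases b <;> simp_all [Branch, mk, sz]

theorem sz_mk0 (r : Head α) (i : ℕ) (D : Finset ℕ) (ps : Bool → PreProof α) {b : Bool}
    (h : r.Branch b) : (ps b).sz < (r.mk0 i D ps).sz := by
  have := sz_mk (r.rename (· + 1)) (i + 1) (up 1 D) (fun b => (ps b).swap 1 r.k)
    ((branch_rename _ _ _).2 h)
  rwa [sz_swap] at this

/-- The rule `r` introducing `i` consumes the part `Φ` of the conclusion and adds the occurrences
`L b` to the premise `b`. -/
def Own (r : Head α) (i : ℕ) (Φ : Ctx α) (L : Bool → List (Formula α)) : Prop :=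
  match r with
  | .parr => ∃ A B, Φ = single i (.parr A B) ∧ L = fun _ => [A, B]
  | .bot => Φ = single i .bot ∧ L = fun _ => []
  | .wth => ∃ A B, Φ = single i (.wth A B) ∧ L = fun b => cond b [B] [A]
  | .plus .fst => ∃ A B, Φ = single i (.plus A B) ∧ L = fun _ => [A]
  | .plus .snd => ∃ A B, Φ = single i (.plus A B) ∧ L = fun _ => [B]
  | .top => Φ = single i .top ∧ L = fun _ => []
  | .tensL q => ∃ A B, Φ i = some (.tens A B) ∧ T q (cons B (Φ.erase i)) ∧ L = fun _ => [A]
  | .tensR q => ∃ A B, Φ i = some (.tens A B) ∧ T q (cons A (Φ.erase i)) ∧ L = fun _ => [B]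

theorem Own.length {r : Head α} {i : ℕ} {Φ : Ctx α} {L : Bool → List (Formula α)}
    (h : r.Own i Φ L) (b : Bool) : (L b).length = r.k := by
  cases r with
  | plus k => cases k <;> obtain ⟨A, B, h, rfl⟩ := h <;> rfl
  | bot => obtain ⟨h, rfl⟩ := h; rfl
  | top => obtain ⟨h, rfl⟩ := h; rfl
  | parr => obtain ⟨A, B, h, rfl⟩ := h; rfl
  | wth => obtain ⟨A, B, h, rfl⟩ := h; cases b <;> rfl
  | _ => obtain ⟨A, B, h, h', rfl⟩ := h; rfl

theorem Own.ne_none {r : Head α} {i : ℕ} {Φ : Ctx α} {L : Bool → List (Formula α)}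
    (h : r.Own i Φ L) : ∃ A, Φ i = some A := by
  cases r with
  | plus k => cases k <;> obtain ⟨A, B, rfl, rfl⟩ := h <;> exact ⟨_, if_pos rfl⟩
  | bot => obtain ⟨rfl, rfl⟩ := h; exact ⟨_, if_pos rfl⟩
  | top => obtain ⟨rfl, rfl⟩ := h; exact ⟨_, if_pos rfl⟩
  | parr => obtain ⟨A, B, rfl, rfl⟩ := h; exact ⟨_, if_pos rfl⟩
  | wth => obtain ⟨A, B, rfl, rfl⟩ := h; exact ⟨_, if_pos rfl⟩
  | _ => obtain ⟨A, B, h, h', rfl⟩ := h; exact ⟨_, h⟩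

theorem Own.rename {r : Head α} {i : ℕ} {Φ Φ' : Ctx α} {L : Bool → List (Formula α)} {f : ℕ → ℕ}
    (h : r.Own i Φ L) (hf : Ren f Φ Φ') : (r.rename f).Own (f i) Φ' L := by
  cases r with
  | plus k =>
    cases k <;> obtain ⟨A, B, rfl, rfl⟩ := h <;>
    exact ⟨A, B, hf.unique (Ren.single _ _), rfl⟩
  | bot => obtain ⟨rfl, rfl⟩ := h; exact ⟨hf.unique (Ren.single _ _), rfl⟩
  | top => obtain ⟨rfl, rfl⟩ := h; exact ⟨hf.unique (Ren.single _ _), rfl⟩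
  | parr => obtain ⟨A, B, rfl, rfl⟩ := h; exact ⟨A, B, hf.unique (Ren.single _ _), rfl⟩
  | wth => obtain ⟨A, B, rfl, rfl⟩ := h; exact ⟨A, B, hf.unique (Ren.single _ _), rfl⟩
  | _ =>
    obtain ⟨A, B, h, h', rfl⟩ := h
    exact ⟨A, B, hf.map h, h'.rename ((hf.erase h).cons _), rfl⟩

end Head

/-- The rule `r` introducing `i` applies with conclusion `Γ`: it consumes `Φ`, and its premises are
`L b, Δ`. -/
structure Rule (r : Head α) (i : ℕ) (Γ Φ Δ : Ctx α) (L : Bool → List (Formula α)) (D : Finset ℕ) :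
    Prop where
  own : r.Own i Φ L
  split : Γ.Split Φ Δ
  dom : IsDom D Δ

namespace Rule

variable {r : Head α} {i : ℕ} {Γ Φ Δ : Ctx α} {L : Bool → List (Formula α)} {D : Finset ℕ}

theorem erase_single {A : Formula α} (h : Γ.Split (single i A) Δ) : Γ.erase i = Δ := by
  funext n
  have := h n
  simp only [single] at this
  simp only [erase]
  grind

theorem single_apply {A : Formula α} (h : Γ.Split (single i A) Δ) : Γ i = some A := by
  have := h i
  simp only [single] at this
  grind

theorem split_single {A : Formula α} (h : Γ i = some A) : Γ.Split (single i A) (Γ.erase i) := by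
  intro n
  simp only [single, erase]
  grind

theorem split_erase (h : Γ.Split Φ Δ) {A : Formula α} (hi : Φ i = some A) :
    Γ i = some A ∧ (Γ.erase i).Split (Φ.erase i) Δ := by
  constructor
  · have := h i; grind
  · intro n; have := h n; simp only [erase]; grind

theorem split_comm (h : Γ.Split Φ Δ) : Γ.Split Δ Φ := by
  intro n; have := h n; grind

theorem derives (h : Rule r i Γ Φ Δ L D) {ps : Bool → PreProof α}
    (hp : ∀ b, r.Branch b → Derives (ps b) (push (L b) Δ)) : Derives (r.mk i D ps) Γ := by
  obtain ⟨ho, hs, hd⟩ := h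
  cases r with
  | parr =>
    obtain ⟨A, B, rfl, rfl⟩ := ho
    obtain rfl := erase_single hs
    exact .parr (single_apply hs) (hp false rfl)
  | bot =>
    obtain ⟨rfl, rfl⟩ := ho
    obtain rfl := erase_single hs
    exact .bot (single_apply hs) (hp false rfl)
  | wth =>
    obtain ⟨A, B, rfl, rfl⟩ := ho
    obtain rfl := erase_single hs
    exact .wth (single_apply hs) (hp false trivial) (hp true trivial)
  | plus k =>
    cases k
    · obtain ⟨A, B, rfl, rfl⟩ := ho
      obtain rfl := erase_single hs
      exact .plus₁ (single_apply hs) (hp false rfl)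
    · obtain ⟨A, B, rfl, rfl⟩ := ho
      obtain rfl := erase_single hs
      exact .plus₂ (single_apply hs) (hp false rfl)
  | top =>
    obtain ⟨rfl, rfl⟩ := ho
    obtain rfl := erase_single hs
    exact .top (single_apply hs) hd
  | tensL q =>
    obtain ⟨A, B, h, h', rfl⟩ := ho
    obtain ⟨hi, hs⟩ := split_erase hs h
    exact .tens hi (split_comm hs) (hp false rfl) h'.der
  | tensR q =>
    obtain ⟨A, B, h, h', rfl⟩ := ho
    obtain ⟨hi, hs⟩ := split_erase hs h
    exact .tens hi hs h'.der (hp false rfl)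

theorem typed (h : Rule r i Γ Φ Δ L D) {ps : Bool → PreProof α}
    (hp : ∀ b, r.Branch b → T (ps b) (push (L b) Δ)) : T (r.mk i D ps) Γ := by
  refine ⟨h.derives fun b hb => (hp b hb).der, ?_⟩
  obtain ⟨ho, hs, hd⟩ := h
  cases r with
  | wth => exact ⟨(hp false trivial).cf, (hp true trivial).cf⟩
  | top => trivial
  | tensL q => obtain ⟨A, B, h, h', rfl⟩ := ho; exact ⟨(hp false rfl).cf, h'.cf⟩
  | tensR q => obtain ⟨A, B, h, h', rfl⟩ := ho; exact ⟨h'.cf, (hp false rfl).cf⟩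
  | _ => exact (hp false rfl).cf

theorem rename (h : Rule r i Γ Φ Δ L D) {f : ℕ → ℕ} {Γ' : Ctx α} (hf : Ren f Γ Γ') :
    Rule (r.rename f) (f i) Γ' (img f Φ) (img f Δ) L (D.image f) := by
  obtain ⟨h₁, h₂, h₃⟩ := hf.split h.split
  exact ⟨h.own.rename h₁, h₃, h₂.dom h.dom⟩

end Rule

/-! ### Inversion: the last rule of a proof, and its relation to the occurrence `0` -/

/-- `p` is `r.mk i D ps`, correctly typed. -/
structure IsRule (p : PreProof α) (Γ : Ctx α) (r : Head α) (i : ℕ) (D : Finset ℕ)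
    (ps : Bool → PreProof α) (Φ Δ : Ctx α) (L : Bool → List (Formula α)) : Prop where
  eq : p = r.mk i D ps
  rule : Rule r i Γ Φ Δ L D
  prem : ∀ b, r.Branch b → T (ps b) (push (L b) Δ)

theorem Ctx.IsDom.erase {D : Finset ℕ} {Γ : Ctx α} (h : IsDom D Γ) (i : ℕ) :
    IsDom (D.erase i) (Γ.erase i) := by
  intro n; have := h n; simp only [Finset.mem_erase, Ctx.erase]; grind

/-- The last rule of a proof without `cut`-rule. -/
theorem T.cases {p : PreProof α} {Γ : Ctx α} (h : T p Γ) :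
    (∃ i j A, p = .ax s(i, j) ∧ i ≠ j ∧ Γ i = some A ∧ Γ j = some A.dual ∧
      ∀ n, n ≠ i → n ≠ j → Γ n = none) ∨
    (∃ i, p = .one i ∧ Γ i = some .one ∧ ∀ n, n ≠ i → Γ n = none) ∨
    ∃ r i D ps Φ Δ L, IsRule p Γ r i D ps Φ Δ L := by
  obtain ⟨hd, hc⟩ := h
  have hN := hd.names
  cases hd with
  | @ax _ A i j hij hi hj h => exact .inl ⟨i, j, A, rfl, hij, hi, hj, h⟩
  | cut => exact hc.elim
  | @tens _ Δ Θ A B i p q hi h hp hq =>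
    -- The right premise is taken as the fixed one, so its context is consumed together with `i`.
    -- The opposite reading is recovered by `IsRule.flip`.
    refine .inr (.inr ⟨.tensL q, i, down 1 p.names, fun _ => p,
      fun n => if n = i then Γ i else Θ n, Δ, fun _ => [A], rfl,
      ⟨⟨A, B, by simp [hi], ⟨?_, hc.2⟩, rfl⟩, ?_, ?_⟩, ?_⟩)
    · have : Ctx.erase (fun n => if n = i then Γ i else Θ n) i = Θ := by
        funext n; have := h n; simp only [Ctx.erase] at this ⊢; grind
      rwa [this]
    · intro n; have := h n; simp only [Ctx.erase] at this ⊢; grind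
    · intro n; rw [mem_down, hp.names]; simp
    · rintro b -; exact ⟨hp, hc.1⟩
  | @parr _ A B i p hi hp =>
    exact .inr (.inr ⟨.parr, i, _, fun _ => p, _, _, _, rfl,
      ⟨⟨A, B, rfl, rfl⟩, Rule.split_single hi, hN.erase i⟩, fun b _ => ⟨hp, hc⟩⟩)
  | @one _ i hi h => exact .inr (.inl ⟨i, rfl, hi, h⟩)
  | @bot _ i p hi hp =>
    exact .inr (.inr ⟨.bot, i, _, fun _ => p, _, _, _, rfl,
      ⟨⟨rfl, rfl⟩, Rule.split_single hi, hN.erase i⟩, fun b _ => ⟨hp, hc⟩⟩)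
  | @wth _ A B i p q hi hp hq =>
    refine .inr (.inr ⟨.wth, i, _, fun b => cond b q p, _, _, _, rfl,
      ⟨⟨A, B, rfl, rfl⟩, Rule.split_single hi, hN.erase i⟩, fun b _ => ?_⟩)
    cases b
    · exact ⟨hp, hc.1⟩
    · exact ⟨hq, hc.2⟩
  | @plus₁ _ A B i p hi hp =>
    exact .inr (.inr ⟨.plus .fst, i, _, fun _ => p, _, _, _, rfl,
      ⟨⟨A, B, rfl, rfl⟩, Rule.split_single hi, hN.erase i⟩, fun b _ => ⟨hp, hc⟩⟩)
  | @plus₂ _ A B i p hi hp =>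
    exact .inr (.inr ⟨.plus .snd, i, _, fun _ => p, _, _, _, rfl,
      ⟨⟨A, B, rfl, rfl⟩, Rule.split_single hi, hN.erase i⟩, fun b _ => ⟨hp, hc⟩⟩)
  | @top _ i S hi h =>
    -- A `⊤`-rule has no premise: `.one 0` is a dummy value that no branch reads.
    exact .inr (.inr ⟨.top, i, S, fun _ => .one 0, _, _, _, rfl,
      ⟨⟨rfl, rfl⟩, Rule.split_single hi, h⟩, fun b h => h.elim⟩)

theorem Ctx.ren_swap (L M : List (Formula α)) (Γ : Ctx α) :
    Ren (swapBlocks L.length M.length) (push L (push M Γ)) (push M (push L Γ)) := by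
  have hinv : ∀ a b n, swapBlocks b a (swapBlocks a b n) = n := by
    intro a b n; unfold swapBlocks; split_ifs <;> omega
  refine Ren.of_injective (fun n m e => ?_) (fun n => ?_) (fun m h => ?_)
  · rw [← hinv L.length M.length n, e, hinv]
  · simp only [push_apply, swapBlocks]
    split_ifs <;> first | omega | (congr 1; omega) | rfl
  · exact (h _ (hinv M.length L.length m)).elim

theorem Ctx.ren_sh (k : ℕ) (Γ : Ctx α) : Ren (· + k) Γ (sh k Γ) := by
  refine Ren.of_injective (fun n m e => ?_) (fun n => ?_) (fun m h => ?_)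
  · simpa using e
  · simp [sh]
  · simp only [sh, ite_eq_left_iff]
    intro hm; exact (h (m - k) (by omega)).elim

theorem T.swap {p : PreProof α} {L M : List (Formula α)} {Γ : Ctx α} {a b : ℕ}
    (h : T p (push L (push M Γ))) (ha : L.length = a) (hb : M.length = b) :
    T (p.swap a b) (push M (push L Γ)) := by
  subst ha hb; exact h.rename (ren_swap L M Γ)

theorem T.shift {p : PreProof α} {A : Formula α} {Γ : Ctx α} (h : T p (cons A Γ)) (k : ℕ) :
    T (p.shift k) (cons A (sh k Γ)) := h.rename ((ren_sh k Γ).cons A)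

theorem Ctx.Ren.id_of (Γ : Ctx α) {f : ℕ → ℕ} (h : ∀ n A, Γ n = some A → f n = n) : Ren f Γ Γ where
  map := by intro n A hA; rw [h n A hA, hA]
  back := fun {n A} hA => ⟨n, hA, h n A hA⟩
  inj := by intro n m A B hn hm e; rwa [h n A hn, h m B hm] at e

theorem Ctx.Ren.comp {f g : ℕ → ℕ} {Γ Γ' Γ'' : Ctx α} (h : Ren f Γ Γ') (h' : Ren g Γ' Γ'') :
    Ren (g ∘ f) Γ Γ'' where
  map := fun hA => h'.map (h.map hA)
  back := by
    intro m A hA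
    obtain ⟨n, hn, rfl⟩ := h'.back hA
    obtain ⟨l, hl, rfl⟩ := h.back hn
    exact ⟨l, hl, rfl⟩
  inj := fun hn hm e => h.inj hn hm (h'.inj (h.map hn) (h.map hm) e)

theorem Ctx.ren_pred {Γ : Ctx α} (h : Γ 0 = none) : Ren Nat.pred Γ (fun n => Γ (n + 1)) where
  map := by rintro (_ | n) A hA <;> simp_all
  back := by intro m A hA; exact ⟨m + 1, hA, rfl⟩
  inj := by rintro (_ | n) (_ | m) A B hn hm e <;> simp_all

theorem T.rename_eq {p : PreProof α} {Γ : Ctx α} {f g : ℕ → ℕ} (h : T p Γ)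
    (hf : ∀ n A, Γ n = some A → f n = g n) : p.rename f = p.rename g := by
  refine rename_congr fun n hn => ?_
  obtain ⟨A, hA⟩ := Option.ne_none_iff_exists'.1 ((h.names n).1 hn)
  exact hf n A hA

theorem T.rename_eq_self {p : PreProof α} {Γ : Ctx α} {f : ℕ → ℕ} (h : T p Γ)
    (hf : ∀ n A, Γ n = some A → f n = n) : p.rename f = p :=
  (h.rename_eq hf).trans (rename_id p)

/-- An occurrence that is not in `Γ` disappears by renaming. -/
theorem T.exists_rename_succ {p : PreProof α} {Γ : Ctx α} {L : List (Formula α)}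
    (h : T p (push L Γ)) (h0 : Γ 0 = none) {k : ℕ} (hk : L.length = k) :
    ∃ p', T p' (push L fun n => Γ (n + 1)) ∧ p = p'.rename (liftN k (· + 1)) := by
  subst hk
  refine ⟨_, h.rename ((ren_pred h0).push L), ?_⟩
  rw [PreProof.rename_rename]
  refine (h.rename_eq_self fun n A hA => ?_).symm
  rw [push_apply] at hA
  simp only [liftN, Function.comp]
  split_ifs at hA ⊢ with h₁ h₂
  · rfl
  · simp at h₂
  · obtain ⟨m, hm⟩ : ∃ m, n - L.length = m + 1 := by
      cases e : n - L.length with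
      | zero => rw [e, h0] at hA; simp at hA
      | succ m => exact ⟨m, rfl⟩
    simp [hm]; omega

/-- Proofs whose last rule introduces the occurrence `0`, which is `A`. -/
inductive Princ : Formula α → Ctx α → PreProof α → Prop
  | tens {A B Δ Δ₁ Δ₂ p₁ p₂} (h : Δ.Split Δ₁ Δ₂) (h₁ : T p₁ (cons A Δ₁)) (h₂ : T p₂ (cons B Δ₂)) :
      Princ (.tens A B) Δ (.tens 0 (p₁.shift 1) (p₂.shift 1))
  | parr {A B Δ p} (h : T p (cons A (cons B Δ))) :
      Princ (.parr A B) Δ (.parr 0 (p.rename (lift (lift (· + 1)))))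
  | one : Princ .one (fun _ => none) (.one 0)
  | bot {Δ p} (h : T p Δ) : Princ .bot Δ (.bot 0 (p.rename (· + 1)))
  | wth {A B Δ p₁ p₂} (h₁ : T p₁ (cons A Δ)) (h₂ : T p₂ (cons B Δ)) :
      Princ (.wth A B) Δ (.wth 0 (p₁.shift 1) (p₂.shift 1))
  | plus₁ {A B Δ p} (h : T p (cons A Δ)) : Princ (.plus A B) Δ (.plus .fst 0 (p.shift 1))
  | plus₂ {A B Δ p} (h : T p (cons B Δ)) : Princ (.plus A B) Δ (.plus .snd 0 (p.shift 1))
  | top {Δ : Ctx α} {D} (h : IsDom D Δ) : Princ .top Δ (.top 0 (D.image (· + 1)))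

/-- `p` ends with the rule `r`, which does not introduce the occurrence `0`. -/
structure IsSide (p : PreProof α) (A : Formula α) (Γ : Ctx α) (r : Head α) (i : ℕ) (D : Finset ℕ)
    (ps : Bool → PreProof α) (Φ Δ : Ctx α) (L : Bool → List (Formula α)) : Prop where
  eq : p = r.mk0 i D ps
  rule : Rule r i Γ Φ Δ L D
  prem : ∀ b, r.Branch b → T (ps b) (cons A (push (L b) Δ))

theorem Head.Own.rename_eq {r : Head α} {i : ℕ} {Φ : Ctx α} {L : Bool → List (Formula α)}
    {f g : ℕ → ℕ} (h : r.Own i Φ L) (hf : ∀ n A, Φ n = some A → f n = g n) :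
    r.rename f = r.rename g := by
  cases r with
  | tensL q | tensR q =>
    obtain ⟨A, B, h, h', rfl⟩ := h
    simp only [Head.rename]
    congr 1
    refine h'.rename_eq ?_
    rintro (_ | n) C hC
    · rfl
    · simp only [lift, cons_succ, Ctx.erase] at hC ⊢
      split_ifs at hC
      rw [hf n C hC]
  | _ => rfl

theorem Head.rename_id (r : Head α) : r.rename id = r := by
  cases r <;> simp [Head.rename, lift_id, PreProof.rename_id]

/-- A rule other than `⊗` consumes nothing but the formula it introduces; a `⊗`-rule also consumes
the context of its fixed premise. -/
theorem Head.Own.zero {r : Head α} {i n : ℕ} {Φ : Ctx α} {A : Formula α}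
    {L : Bool → List (Formula α)} (h : r.Own i Φ L) (hn : Φ n = some A) (hi : n ≠ i) :
    (∃ q, r = .tensL q) ∨ ∃ q, r = .tensR q := by
  cases r with
  | plus k => cases k <;> obtain ⟨A, B, rfl, rfl⟩ := h <;> simp [single, hi] at hn
  | bot => obtain ⟨rfl, rfl⟩ := h; simp [single, hi] at hn
  | top => obtain ⟨rfl, rfl⟩ := h; simp [single, hi] at hn
  | parr => obtain ⟨A, B, rfl, rfl⟩ := h; simp [single, hi] at hn
  | wth => obtain ⟨A, B, rfl, rfl⟩ := h; simp [single, hi] at hn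
  | tensL q => exact .inl ⟨q, rfl⟩
  | tensR q => exact .inr ⟨q, rfl⟩

theorem Rule.uncons {r : Head α} {i : ℕ} {A : Formula α} {Γ Φ Δ : Ctx α}
    {L : Bool → List (Formula α)} {D : Finset ℕ} (h : Rule r (i + 1) (cons A Γ) Φ Δ L D)
    (h0 : Φ 0 = none) :
    Rule (r.rename Nat.pred) i Γ (fun n => Φ (n + 1)) (fun n => Δ (n + 1)) L (down 1 D) ∧
      cons A (fun n => Δ (n + 1)) = Δ ∧ up 1 (down 1 D) = D ∧
      (r.rename Nat.pred).rename (· + 1) = r := by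
  obtain ⟨ho, hs, hd⟩ := h
  have hΔ : Δ 0 = some A := by have := hs 0; simp only [cons_zero] at this; grind
  refine ⟨⟨ho.rename (ren_pred h0), fun n => hs (n + 1), fun n => ?_⟩, cons_eta hΔ, ?_, ?_⟩
  · rw [mem_down, hd]
  · ext n
    rcases n with _ | n
    · simp [hd 0, hΔ]
    · simp
  · rw [Head.rename_rename]
    refine (ho.rename_eq (g := id) ?_).trans (Head.rename_id r)
    rintro (_ | n) B hB
    · simp [h0] at hB
    · rfl

/-- An occurrence consumed without being introduced lies in the fixed premise of a `⊗`-rule. Fixing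
the other premise instead puts this occurrence in the context of the premise on which the rule
operates. -/
theorem IsRule.flip {p : PreProof α} {Γ : Ctx α} {r : Head α} {i : ℕ} {D : Finset ℕ}
    {ps : Bool → PreProof α} {Φ Δ : Ctx α} {L : Bool → List (Formula α)}
    (h : IsRule p Γ r i D ps Φ Δ L) {n : ℕ} {A : Formula α} (hn : Φ n = some A) (hi : n ≠ i) :
    ∃ r' D' ps' Φ' Δ' L', IsRule p Γ r' i D' ps' Φ' Δ' L' ∧ Φ' n = none := by
  obtain ⟨rfl, ⟨ho, hs, hd⟩, hp⟩ := h
  rcases ho.zero hn hi with ⟨q, rfl⟩ | ⟨q, rfl⟩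
  all_goals
    obtain ⟨B, C, h, h', rfl⟩ := ho
    have hs' : Γ.Split (fun n => if n = i then Φ n else Δ n) (Φ.erase i) := by
      intro n; have := hs n; simp only [erase]; grind
    have he : Ctx.erase (fun n => if n = i then Φ n else Δ n) i = Δ := by
      funext n; have := hs n; simp only [erase]; grind
    have hΦ : (if n = i then Φ n else Δ n) = none := by have := hs n; grind
    have hd' : IsDom (down 1 q.names) (Φ.erase i) := fun n => by rw [mem_down, h'.names]; simp
  · refine ⟨.tensR (ps false), _, fun _ => q, _, _, _,
      ⟨rfl, ⟨⟨B, C, by simp [h], ?_, rfl⟩, hs', hd'⟩, fun b _ => h'⟩, hΦ⟩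
    rw [he]; exact hp false rfl
  · refine ⟨.tensL (ps false), _, fun _ => q, _, _, _,
      ⟨rfl, ⟨⟨B, C, by simp [h], ?_, rfl⟩, hs', hd'⟩, fun b _ => h'⟩, hΦ⟩
    rw [he]; exact hp false rfl

theorem PreProof.swap_swap (a b : ℕ) (p : PreProof α) : (p.swap a b).swap b a = p := by
  rw [PreProof.swap, PreProof.swap, PreProof.rename_rename]
  convert PreProof.rename_id p using 2
  funext n; simp only [Function.comp, swapBlocks, id]; split_ifs <;> omega

/-- A rule whose part of the conclusion does not contain the occurrence `0`. -/
theorem IsRule.side {p : PreProof α} {A : Formula α} {Γ : Ctx α} {r : Head α} {i : ℕ} {D : Finset ℕ}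
    {ps : Bool → PreProof α} {Φ Δ : Ctx α} {L : Bool → List (Formula α)}
    (h : IsRule p (cons A Γ) r (i + 1) D ps Φ Δ L) (h0 : Φ 0 = none) :
    IsSide p A Γ (r.rename Nat.pred) i (down 1 D) (fun b => (ps b).swap r.k 1)
      (fun n => Φ (n + 1)) (fun n => Δ (n + 1)) L := by
  obtain ⟨rfl, hr, hp⟩ := h
  obtain ⟨h₁, h₂, h₃, h₄⟩ := hr.uncons h0
  refine ⟨?_, h₁, fun b hb => ?_⟩
  · rw [Head.mk0, h₃, h₄]
    simp [swap_swap]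
  · rw [Head.branch_rename] at hb
    have := hp b hb
    rw [← h₂] at this
    exact this.swap (M := [A]) (hr.own.length b) rfl

theorem T.shift_of {p : PreProof α} {A : Formula α} {Γ : Ctx α} (h : T p (cons A Γ))
    (h0 : Γ 0 = none) : ∃ p', T p' (cons A fun n => Γ (n + 1)) ∧ p = p'.shift 1 := by
  obtain ⟨p', hp, e⟩ := T.exists_rename_succ (L := [A]) h h0 rfl
  exact ⟨p', hp, by rw [e, PreProof.shift, ← liftN_one]; rfl⟩

/-- The occurrence `0` is consumed, hence absent from the contexts of the premises. So these are
shifted proofs, which is the form that the key cases require. -/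
theorem IsRule.princ {p : PreProof α} {A : Formula α} {Γ : Ctx α} {r : Head α} {D : Finset ℕ}
    {ps : Bool → PreProof α} {Φ Δ : Ctx α} {L : Bool → List (Formula α)}
    (h : IsRule p (cons A Γ) r 0 D ps Φ Δ L) : Princ A Γ p := by
  obtain ⟨rfl, ⟨ho, hs, hd⟩, hp⟩ := h
  have hΔ : Δ 0 = none := by
    obtain ⟨B, hB⟩ := ho.ne_none; have := hs 0; grind
  have key : ∀ C, Φ = single 0 C → A = C ∧ (fun n => Δ (n + 1)) = Γ := by
    rintro C rfl
    have h₁ := Rule.single_apply hs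
    have h₂ := Rule.erase_single hs
    refine ⟨by simpa using h₁, ?_⟩
    funext n; rw [← h₂]; simp [erase]
  cases r with
  | parr =>
    obtain ⟨B, C, rfl, rfl⟩ := ho
    obtain ⟨rfl, e⟩ := key _ rfl
    obtain ⟨p', hp', e'⟩ := T.exists_rename_succ (hp false rfl) hΔ rfl
    rw [e] at hp'
    simp only [Head.mk, e', List.length_cons, List.length_nil, zero_add, Nat.reduceAdd,
      liftN_two]
    exact .parr hp'
  | bot =>
    obtain ⟨rfl, rfl⟩ := ho
    obtain ⟨rfl, e⟩ := key _ rfl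
    obtain ⟨p', hp', e'⟩ := T.exists_rename_succ (hp false rfl) hΔ rfl
    rw [e] at hp'
    simp only [Head.mk, e', List.length_nil, liftN_zero]
    exact .bot hp'
  | wth =>
    obtain ⟨B, C, rfl, rfl⟩ := ho
    obtain ⟨rfl, e⟩ := key _ rfl
    obtain ⟨p', hp', e'⟩ := T.shift_of (Γ := Δ) (hp false trivial) hΔ
    obtain ⟨p'', hp'', e''⟩ := T.shift_of (Γ := Δ) (hp true trivial) hΔ
    rw [e] at hp' hp''
    simp only [Head.mk, e', e'']
    exact .wth hp' hp''
  | plus k =>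
    cases k
    · obtain ⟨B, C, rfl, rfl⟩ := ho
      obtain ⟨rfl, e⟩ := key _ rfl
      obtain ⟨p', hp', e'⟩ := T.shift_of (Γ := Δ) (hp false rfl) hΔ
      rw [e] at hp'
      simp only [Head.mk, e']
      exact .plus₁ hp'
    · obtain ⟨B, C, rfl, rfl⟩ := ho
      obtain ⟨rfl, e⟩ := key _ rfl
      obtain ⟨p', hp', e'⟩ := T.shift_of (Γ := Δ) (hp false rfl) hΔ
      rw [e] at hp'
      simp only [Head.mk, e']
      exact .plus₂ hp'
  | top =>
    obtain ⟨rfl, rfl⟩ := ho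
    obtain ⟨rfl, e⟩ := key _ rfl
    have : D = (down 1 D).image (· + 1) := by
      ext n
      simp only [Finset.mem_image, mem_down]
      constructor
      · intro hn
        rcases n with _ | n
        · exact ((hd 0).1 hn hΔ).elim
        · exact ⟨n, hn, rfl⟩
      · rintro ⟨n, hn, rfl⟩; exact hn
    rw [Head.mk, this]
    exact .top fun n => by rw [mem_down, hd, ← e]
  | tensL q | tensR q =>
    obtain ⟨B, C, h, h', rfl⟩ := ho
    have hA : A = B.tens C := by have := hs 0; simp only [cons_zero] at this; grind
    subst hA
    obtain ⟨p', hp', e'⟩ := T.shift_of (Γ := Δ) (hp false rfl) hΔ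
    obtain ⟨p'', hp'', e''⟩ := T.shift_of h' (by simp [erase])
    simp only [Head.mk, e', e'']
    refine .tens ?_ (by assumption) (by assumption)
    intro n
    have := hs (n + 1)
    simp only [cons_succ] at this
    simp only [erase]
    grind

/-- The last rule of a proof without `cut`-rule, with respect to the occurrence `0`. -/
theorem T.cases_zero {p : PreProof α} {A : Formula α} {Γ : Ctx α} (h : T p (cons A Γ)) :
    (∃ i, p = .ax s(0, i + 1) ∧ Γ = single i A.dual) ∨
    (∃ r i D ps Φ Δ L, IsSide p A Γ r i D ps Φ Δ L) ∨ Princ A Γ p := by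
  rcases h.cases with ⟨i, j, B, rfl, hij, hi, hj, hn⟩ | ⟨i, rfl, hi, hn⟩ |
    ⟨r, i, D, ps, Φ, Δ, L, hr⟩
  · left
    rcases i with _ | i
    · obtain ⟨j, rfl⟩ := Nat.exists_eq_succ_of_ne_zero (Ne.symm hij)
      obtain rfl : A = B := by simpa using hi
      refine ⟨j, rfl, funext fun n => ?_⟩
      simp only [single]
      split_ifs with e
      · subst e; exact hj
      · exact hn (n + 1) (by omega) (by omega)
    · rcases j with _ | j
      · obtain rfl : A = B.dual := by simpa using hj
        refine ⟨i, by rw [Sym2.eq_swap], funext fun n => ?_⟩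
        simp only [single, Formula.dual_dual]
        split_ifs with e
        · subst e; exact hi
        · exact hn (n + 1) (by omega) (by omega)
      · exact absurd (hn 0 (by omega) (by omega)) (by simp)
  · right; right
    rcases i with _ | i
    · obtain rfl : A = .one := by simpa using hi
      obtain rfl : Γ = fun _ => none := funext fun n => hn (n + 1) (by omega)
      exact .one
    · exact absurd (hn 0 (by omega)) (by simp)
  · right
    rcases i with _ | i
    · exact .inr hr.princ
    · left
      cases h0 : Φ 0 with
      | none => exact ⟨_, _, _, _, _, _, _, hr.side h0⟩
      | some C =>
        obtain ⟨r', D', ps', Φ', Δ', L', hr', h0'⟩ := hr.flip h0 (by omega)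
        exact ⟨_, _, _, _, _, _, _, hr'.side h0'⟩

/-! ### Admissibility of the cut rule -/

/-- The number of connectives. -/
def Formula.size : Formula α → ℕ
  | .tens A B => A.size + B.size + 1
  | .parr A B => A.size + B.size + 1
  | .wth A B => A.size + B.size + 1
  | .plus A B => A.size + B.size + 1
  | _ => 0

@[simp] theorem Formula.size_dual (A : Formula α) : A.dual.size = A.size := by
  induction A <;> simp_all [Formula.dual, Formula.size, add_comm]

/-- What the last rule of a proof does with the occurrence `0`. -/
inductive View (α : Type u) : Type u
  | ax (i : ℕ)
  | side (r : Head α) (i : ℕ) (D : Finset ℕ) (ps : Bool → PreProof α)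
  | other

open Classical in
/-- The last rule of a proof, with respect to the occurrence `0`. -/
noncomputable def view : PreProof α → View α
  | .ax e => if h : ∃ i, e = s(0, i + 1) then .ax h.choose else .other
  -- The set of names is read by `Head.mk` only for a `⊤`-rule, so `∅` is a default value for all
  -- other rules. The exchange brings the cut formula back to the name `0` in the premise.
  | .parr (i + 1) p => .side .parr i ∅ fun _ => p.swap 2 1
  | .bot (i + 1) p => .side .bot i ∅ fun _ => p
  | .wth (i + 1) p q => .side .wth i ∅ fun b => cond b (q.swap 1 1) (p.swap 1 1)
  | .plus k (i + 1) p => .side (.plus k) i ∅ fun _ => p.swap 1 1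
  | .top (i + 1) S => .side .top i (down 1 S) fun _ => .one 0
  | .tens (i + 1) p q =>
    -- The occurrence `0` of the conclusion is called `1` in the premises; this test finds the
    -- premise that contains it, and the other premise becomes the fixed one.
    if 1 ∈ p.names then .side (.tensL (q.rename (lift Nat.pred))) i ∅ fun _ => p.swap 1 1
    else .side (.tensR (p.rename (lift Nat.pred))) i ∅ fun _ => q.swap 1 1
  | _ => .other

theorem view_size {p : PreProof α} {r : Head α} {i : ℕ} {D : Finset ℕ} {ps : Bool → PreProof α}
    (h : view p = .side r i D ps) (b : Bool) : (ps b).sz < p.sz := by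
  unfold view at h
  split at h
  case h_1 => split_ifs at h
  case h_7 =>
    split_ifs at h
    all_goals
      simp only [View.side.injEq] at h
      obtain ⟨-, -, -, rfl⟩ := h
      simp [sz]
  case h_8 => simp at h
  all_goals
    simp only [View.side.injEq] at h
    obtain ⟨-, -, -, rfl⟩ := h
    cases b <;> simp [sz]

/-- The cuts that replace a cut between two rules that introduce the cut formula. -/
inductive Key (α : Type u) : Type u
  | zero (p : PreProof α)
  | one (A : Formula α) (p q : PreProof α)
  | two (A : Formula α) (p : PreProof α) (B : Formula α) (q r : PreProof α)

/-- The key case for a cut on `A` between `p` and `q`. -/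
def key : Formula α → PreProof α → PreProof α → Key α
  | .tens A B, .tens _ p₁ p₂, .parr _ p₃ =>
    .two A (p₁.rename (lift Nat.pred)) B ((p₂.rename (lift Nat.pred)).shift 1)
      (p₃.rename (lift (lift Nat.pred)))
  | .parr B A, .parr _ p₃, .tens _ p₁ p₂ =>
    .two A.dual (p₁.rename (lift Nat.pred)) B.dual ((p₂.rename (lift Nat.pred)).shift 1)
      (p₃.rename (lift (lift Nat.pred)))
  | .wth _ B, .wth _ _ p₂, .plus .fst _ p₃ =>
    .one B (p₂.rename (lift Nat.pred)) (p₃.rename (lift Nat.pred))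
  | .wth A _, .wth _ p₁ _, .plus .snd _ p₃ =>
    .one A (p₁.rename (lift Nat.pred)) (p₃.rename (lift Nat.pred))
  | .plus B _, .plus .fst _ p₃, .wth _ _ p₂ =>
    .one B.dual (p₂.rename (lift Nat.pred)) (p₃.rename (lift Nat.pred))
  | .plus _ A, .plus .snd _ p₃, .wth _ p₁ _ =>
    .one A.dual (p₁.rename (lift Nat.pred)) (p₃.rename (lift Nat.pred))
  | _, .one _, .bot _ p => .zero (p.rename Nat.pred)
  | _, .bot _ p, .one _ => .zero (p.rename Nat.pred)
  -- Default value that makes `key` total; it is not reached by two typed proofs that introduce dual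
  -- formulas.
  | _, p, _ => .zero p

theorem key_one_size {A B : Formula α} {p q p' q' : PreProof α} (h : key A p q = .one B p' q') :
    B.size < A.size := by
  unfold key at h
  split at h <;> simp only [Key.one.injEq, reduceCtorEq] at h <;> obtain ⟨rfl, -⟩ := h <;>
    simp [Formula.size]

theorem key_two_size {A B C : Formula α} {p q p' q' r' : PreProof α}
    (h : key A p q = .two B p' C q' r') : B.size < A.size ∧ C.size < A.size := by
  unfold key at h
  split at h <;> simp only [Key.two.injEq, reduceCtorEq] at h <;> obtain ⟨rfl, -, rfl, -⟩ := h <;>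
    simp [Formula.size]

/-- The elimination of a cut on `A` between two proofs without `cut`-rule. -/
noncomputable def elim (A : Formula α) (p q : PreProof α) : PreProof α :=
  -- Order of preference: axioms, a rule of the left premise, a rule of the right premise, and the
  -- key case when both premises introduce the cut formula. Preferring the left makes it an equality
  -- that rules of the left premise go below the cut (`elim_mk0`); for the right premise this holds
  -- in general only up to commutations (`elim_side_right`).
  match _hq : view q, _hp : view p with
  | .ax j, _ => p.rename (contract j)
  | _, .ax i => q.rename (contract i)
  | _, .side r i D ps => r.mk i (D ∪ down 1 q.names) fun b => elim A (ps b) (q.shift r.k)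
  | .side s j D qs, .other => s.mk j (D ∪ down 1 p.names) fun b => elim A (p.shift s.k) (qs b)
  | .other, .other =>
    match _h : key A p q with
    | .zero p => p
    | .one B p q => elim B p q
    | .two B p C q r => elim B p (elim C q r)
termination_by (A.size, p.sz + q.sz)
decreasing_by
  · apply Prod.Lex.right; simpa using view_size _hp b
  · apply Prod.Lex.right; simpa using view_size _hq b
  · apply Prod.Lex.left; exact key_one_size _h
  · apply Prod.Lex.left; exact (key_two_size _h).2
  · apply Prod.Lex.left; exact (key_two_size _h).1

theorem view_ax (i : ℕ) : view (.ax s(0, i + 1) : PreProof α) = .ax i := by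
  have h : ∃ j, s(0, i + 1) = s(0, j + 1) := ⟨i, rfl⟩
  have := Nat.succ.inj (Sym2.congr_right.1 h.choose_spec)
  rw [view, dif_pos h, ← this]

theorem eq_of_view_ax {p : PreProof α} {i : ℕ} (h : view p = .ax i) : p = .ax s(0, i + 1) := by
  unfold view at h
  split at h
  case h_1 e =>
    split_ifs at h with he
    simp only [View.ax.injEq] at h
    rw [← h, ← he.choose_spec]
  case h_7 => split_ifs at h
  all_goals simp at h

theorem elim_ax_right (A : Formula α) (p : PreProof α) (j : ℕ) :
    elim A p (.ax s(0, j + 1)) = p.rename (contract j) := by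
  have hj := view_ax (α := α) j
  rw [elim]; split <;> simp_all

theorem elim_ax_left (A : Formula α) (q : PreProof α) (i : ℕ) :
    elim A (.ax s(0, i + 1)) q = q.rename (contract i) := by
  have hi := view_ax (α := α) i
  rw [elim]; split
  · rename_i j h
    -- Both premises are axioms: the first equation of `elim` renames the left one, which gives the
    -- same axiom.
    rw [eq_of_view_ax h]
    simp [PreProof.rename, contract, Sym2.eq_swap]
  all_goals simp_all

theorem elim_of_view_side {A : Formula α} {p q : PreProof α} {r : Head α} {i : ℕ} {D : Finset ℕ}
    {ps : Bool → PreProof α} (hp : view p = .side r i D ps) (hq : ∀ j, view q ≠ .ax j) :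
    elim A p q = r.mk i (D ∪ down 1 q.names) fun b => elim A (ps b) (q.shift r.k) := by
  rw [elim]; split <;> simp_all

theorem elim_of_view_other {A : Formula α} {p q : PreProof α} {r : Head α} {i : ℕ} {D : Finset ℕ}
    {ps : Bool → PreProof α} (hp : view p = .other) (hq : view q = .side r i D ps) :
    elim A p q = r.mk i (D ∪ down 1 p.names) fun b => elim A (p.shift r.k) (ps b) := by
  rw [elim]; split <;> simp_all

theorem elim_of_key {A : Formula α} {p q : PreProof α} (hp : view p = .other)
    (hq : view q = .other) : elim A p q =
    match key A p q with
    | .zero p => p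
    | .one B p q => elim B p q
    | .two B p C q r => elim B p (elim C q r) := by
  rw [elim]; split <;> simp_all
  split <;> simp_all

theorem Head.mk_congr_dom {r : Head α} {i : ℕ} {D D' : Finset ℕ} {ps ps' : Bool → PreProof α}
    (hD : r = .top → D = D') (h : ∀ b, r.Branch b → ps b = ps' b) :
    r.mk i D ps = r.mk i D' ps' := by
  cases r <;> simp_all [Branch, mk]

theorem contract_apply (i n : ℕ) : contract i n = if n = 0 then i else n - 1 := by
  cases n <;> simp [contract]

theorem PreProof.swap_zero_right (a : ℕ) (p : PreProof α) : p.swap a 0 = p := by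
  convert PreProof.rename_id p using 1
  rw [PreProof.swap]; congr 1; funext n; simp only [swapBlocks, id]; split_ifs <;> omega

theorem one_mem_names_swap {p : PreProof α} (h : 0 ∈ p.names) : 1 ∈ (p.swap 1 1).names := by
  rw [PreProof.swap, names_rename]
  exact Finset.mem_image.2 ⟨0, h, rfl⟩

theorem one_not_mem_names_shift (p : PreProof α) : 1 ∉ (p.shift 1).names := by
  rw [PreProof.shift, names_rename]
  intro h
  obtain ⟨_ | n, -, e⟩ := Finset.mem_image.1 h <;> simp [lift] at e

theorem rename_lift_pred_shift (p : PreProof α) : (p.shift 1).rename (lift Nat.pred) = p := by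
  rw [PreProof.shift, PreProof.rename_rename, lift_comp]
  exact (PreProof.rename_congr fun n _ => congrFun lift_id n).trans (rename_id p)

/-- Inverse of `Head.mk0`, up to the data that `Head.mk` ignores: the set of names when the rule is
not `⊤`, and the values outside its branches. The hypothesis is what makes the test of `view` on a
`⊗`-rule succeed. -/
theorem view_mk0 {r : Head α} {i : ℕ} {D : Finset ℕ} {ps : Bool → PreProof α}
    (h : ∀ b, r.Branch b → 0 ∈ (ps b).names) :
    ∃ D' ps', view (r.mk0 i D ps) = .side r i D' ps' ∧ (r = .top → D' = D) ∧
      ∀ b, r.Branch b → ps' b = ps b := by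
  cases r with
  | tensL q =>
    have h₁ := one_mem_names_swap (h false rfl)
    refine ⟨∅, fun _ => ((ps false).swap 1 1).swap 1 1, ?_, by simp, ?_⟩
    · simp only [Head.mk0, Head.mk, Head.rename, view, Head.k, h₁, if_true]
      rw [← PreProof.shift, rename_lift_pred_shift]
    · rintro _ rfl; exact swap_swap _ _ _
  | tensR q =>
    have h₁ := one_not_mem_names_shift q
    refine ⟨∅, fun _ => ((ps false).swap 1 1).swap 1 1, ?_, by simp, ?_⟩
    · simp only [Head.mk0, Head.mk, Head.rename, view, Head.k]
      rw [PreProof.shift] at h₁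
      rw [if_neg h₁, ← PreProof.shift, rename_lift_pred_shift]
    · rintro _ rfl; exact swap_swap _ _ _
  | top =>
    refine ⟨_, _, rfl, fun _ => ?_, fun b hb => hb.elim⟩
    ext n; simp
  | bot =>
    refine ⟨_, _, rfl, by simp, ?_⟩
    rintro _ rfl
    exact swap_zero_right _ _
  | wth =>
    refine ⟨_, _, rfl, by simp, ?_⟩
    rintro (_ | _) - <;> exact swap_swap _ _ _
  | _ =>
    refine ⟨_, _, rfl, by simp, ?_⟩
    rintro _ rfl; exact swap_swap _ _ _

theorem PreProof.ax_shift (j k : ℕ) :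
    (PreProof.ax s(0, j + 1) : PreProof α).shift k = .ax s(0, j + k + 1) := by
  simp [PreProof.shift, PreProof.rename, lift]

/-- A cut against an axiom is a renaming, and a renaming goes through a rule. Thus the equation of
`elim_mk0` has no exception for an axiom in the right premise, although `elim` treats axioms first.
-/
theorem Head.mk0_rename_contract (r : Head α) (i : ℕ) (D : Finset ℕ) (ps : Bool → PreProof α)
    (j : ℕ) : (r.mk0 i D ps).rename (contract j) =
      r.mk i (D ∪ down 1 (PreProof.ax s(0, j + 1) : PreProof α).names) fun b =>
        (ps b).rename (contract (j + r.k)) := by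
  rw [Head.mk0, Head.rename_mk, Head.rename_rename]
  have h₁ : (contract j ∘ fun x => x + 1) = id := by funext n; rfl
  have h₂ : Finset.image (contract j) (up 1 D) =
      D ∪ down 1 (PreProof.ax s(0, j + 1) : PreProof α).names := by
    ext n
    simp only [Finset.mem_image, mem_up, Finset.mem_union, mem_down, PreProof.names,
      Sym2.mem_toFinset, Sym2.mem_iff]
    constructor
    · rintro ⟨_ | m, h, rfl⟩
      · right; simp [contract]
      · left; simpa [contract] using h
    · rintro (h | h)
      · exact ⟨n + 1, by simpa using h, rfl⟩
      · exact ⟨0, by simp, by simp [contract]; omega⟩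
  rw [h₁, Head.rename_id, h₂]
  refine Head.mk_congr fun b _ => ?_
  rw [swap, PreProof.rename_rename, Head.k_rename]
  congr 1
  funext n
  simp only [Function.comp, swapBlocks, liftN]
  simp only [contract_apply]
  split_ifs <;> omega

/-- A rule that does not introduce the cut formula of the left premise goes below the cut. -/
theorem elim_mk0 {A : Formula α} {r : Head α} {i : ℕ} {D : Finset ℕ} {ps : Bool → PreProof α}
    (q : PreProof α) (h : ∀ b, r.Branch b → 0 ∈ (ps b).names) :
    elim A (r.mk0 i D ps) q = r.mk i (D ∪ down 1 q.names) fun b => elim A (ps b) (q.shift r.k) := by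
  by_cases hq : ∃ j, view q = .ax j
  · obtain ⟨j, hj⟩ := hq
    obtain rfl := eq_of_view_ax hj
    simp only [elim_ax_right, ax_shift, Head.mk0_rename_contract]
  · push Not at hq
    obtain ⟨D', ps', h₁, h₂, h₃⟩ := view_mk0 (i := i) (D := D) h
    rw [elim_of_view_side h₁ hq]
    exact Head.mk_congr_dom (fun e => by rw [h₂ e]) fun b hb => by rw [h₃ b hb]

theorem Princ.view {A : Formula α} {Γ : Ctx α} {p : PreProof α} (h : Princ A Γ p) :
    view p = .other := by cases h <;> rfl

theorem Princ.typed {A : Formula α} {Γ : Ctx α} {p : PreProof α} (h : Princ A Γ p) :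
    T p (cons A Γ) := by
  have he : ∀ (B : Formula α) (Δ : Ctx α), (cons B Δ).erase 0 = sh 1 Δ := by
    intro B Δ; funext n; cases n <;> simp [erase, sh]
  cases h with
  | @tens A B _ Δ₁ Δ₂ p₁ p₂ h h₁ h₂ =>
    refine ⟨.tens rfl (Δ := sh 1 Δ₁) (Θ := sh 1 Δ₂) ?_ (h₁.shift 1).der (h₂.shift 1).der,
      (h₁.shift 1).cf, (h₂.shift 1).cf⟩
    rw [he]
    rintro (_ | n)
    · simp [sh]
    · exact h n
  | @parr A B _ p h =>
    have := h.rename (((ren_sh 1 Γ).cons B).cons A)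
    refine ⟨.parr rfl ?_, this.cf⟩
    rw [he]; exact this.der
  | one =>
    refine ⟨.one rfl ?_, trivial⟩
    rintro (_ | n) hn
    · exact absurd rfl hn
    · rfl
  | bot h =>
    have := h.rename (ren_sh 1 Γ)
    refine ⟨.bot rfl ?_, this.cf⟩
    rw [he]; exact this.der
  | wth h₁ h₂ =>
    refine ⟨.wth rfl ?_ ?_, (h₁.shift 1).cf, (h₂.shift 1).cf⟩
    · rw [he]; exact (h₁.shift 1).der
    · rw [he]; exact (h₂.shift 1).der
  | plus₁ h => refine ⟨.plus₁ rfl ?_, (h.shift 1).cf⟩; rw [he]; exact (h.shift 1).der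
  | plus₂ h => refine ⟨.plus₂ rfl ?_, (h.shift 1).cf⟩; rw [he]; exact (h.shift 1).der
  | @top _ D h =>
    refine ⟨.top rfl ?_, trivial⟩
    rw [he]
    exact (ren_sh 1 Γ).dom h

theorem IsSide.isRule {p : PreProof α} {A : Formula α} {Γ : Ctx α} {r : Head α} {i : ℕ}
    {D : Finset ℕ} {ps : Bool → PreProof α} {Φ Δ : Ctx α} {L : Bool → List (Formula α)}
    (h : IsSide p A Γ r i D ps Φ Δ L) : IsRule p (cons A Γ) (r.rename (· + 1)) (i + 1) (up 1 D)
      (fun b => (ps b).swap 1 r.k) (sh 1 Φ) (cons A Δ) L := by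
  obtain ⟨e, ⟨ho, hs, hd⟩, hp⟩ := h
  refine ⟨e, ⟨ho.rename (ren_sh 1 Φ), ?_, ?_⟩, fun b hb => ?_⟩
  · rintro (_ | n)
    · simp [sh]
    · exact hs n
  · rintro (_ | n)
    · simp
    · simpa using hd n
  · rw [Head.branch_rename] at hb
    exact (hp b hb).swap (L := [A]) rfl (ho.length b)

theorem IsRule.typed {p : PreProof α} {Γ : Ctx α} {r : Head α} {i : ℕ}
    {D : Finset ℕ} {ps : Bool → PreProof α} {Φ Δ : Ctx α} {L : Bool → List (Formula α)}
    (h : IsRule p Γ r i D ps Φ Δ L) : T p Γ := by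
  obtain ⟨rfl, h, hp⟩ := h; exact h.typed hp

/-! ### Key cases, and induction along the elimination of a cut -/

/-- The key cases of cut-elimination. -/
inductive KeyCase : Formula α → Ctx α → Ctx α → PreProof α → PreProof α → Prop
  | tens_parr {A B Δ Δ₁ Δ₂ Θ p₁ p₂ p₃} (h : Δ.Split Δ₁ Δ₂) (h₁ : T p₁ (cons A Δ₁))
      (h₂ : T p₂ (cons B Δ₂)) (h₃ : T p₃ (cons B.dual (cons A.dual Θ))) :
      KeyCase (.tens A B) Δ Θ (.tens 0 (p₁.shift 1) (p₂.shift 1))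
        (.parr 0 (p₃.rename (lift (lift (· + 1)))))
  | wth_plus₁ {A B Δ Θ p₁ p₂ p₃} (h₁ : T p₁ (cons A Δ)) (h₂ : T p₂ (cons B Δ))
      (h₃ : T p₃ (cons B.dual Θ)) :
      KeyCase (.wth A B) Δ Θ (.wth 0 (p₁.shift 1) (p₂.shift 1)) (.plus .fst 0 (p₃.shift 1))
  | wth_plus₂ {A B Δ Θ p₁ p₂ p₃} (h₁ : T p₁ (cons A Δ)) (h₂ : T p₂ (cons B Δ))
      (h₃ : T p₃ (cons A.dual Θ)) :
      KeyCase (.wth A B) Δ Θ (.wth 0 (p₁.shift 1) (p₂.shift 1)) (.plus .snd 0 (p₃.shift 1))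
  | one_bot {Θ p} (h : T p Θ) :
      KeyCase .one (fun _ => none) Θ (.one 0) (.bot 0 (p.rename (· + 1)))

/-- Duality leaves only matching pairs of rules, up to exchanging the two premises. The `⊤` case is
void since no rule introduces `0`. -/
theorem Princ.keyCase {A : Formula α} {Δ Θ : Ctx α} {p q : PreProof α} (hp : Princ A Δ p)
    (hq : Princ A.dual Θ q) : KeyCase A Δ Θ p q ∨ KeyCase A.dual Θ Δ q p := by
  generalize hF : A.dual = F at hq ⊢
  cases hp with
  | tens h h₁ h₂ =>
    cases hq <;> simp [Formula.dual] at hF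
    obtain ⟨rfl, rfl⟩ := hF
    exact .inl (.tens_parr h h₁ h₂ (by assumption))
  | parr h =>
    cases hq <;> simp [Formula.dual] at hF
    obtain ⟨rfl, rfl⟩ := hF
    exact .inr (.tens_parr (by assumption) (by assumption) (by assumption)
      (by simpa only [Formula.dual_dual] using h))
  | one =>
    cases hq <;> simp [Formula.dual] at hF
    exact .inl (.one_bot (by assumption))
  | bot h =>
    cases hq <;> simp [Formula.dual] at hF
    exact .inr (.one_bot h)
  | wth h₁ h₂ =>
    cases hq <;> simp [Formula.dual] at hF <;> obtain ⟨rfl, rfl⟩ := hF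
    · exact .inl (.wth_plus₁ h₁ h₂ (by assumption))
    · exact .inl (.wth_plus₂ h₁ h₂ (by assumption))
  | plus₁ h =>
    cases hq <;> simp [Formula.dual] at hF; obtain ⟨rfl, rfl⟩ := hF
    exact .inr (.wth_plus₁ (by assumption) (by assumption) (by rwa [Formula.dual_dual]))
  | plus₂ h =>
    cases hq <;> simp [Formula.dual] at hF; obtain ⟨rfl, rfl⟩ := hF
    exact .inr (.wth_plus₂ (by assumption) (by assumption) (by rwa [Formula.dual_dual]))
  | top h => cases hq <;> simp [Formula.dual] at hF

theorem rename_pred_succ (p : PreProof α) : (p.rename (· + 1)).rename Nat.pred = p := by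
  rw [PreProof.rename_rename]; exact rename_id p

theorem rename_lift_lift_pred_succ (p : PreProof α) :
    (p.rename (lift (lift (· + 1)))).rename (lift (lift Nat.pred)) = p := by
  rw [PreProof.rename_rename, lift_comp, lift_comp]
  exact (PreProof.rename_congr fun n _ => congrFun (by rw [← lift_id]; exact congrArg lift lift_id) n).trans (rename_id p)

theorem elim_tens_parr (A B : Formula α) (p₁ p₂ p₃ : PreProof α) :
    elim (.tens A B) (.tens 0 (p₁.shift 1) (p₂.shift 1)) (.parr 0 (p₃.rename (lift (lift (· + 1)))))
      = elim A p₁ (elim B (p₂.shift 1) p₃) := by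
  rw [elim_of_key rfl rfl]
  simp only [key, rename_lift_pred_shift, rename_lift_lift_pred_succ]

theorem elim_wth_plus₁ (A B : Formula α) (p₁ p₂ p₃ : PreProof α) :
    elim (.wth A B) (.wth 0 (p₁.shift 1) (p₂.shift 1)) (.plus .fst 0 (p₃.shift 1))
      = elim B p₂ p₃ := by
  rw [elim_of_key rfl rfl]
  simp only [key, rename_lift_pred_shift]

theorem elim_wth_plus₂ (A B : Formula α) (p₁ p₂ p₃ : PreProof α) :
    elim (.wth A B) (.wth 0 (p₁.shift 1) (p₂.shift 1)) (.plus .snd 0 (p₃.shift 1))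
      = elim A p₁ p₃ := by
  rw [elim_of_key rfl rfl]
  simp only [key, rename_lift_pred_shift]

theorem elim_one_bot (p : PreProof α) :
    elim .one (.one 0) (.bot 0 (p.rename (· + 1))) = p := by
  rw [elim_of_key rfl rfl]
  simp only [key, rename_pred_succ]

/-- The shapes of the proofs in the key cases. -/
inductive KeyShape : Formula α → PreProof α → PreProof α → Prop
  | tens_parr {A B : Formula α} {p₁ p₂ p₃ : PreProof α} : KeyShape (.tens A B) (.tens 0 (p₁.shift 1) (p₂.shift 1))
      (.parr 0 (p₃.rename (lift (lift (· + 1)))))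
  | wth_plus₁ {A B : Formula α} {p₁ p₂ p₃ : PreProof α} : KeyShape (.wth A B) (.wth 0 (p₁.shift 1) (p₂.shift 1))
      (.plus .fst 0 (p₃.shift 1))
  | wth_plus₂ {A B : Formula α} {p₁ p₂ p₃ : PreProof α} : KeyShape (.wth A B) (.wth 0 (p₁.shift 1) (p₂.shift 1))
      (.plus .snd 0 (p₃.shift 1))
  | one_bot {p : PreProof α} : KeyShape .one (.one 0) (.bot 0 (p.rename (· + 1)))

theorem KeyCase.shape {A : Formula α} {Δ Θ : Ctx α} {p q : PreProof α}
    (h : KeyCase A Δ Θ p q) : KeyShape A p q := by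
  cases h <;> constructor

theorem PreProof.shift_rename_lift (k : ℕ) (f : ℕ → ℕ) (p : PreProof α) :
    (p.shift k).rename (lift (liftN k f)) = (p.rename (lift f)).shift k := by
  rw [PreProof.shift, PreProof.shift, PreProof.rename_rename, PreProof.rename_rename, lift_comp,
    lift_comp]
  congr 2
  funext n
  simp [liftN]

theorem PreProof.shift_one_rename (f : ℕ → ℕ) (p : PreProof α) :
    (p.shift 1).rename (lift (lift f)) = (p.rename (lift f)).shift 1 := by
  rw [← shift_rename_lift, liftN_one]

theorem PreProof.rename_lift_lift_succ_rename (f : ℕ → ℕ) (p : PreProof α) :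
    (p.rename (lift (lift (· + 1)))).rename (lift (lift (lift f))) =
      (p.rename (lift (lift f))).rename (lift (lift (· + 1))) := by
  simp only [PreProof.rename_rename, lift_comp]
  rfl

theorem PreProof.rename_succ_rename (f : ℕ → ℕ) (p : PreProof α) :
    (p.rename (· + 1)).rename (lift f) = (p.rename f).rename (· + 1) := by
  simp only [PreProof.rename_rename]
  rfl

theorem KeyShape.rename {A : Formula α} {p q : PreProof α} (h : KeyShape A p q) (f : ℕ → ℕ) :
    KeyShape A (p.rename (lift f)) (q.rename (lift f)) := by
  cases h <;> simp only [PreProof.rename, shift_one_rename, rename_lift_lift_succ_rename,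
    rename_succ_rename] <;> constructor

/-- The function `key` produces the same cuts for both orientations, so in key cases the symmetry of
the cut is a plain equality. It also reduces statements about key cases to one orientation. -/
theorem KeyShape.elim_swap {A : Formula α} {p q : PreProof α}
    (h : KeyShape A p q) : elim A.dual q p = elim A p q := by
  cases h with
  | tens_parr =>
    rw [elim_tens_parr, Formula.dual, elim_of_key rfl rfl]
    simp only [key, rename_lift_pred_shift, rename_lift_lift_pred_succ, Formula.dual_dual]
  | wth_plus₁ =>
    rw [elim_wth_plus₁, Formula.dual, elim_of_key rfl rfl]
    simp only [key, rename_lift_pred_shift, Formula.dual_dual]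
  | wth_plus₂ =>
    rw [elim_wth_plus₂, Formula.dual, elim_of_key rfl rfl]
    simp only [key, rename_lift_pred_shift, Formula.dual_dual]
  | one_bot =>
    rw [elim_one_bot, Formula.dual, elim_of_key rfl rfl]
    simp only [key, rename_pred_succ]

theorem IsSide.elim {p : PreProof α} {A : Formula α} {Γ : Ctx α} {r : Head α} {i : ℕ}
    {D : Finset ℕ} {ps : Bool → PreProof α} {Φ Δ : Ctx α} {L : Bool → List (Formula α)}
    (h : IsSide p A Γ r i D ps Φ Δ L) (B : Formula α) (q : PreProof α) :
    elim B p q =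
      r.mk i (D ∪ down 1 q.names) fun b => MALL.elim B (ps b) (q.shift r.k) := by
  obtain ⟨rfl, hr, hp⟩ := h
  exact elim_mk0 q fun b hb => ((hp b hb).names 0).2 (by simp)

/-- A rule that does not introduce the cut formula of the right premise goes below the cut. -/
theorem elim_other_mk0 {A : Formula α} {r : Head α} {i : ℕ} {D : Finset ℕ} {p : PreProof α}
    (hp : MALL.view p = .other) {qs : Bool → PreProof α}
    (h : ∀ b, r.Branch b → 0 ∈ (qs b).names) :
    MALL.elim A p (r.mk0 i D qs) =
      r.mk i (D ∪ down 1 p.names) fun b => MALL.elim A (p.shift r.k) (qs b) := by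
  obtain ⟨D', ps', h₁, h₂, h₃⟩ := view_mk0 (i := i) (D := D) h
  rw [elim_of_view_other hp h₁]
  exact Head.mk_congr_dom (fun e => by rw [h₂ e]) fun b hb => by rw [h₃ b hb]

theorem IsSide.zero_mem {p : PreProof α} {A : Formula α} {Γ : Ctx α} {r : Head α} {i : ℕ}
    {D : Finset ℕ} {ps : Bool → PreProof α} {Φ Δ : Ctx α} {L : Bool → List (Formula α)}
    (h : IsSide p A Γ r i D ps Φ Δ L) (b : Bool) (hb : r.Branch b) : 0 ∈ (ps b).names :=
  ((h.prem b hb).names 0).2 (by simp)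

theorem IsSide.typed {p : PreProof α} {A : Formula α} {Γ : Ctx α} {r : Head α} {i : ℕ}
    {D : Finset ℕ} {ps : Bool → PreProof α} {Φ Δ : Ctx α} {L : Bool → List (Formula α)}
    (h : IsSide p A Γ r i D ps Φ Δ L) : T p (cons A Γ) := h.isRule.typed

theorem IsSide.sz {p : PreProof α} {A : Formula α} {Γ : Ctx α} {r : Head α} {i : ℕ}
    {D : Finset ℕ} {ps : Bool → PreProof α} {Φ Δ : Ctx α} {L : Bool → List (Formula α)}
    (h : IsSide p A Γ r i D ps Φ Δ L) {b : Bool} (hb : r.Branch b) : (ps b).sz < p.sz := by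
  obtain ⟨rfl, -, -⟩ := h; exact Head.sz_mk0 r i D ps hb

/-- Induction along the elimination of a cut. -/
theorem elim_induction {P : Formula α → Ctx α → Ctx α → PreProof α → PreProof α → Prop}
    (ax_right : ∀ {A Δ p} j, T p (cons A Δ) → P A Δ (single j A) p (.ax s(0, j + 1)))
    (ax_left : ∀ {A Θ q} i, T q (cons A.dual Θ) → P A (single i A.dual) Θ (.ax s(0, i + 1)) q)
    (side_left : ∀ {A Δ Θ p q r i D ps Φ X L}, IsSide p A Δ r i D ps Φ X L → T q (cons A.dual Θ) →
      (∀ b, r.Branch b → P A (push (L b) X) (sh r.k Θ) (ps b) (q.shift r.k)) → P A Δ Θ p q)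
    (side_right : ∀ {A Δ Θ p q r i D qs Φ X L}, Princ A Δ p →
      IsSide q A.dual Θ r i D qs Φ X L →
      (∀ b, r.Branch b → P A (sh r.k Δ) (push (L b) X) (p.shift r.k) (qs b)) → P A Δ Θ p q)
    (key : ∀ {A Δ Θ p q}, Princ A Δ p → Princ A.dual Θ q →
      (∀ {B Δ' Θ' p' q'}, B.size < A.size → T p' (cons B Δ') → T q' (cons B.dual Θ') →
        P B Δ' Θ' p' q') → P A Δ Θ p q)
    {A : Formula α} {Δ Θ : Ctx α} {p q : PreProof α} (hp : T p (cons A Δ))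
    (hq : T q (cons A.dual Θ)) : P A Δ Θ p q := by
  -- Lexicographic induction on the size of `A` and the total size of the premises. In a key case
  -- the hypothesis must concern all proofs: for `⊗` against `⅋`, the second cut is applied to a
  -- result of `elim`, whose size is not controlled.
  induction hn : A.size using Nat.strong_induction_on generalizing A Δ Θ p q with | _ n ihA
  subst hn
  induction hn : p.sz + q.sz using Nat.strong_induction_on generalizing Δ Θ p q with | _ n ih
  subst hn
  rcases hq.cases_zero with ⟨j, rfl, rfl⟩ | hq'
  · rw [Formula.dual_dual]; exact ax_right j hp
  rcases hp.cases_zero with ⟨i, rfl, rfl⟩ | ⟨r, i, D, ps, Φ, X, L, h⟩ | hp'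
  · exact ax_left i hq
  · refine side_left h hq fun b hb => ih _ ?_ (h.prem b hb) (hq.shift _) rfl
    have := h.sz hb
    simp [this]
  · rcases hq' with ⟨r, i, D, qs, Φ, X, L, h⟩ | hq'
    · refine side_right hp' h fun b hb => ih _ ?_ (hp.shift _) (h.prem b hb) rfl
      have := h.sz hb
      simp [this]
    · exact key hp' hq' fun hB hp hq => ihA _ hB hp hq rfl

/-! ### Typing and renaming of cut-elimination -/

theorem Ctx.join_split {Γ Δ Θ : Ctx α} (h : Γ.Split Δ Θ) : Δ.join Θ = Γ := by
  funext n; have := h n; simp only [join]; grind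

theorem Ctx.split_join {Δ Θ : Ctx α} (h : ∀ n, Δ n = none ∨ Θ n = none) :
    (Δ.join Θ).Split Δ Θ := by
  intro n; have := h n; simp only [join]; grind

theorem Ctx.Split.disjoint {Γ Δ Θ : Ctx α} (h : Γ.Split Δ Θ) (n : ℕ) :
    Δ n = none ∨ Θ n = none := by
  have := h n; grind

theorem Ctx.Split.dom {Γ Δ Θ : Ctx α} {D E : Finset ℕ} (h : Γ.Split Δ Θ) (hD : IsDom D Δ)
    (hE : IsDom E Θ) : IsDom (D ∪ E) Γ := by
  intro n
  rw [Finset.mem_union, hD n, hE n]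
  have := h n; grind

/-- `Γ = Φ, X, Θ` -/
theorem Ctx.Split.assoc {Γ Δ Θ Φ X : Ctx α} (h : Γ.Split Δ Θ) (h' : Δ.Split Φ X) :
    Γ.Split Φ (X.join Θ) ∧ (X.join Θ).Split X Θ := by
  constructor <;> intro n <;> have h₁ := h n <;> have h₂ := h' n <;> simp only [join] <;> grind

theorem Ctx.Split.push_left {Γ Δ Θ : Ctx α} (h : Γ.Split Δ Θ) (L : List (Formula α)) {k : ℕ}
    (hk : L.length = k) : (push L Γ).Split (push L Δ) (sh k Θ) := by
  subst hk
  intro n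
  have := h (n - L.length)
  simp only [push_apply, sh]
  grind

theorem Ctx.Split.symm {Γ Δ Θ : Ctx α} (h : Γ.Split Δ Θ) : Γ.Split Θ Δ := Rule.split_comm h

theorem Ctx.Split.push_right {Γ Δ Θ : Ctx α} (h : Γ.Split Δ Θ) (L : List (Formula α)) {k : ℕ}
    (hk : L.length = k) : (push L Γ).Split (sh k Δ) (push L Θ) :=
  (h.symm.push_left L hk).symm

theorem Rule.join {r : Head α} {i : ℕ} {Γ Δ Θ Φ X : Ctx α} {L : Bool → List (Formula α)}
    {D E : Finset ℕ} (h : Rule r i Δ Φ X L D) (hs : Γ.Split Δ Θ) (hE : IsDom E Θ) :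
    Rule r i Γ Φ (X.join Θ) L (D ∪ E) := by
  obtain ⟨h₁, h₂⟩ := hs.assoc h.split
  exact ⟨h.own, h₁, h₂.dom h.dom hE⟩

theorem T.dom_down {p : PreProof α} {A : Formula α} {Γ : Ctx α} (h : T p (cons A Γ)) :
    IsDom (down 1 p.names) Γ := fun n => by rw [mem_down, h.names]; simp

theorem Ctx.ren_contract {Γ Δ : Ctx α} {i : ℕ} {A : Formula α} (h : Γ.Split (single i A) Δ) :
    Ren (contract i) (cons A Δ) Γ := by
  have hi := Rule.single_apply h
  have he := Rule.erase_single h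
  refine ⟨?_, ?_, ?_⟩
  · rintro (_ | n) B hB
    · simpa [contract, hi] using hB
    · rw [← he] at hB
      simp only [cons_succ, erase] at hB
      simp only [contract]
      split_ifs at hB
      exact hB
  · intro m B hB
    by_cases e : m = i
    · subst e; exact ⟨0, by simpa [hi] using hB, rfl⟩
    · exact ⟨m + 1, by rw [cons_succ, ← he]; simp [erase, e, hB], rfl⟩
  · rintro (_ | n) (_ | m) B C hn hm e
    · rfl
    · rw [← he] at hm; simp [erase, contract] at hm e; exact (hm.1 e.symm).elim
    · rw [← he] at hn; simp [erase, contract] at hn e; exact (hn.1 e).elim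
    · simpa [contract] using e

theorem KeyCase.typed {A : Formula α} {Γ Δ Θ : Ctx α} {p q : PreProof α} (h : KeyCase A Δ Θ p q)
    (hs : Γ.Split Δ Θ)
    (ih : ∀ {B : Formula α} {Γ' Δ' Θ' : Ctx α} {p' q' : PreProof α}, B.size < A.size → T p' (cons B Δ') → T q' (cons B.dual Θ') →
        Γ'.Split Δ' Θ' → T (elim B p' q') Γ') : T (elim A p q) Γ := by
  cases h with
  | @tens_parr A B _ Δ₁ Δ₂ _ p₁ p₂ p₃ h h₁ h₂ h₃ =>
    rw [elim_tens_parr]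
    obtain ⟨h₄, h₅⟩ := hs.assoc h
    exact ih (by simp [Formula.size]) h₁ (ih (by simp [Formula.size])
      (h₂.shift 1) h₃ (h₅.push_right [A.dual] rfl)) h₄
  | wth_plus₁ h₁ h₂ h₃ =>
    rw [elim_wth_plus₁]; exact ih (by simp [Formula.size]) h₂ h₃ hs
  | wth_plus₂ h₁ h₂ h₃ =>
    rw [elim_wth_plus₂]; exact ih (by simp [Formula.size]) h₁ h₃ hs
  | one_bot h =>
    rw [elim_one_bot]
    have : Γ = Θ := by funext n; have := hs n; grind
    rwa [this]

/-- Admissibility of cut in the cut-free calculus. When a rule moves below the cut, the context of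
the other premise of the cut joins that of the premises of the rule. -/
theorem T.elim {A : Formula α} {Γ Δ Θ : Ctx α} {p q : PreProof α} (hp : T p (cons A Δ))
    (hq : T q (cons A.dual Θ)) (hs : Γ.Split Δ Θ) : T (elim A p q) Γ := by
  refine elim_induction (P := fun A Δ Θ p q => ∀ Γ, Γ.Split Δ Θ → T (MALL.elim A p q) Γ)
    ?_ ?_ ?_ ?_ ?_ hp hq Γ hs
  · intro A Δ p j hp Γ hs
    rw [elim_ax_right]
    exact hp.rename (ren_contract hs.symm)
  · intro A Θ q i hq Γ hs
    rw [elim_ax_left]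
    exact hq.rename (ren_contract hs)
  · intro A Δ Θ p q r i D ps Φ X L h hq ih Γ hs
    rw [h.elim]
    exact (h.rule.join hs hq.dom_down).typed fun b hb =>
      ih b hb _ ((hs.assoc h.rule.split).2.push_left _ (h.rule.own.length b))
  · intro A Δ Θ p q r i D qs Φ X L hp h ih Γ hs
    rw [h.eq, elim_other_mk0 hp.view h.zero_mem]
    refine (h.rule.join hs.symm hp.typed.dom_down).typed fun b hb =>
      ih b hb _ ((hs.symm.assoc h.rule.split).2.push_left _ (h.rule.own.length b)).symm
  · intro A Δ Θ p q hp hq ih Γ hs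
    rcases hp.keyCase hq with h | h
    · exact h.typed hs fun hB hp hq hs => ih hB hp hq _ hs
    · have := h.shape.elim_swap
      rw [Formula.dual_dual] at this
      rw [this]
      exact h.typed hs.symm fun hB hp hq hs => ih (by simpa using hB) hp hq _ hs

theorem image_down_names (f : ℕ → ℕ) (p : PreProof α) :
    (down 1 p.names).image f = down 1 (p.rename (lift f)).names := by
  ext n
  rw [names_rename]
  simp only [mem_down, Finset.mem_image]
  constructor
  · rintro ⟨a, h, rfl⟩; exact ⟨a + 1, h, rfl⟩
  · rintro ⟨_ | a, h, e⟩ <;> simp [lift] at e; exact ⟨a, h, e⟩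

theorem Princ.view_rename {A : Formula α} {Γ : Ctx α} {p : PreProof α} (h : Princ A Γ p)
    (f : ℕ → ℕ) : MALL.view (p.rename (lift f)) = .other := by cases h <;> rfl

theorem zero_mem_names_rename_lift {p : PreProof α} (h : 0 ∈ p.names) (f : ℕ → ℕ) :
    0 ∈ (p.rename (lift f)).names := by
  rw [names_rename]; exact Finset.mem_image.2 ⟨0, h, rfl⟩

theorem KeyCase.elim_rename {A : Formula α} {Δ Θ : Ctx α} {p q : PreProof α}
    (h : KeyCase A Δ Θ p q) (hd : ∀ n, Δ n = none ∨ Θ n = none)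
    (ih : ∀ {B : Formula α} {Δ' Θ' : Ctx α} {p' q' : PreProof α}, B.size < A.size → T p' (cons B Δ') → T q' (cons B.dual Θ') →
      (∀ n, Δ' n = none ∨ Θ' n = none) → ∀ f,
        (elim B p' q').rename f = elim B (p'.rename (lift f)) (q'.rename (lift f))) (f : ℕ → ℕ) :
    (elim A p q).rename f = elim A (p.rename (lift f)) (q.rename (lift f)) := by
  cases h with
  | @tens_parr A B _ Δ₁ Δ₂ _ p₁ p₂ p₃ h h₁ h₂ h₃ =>
    simp only [PreProof.rename, shift_one_rename, rename_lift_lift_succ_rename]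
    have hs := split_join hd
    obtain ⟨h₄, h₅⟩ := hs.assoc h
    have h₆ := h₅.push_right [A.dual] (k := 1) rfl
    have h₇ : T (elim B (p₂.shift 1) p₃) (cons A.dual (Δ₂.join Θ)) := (h₂.shift 1).elim h₃ h₆
    have e := elim_tens_parr A B (p₁.rename (lift f)) (p₂.rename (lift f))
      (p₃.rename (lift (lift f)))
    simp only [lift] at e ⊢
    rw [elim_tens_parr, e, ih (by simp [Formula.size]) h₁ h₇ h₄.disjoint,
      ih (by simp [Formula.size]) (h₂.shift 1) h₃ h₆.disjoint, shift_one_rename]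
  | @wth_plus₁ A B _ _ p₁ p₂ p₃ h₁ h₂ h₃ =>
    have e := elim_wth_plus₁ A B (p₁.rename (lift f)) (p₂.rename (lift f)) (p₃.rename (lift f))
    simp only [PreProof.rename, shift_one_rename, lift] at e ⊢
    rw [elim_wth_plus₁, e, ih (by simp [Formula.size]) h₂ h₃ hd]
  | @wth_plus₂ A B _ _ p₁ p₂ p₃ h₁ h₂ h₃ =>
    have e := elim_wth_plus₂ A B (p₁.rename (lift f)) (p₂.rename (lift f)) (p₃.rename (lift f))
    simp only [PreProof.rename, shift_one_rename, lift] at e ⊢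
    rw [elim_wth_plus₂, e, ih (by simp [Formula.size]) h₁ h₃ hd]
  | @one_bot _ p h =>
    have e := elim_one_bot (p.rename f)
    simp only [PreProof.rename, rename_succ_rename, lift] at e ⊢
    rw [elim_one_bot, e]

/-- No choice made by `elim` depends on the names of the context, so `f` need not be injective.
Typing and disjointness serve to apply the induction hypothesis to the nested cuts of the case `⊗`
against `⅋`, whose inner result must be a proof. -/
theorem elim_rename {A : Formula α} {Δ Θ : Ctx α} {p q : PreProof α} (hp : T p (cons A Δ))
    (hq : T q (cons A.dual Θ)) (hd : ∀ n, Δ n = none ∨ Θ n = none) (f : ℕ → ℕ) :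
    (elim A p q).rename f = elim A (p.rename (lift f)) (q.rename (lift f)) := by
  refine elim_induction (P := fun A Δ Θ p q => (∀ n, Δ n = none ∨ Θ n = none) → ∀ f,
    (elim A p q).rename f = elim A (p.rename (lift f)) (q.rename (lift f)))
    ?_ ?_ ?_ ?_ ?_ hp hq hd f
  · intro A Δ p j hp _ f
    have : ((PreProof.ax s(0, j + 1) : PreProof α).rename (lift f)) = .ax s(0, f j + 1) := rfl
    rw [elim_ax_right, this, elim_ax_right, PreProof.rename_rename, PreProof.rename_rename]
    congr 1
    funext n; cases n <;> rfl
  · intro A Θ q i hq _ f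
    have : ((PreProof.ax s(0, i + 1) : PreProof α).rename (lift f)) = .ax s(0, f i + 1) := rfl
    rw [elim_ax_left, this, elim_ax_left, PreProof.rename_rename, PreProof.rename_rename]
    congr 1
    funext n; cases n <;> rfl
  · intro A Δ Θ p q r i D ps Φ X L h hq ih hd f
    have h₀ := h.zero_mem
    have hs := (split_join hd).assoc h.rule.split
    rw [h.elim, h.eq, Head.rename_mk0, elim_mk0, Head.rename_mk, Finset.image_union,
      image_down_names]
    · refine Head.mk_congr fun b hb => ?_
      rw [Head.branch_rename] at hb
      rw [ih b hb (hs.2.push_left _ (h.rule.own.length b)).disjoint, shift_rename_lift,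
        Head.k_rename]
    · intro b hb
      rw [Head.branch_rename] at hb
      exact zero_mem_names_rename_lift (h₀ b hb) _
  · intro A Δ Θ p q r i D qs Φ X L hp h ih hd f
    have h₀ := h.zero_mem
    have hs := (split_join hd).symm.assoc h.rule.split
    rw [h.eq, elim_other_mk0 hp.view h₀, Head.rename_mk0, elim_other_mk0 (hp.view_rename f),
      Head.rename_mk, Finset.image_union, image_down_names]
    · refine Head.mk_congr fun b hb => ?_
      rw [Head.branch_rename] at hb
      rw [ih b hb (hs.2.push_left _ (h.rule.own.length b)).symm.disjoint, shift_rename_lift,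
        Head.k_rename]
    · intro b hb
      rw [Head.branch_rename] at hb
      exact zero_mem_names_rename_lift (h₀ b hb) _
  · intro A Δ Θ p q hp hq ih hd f
    rcases hp.keyCase hq with h | h
    · exact h.elim_rename hd (fun hB hp hq hd f => ih hB hp hq hd f) f
    · have e := h.shape.elim_swap
      have e' := (h.shape.rename f).elim_swap
      rw [Formula.dual_dual] at e e'
      rw [e, e']
      exact h.elim_rename (fun n => (hd n).symm)
        (fun hB hp hq hd f => ih (by simpa using hB) hp hq hd f) f

/-! ### Equality up to rule commutations -/

theorem Head.Own.sh {r : Head α} {i : ℕ} {Φ : Ctx α} {L : Bool → List (Formula α)}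
    (h : r.Own i Φ L) (k : ℕ) : (r.rename (· + k)).Own (i + k) (sh k Φ) L :=
  h.rename (ren_sh k Φ)

theorem Rule.push {r : Head α} {i : ℕ} {Γ Φ Δ : Ctx α} {L : Bool → List (Formula α)} {D : Finset ℕ}
    (h : Rule r i Γ Φ Δ L D) (M : List (Formula α)) {k : ℕ} (hk : M.length = k) :
    Rule (r.rename (· + k)) (i + k) (push M Γ) (Ctx.sh k Φ) (push M Δ) L (up k D) := by
  refine ⟨h.own.sh k, Ctx.Split.push_right h.split M hk, fun n => ?_⟩
  subst hk
  rw [mem_up, push_apply]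
  split_ifs with hn
  · simp [hn]
  · simp only [hn, false_or, h.dom _]; simp; omega

/-- Equality up to rule commutations, between proofs of `Γ` without `cut`-rule. -/
inductive CommEquiv : Ctx α → PreProof α → PreProof α → Prop
  | refl {Γ p} (h : T p Γ) : CommEquiv Γ p p
  | symm {Γ p q} (h : CommEquiv Γ p q) : CommEquiv Γ q p
  | trans {Γ p q r} (h : CommEquiv Γ p q) (h' : CommEquiv Γ q r) : CommEquiv Γ p r
  | mk {r : Head α} {i Γ Φ Δ L D ps ps'} (h : Rule r i Γ Φ Δ L D)
      (hp : ∀ b, r.Branch b → CommEquiv (push (L b) Δ) (ps b) (ps' b)) :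
      CommEquiv Γ (r.mk i D ps) (r.mk i D ps')
  -- All rule commutations at once: `r` consumes `Φ`, `s` consumes `Ψ`, these are disjoint parts of
  -- `Γ`, and `Δ` is what remains for the proofs `ps a b` above both. If `r` or `s` is `⊤` there is
  -- no such proof, and the other rule is created or erased.
  | comm {r s : Head α} {i j Γ Φ Ψ Y Z Δ L M D₁ D₂ D} {ps : Bool → Bool → PreProof α}
      (hr : Rule r i Γ Φ Y L D₁) (hs' : Rule s j Y Ψ Δ M D) (hs : Rule s j Γ Ψ Z M D₂)
      (hp : ∀ a b, r.Branch a → s.Branch b → T (ps a b) (push (M b) (push (L a) Δ))) :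
      CommEquiv Γ
        (r.mk i D₁ fun a => (s.rename (· + r.k)).mk (j + r.k) (up r.k D) (ps a))
        (s.mk j D₂ fun b => (r.rename (· + s.k)).mk (i + s.k) (up s.k D)
          fun a => (ps a b).swap s.k r.k)

/-- Since `Φ` and `Ψ` are disjoint in `Γ`, the rule `r` still applies after `s`. This makes the
hypotheses of `CommEquiv.comm` symmetric in `r` and `s`. -/
theorem Rule.exchange {r s : Head α} {i j : ℕ} {Γ Φ Ψ Y Z Δ : Ctx α}
    {L M : Bool → List (Formula α)} {D₁ D₂ D : Finset ℕ} (hr : Rule r i Γ Φ Y L D₁)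
    (hs' : Rule s j Y Ψ Δ M D) (hs : Rule s j Γ Ψ Z M D₂) : Rule r i Z Φ Δ L D := by
  refine ⟨hr.own, fun n => ?_, hs'.dom⟩
  have h₁ := hr.split n
  have h₂ := hs'.split n
  have h₃ := hs.split n
  grind

theorem comm_left {r s : Head α} {i j : ℕ} {Γ Φ Ψ Y Δ : Ctx α}
    {L M : Bool → List (Formula α)} {D₁ D : Finset ℕ} {ps : Bool → Bool → PreProof α}
    (hr : Rule r i Γ Φ Y L D₁) (hs' : Rule s j Y Ψ Δ M D)
    (hp : ∀ a b, r.Branch a → s.Branch b → T (ps a b) (push (M b) (push (L a) Δ))) :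
    T (r.mk i D₁ fun a => (s.rename (· + r.k)).mk (j + r.k) (up r.k D) (ps a)) Γ :=
  hr.typed fun a ha => (hs'.push (L a) (hr.own.length a)).typed fun b hb =>
    hp a b ha (by simpa using hb)

theorem comm_right {r s : Head α} {i j : ℕ} {Γ Φ Ψ Y Z Δ : Ctx α}
    {L M : Bool → List (Formula α)} {D₁ D₂ D : Finset ℕ} {ps : Bool → Bool → PreProof α}
    (hr : Rule r i Γ Φ Y L D₁) (hs' : Rule s j Y Ψ Δ M D) (hs : Rule s j Γ Ψ Z M D₂)
    (hp : ∀ a b, r.Branch a → s.Branch b → T (ps a b) (push (M b) (push (L a) Δ))) :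
    T (s.mk j D₂ fun b => (r.rename (· + s.k)).mk (i + s.k) (up s.k D)
          fun a => (ps a b).swap s.k r.k) Γ :=
  comm_left (ps := fun b a => (ps a b).swap s.k r.k) hs (hr.exchange hs' hs) fun b a hb ha =>
    (hp a b ha hb).swap (hs.own.length b) (hr.own.length a)

theorem CommEquiv.typed {Γ : Ctx α} {p q : PreProof α} (h : CommEquiv Γ p q) : T p Γ ∧ T q Γ := by
  induction h with
  | refl h => exact ⟨h, h⟩
  | symm _ ih => exact ih.symm
  | trans _ _ ih ih' => exact ⟨ih.1, ih'.2⟩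
  | mk h _ ih => exact ⟨h.typed fun b hb => (ih b hb).1, h.typed fun b hb => (ih b hb).2⟩
  | comm hr hs' hs hp => exact ⟨comm_left hr hs' hp, comm_right hr hs' hs hp⟩

theorem image_liftN_up (k : ℕ) (f : ℕ → ℕ) (D : Finset ℕ) :
    (up k D).image (liftN k f) = up k (D.image f) := by
  ext n
  simp only [Finset.mem_image, mem_up, liftN]
  constructor
  · rintro ⟨m, h, rfl⟩
    split_ifs with hm
    · exact .inl hm
    · exact .inr ⟨by omega, m - k, by tauto, by omega⟩
  · rintro (h | ⟨h, m, hm, e⟩)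
    · exact ⟨n, .inl h, by simp [h]⟩
    · exact ⟨m + k, .inr ⟨by omega, by simpa using hm⟩, by simp; omega⟩

theorem Head.rename_add_rename_liftN (k : ℕ) (f : ℕ → ℕ) (r : Head α) :
    (r.rename (· + k)).rename (liftN k f) = (r.rename f).rename (· + k) := by
  rw [rename_rename, rename_rename]
  congr 1
  funext n; simp [liftN]

theorem PreProof.swap_rename (a b : ℕ) (f : ℕ → ℕ) (p : PreProof α) :
    (p.swap a b).rename (liftN b (liftN a f)) = (p.rename (liftN a (liftN b f))).swap a b := by
  rw [PreProof.swap, PreProof.swap, PreProof.rename_rename, PreProof.rename_rename]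
  congr 1
  funext n
  simp only [Function.comp, swapBlocks, liftN]
  grind

theorem CommEquiv.rename {Γ Γ' : Ctx α} {p q : PreProof α} {f : ℕ → ℕ} (h : CommEquiv Γ p q)
    (hf : Ren f Γ Γ') : CommEquiv Γ' (p.rename f) (q.rename f) := by
  induction h generalizing f Γ' with
  | refl h => exact .refl (h.rename hf)
  | symm _ ih => exact (ih hf).symm
  | trans _ _ ih ih' => exact (ih hf).trans (ih' hf)
  | @mk r i Γ Φ Δ L D ps ps' h _ ih =>
    rw [Head.rename_mk, Head.rename_mk]
    refine .mk (h.rename hf) fun b hb => ?_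
    rw [Head.branch_rename] at hb
    rw [← h.own.length b]
    exact ih b hb ((hf.split h.split).2.1.push _)
  | @comm r s i j Γ Φ Ψ Y Z Δ L M D₁ D₂ D ps hr hs' hs hp =>
    have hY := (hf.split hr.split).2.1
    have hΔ := (hY.split hs'.split).2.1
    have := CommEquiv.comm (hr.rename hf) (hs'.rename hY) (hs.rename hf)
      (ps := fun a b => (ps a b).rename (liftN s.k (liftN r.k f))) (fun a b ha hb => by
        rw [Head.branch_rename] at ha hb
        have e := (hp a b ha hb).rename ((hΔ.push (L a)).push (M b))
        rwa [hr.own.length a, hs.own.length b] at e)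
    simp only [Head.rename_mk, Head.rename_add_rename_liftN, image_liftN_up, Head.k_rename,
      swap_rename] at this ⊢
    have e : ∀ i k, liftN k f (i + k) = f i + k := by intro i k; simp [liftN]
    rw [e, e]
    exact this

/-- The names of the fixed premise. -/
def Head.fixed : Head α → Finset ℕ
  | .tensL q => down 1 q.names
  | .tensR q => down 1 q.names
  | _ => ∅

theorem Head.Own.dom {r : Head α} {i : ℕ} {Φ : Ctx α} {L : Bool → List (Formula α)}
    (h : r.Own i Φ L) : IsDom (insert i r.fixed) Φ := by
  have hs : ∀ A : Formula α, IsDom (insert i ∅) (single i A) := by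
    intro A n; simp [single]
  cases r with
  | plus k => cases k <;> obtain ⟨A, B, rfl, rfl⟩ := h <;> exact hs _
  | bot => obtain ⟨rfl, rfl⟩ := h; exact hs _
  | top => obtain ⟨rfl, rfl⟩ := h; exact hs _
  | parr => obtain ⟨A, B, rfl, rfl⟩ := h; exact hs _
  | wth => obtain ⟨A, B, rfl, rfl⟩ := h; exact hs _
  | _ =>
    obtain ⟨A, B, h, h', rfl⟩ := h
    intro n
    rw [Finset.mem_insert, fixed, h'.dom_down, Ctx.erase]
    split_ifs with e
    · simp [e, h]
    · simp [e]

/-- An order on the rules, for which commutations are directed. -/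
def Head.rank : Head α → ℕ
  | .parr => 0
  | .tensL _ => 1
  | .tensR _ => 1
  | .wth => 2
  | .plus _ => 3
  | .bot => 4
  | .top => 5

theorem up_zero (D : Finset ℕ) : up 0 D = D := by ext n; simp

/-- Each pair of operations specialises the uniform scheme to one constructor of `CommRoot`. These
are stated in one direction only, the one in which the rule of smaller rank goes down; the sets of
names are those which a `⊤`-rule has to carry. -/
theorem commRoot_of_rank {r s : Head α} (h : s.rank ≤ r.rank) (i j : ℕ) (D : Finset ℕ)
    (ps : Bool → Bool → PreProof α) :
    CommRoot
      (r.mk i (insert j (s.fixed ∪ D)) fun a =>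
        (s.rename (· + r.k)).mk (j + r.k) (up r.k D) (ps a))
      (s.mk j (insert i (r.fixed ∪ D)) fun b =>
        (r.rename (· + s.k)).mk (i + s.k) (up s.k D) fun a => (ps a b).swap s.k r.k) := by
  have e : ∀ q : PreProof α, q.rename (lift fun n => n) = q := by
    intro q
    have : (fun n : ℕ => n) = id := rfl
    rw [this, lift_id, rename_id]
  rcases r with _ | _ | _ | _ | _ | q | q <;> rcases s with _ | _ | _ | _ | _ | q' | q' <;>
    first
    | (exfalso; simp [Head.rank] at h; done)
    | (simp only [Head.mk, Head.k, Head.fixed, Head.rename, Finset.empty_union, up_zero,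
        swap_zero_right, Nat.add_zero, e]
       constructor)
    | skip
  -- `tens_top₁` lists the names of the fixed premise last, contrary to the scheme.
  · rw [Finset.union_comm]; exact CommRoot.tens_top₁ _ _ _ _

theorem commRoot_or (r s : Head α) (i j : ℕ) (D : Finset ℕ) (ps : Bool → Bool → PreProof α)
    {p q : PreProof α}
    (hp : p = r.mk i (insert j (s.fixed ∪ D)) fun a =>
      (s.rename (· + r.k)).mk (j + r.k) (up r.k D) (ps a))
    (hq : q = s.mk j (insert i (r.fixed ∪ D)) fun b =>
      (r.rename (· + s.k)).mk (i + s.k) (up s.k D) fun a => (ps a b).swap s.k r.k) :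
    CommRoot p q ∨ CommRoot q p := by
  subst hp hq
  rcases le_total s.rank r.rank with h | h
  · exact .inl (commRoot_of_rank h i j D ps)
  · right
    have := commRoot_of_rank h j i D fun b a => (ps a b).swap s.k r.k
    simpa only [swap_swap] using this

/-- A rule commutation between two proofs of `Γ` without `cut`-rule. -/
def TypedStep (Γ : Ctx α) (p q : PreProof α) : Prop :=
  InContext CutFreeCommRoot p q ∧ T p Γ ∧ T q Γ

theorem Head.inContext_mk {R : PreProof α → PreProof α → Prop} (r : Head α) (i : ℕ) (D : Finset ℕ)
    {ps : Bool → PreProof α} {p p' : PreProof α} {b : Bool} (hb : r.Branch b)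
    (h : InContext R p p') :
    InContext R (r.mk i D (Function.update ps b p)) (r.mk i D (Function.update ps b p')) := by
  cases r <;> cases b <;> simp [Branch, mk, Function.update] at hb ⊢
  · exact .parr h
  · exact .bot h
  · exact .wthL h
  · exact .wthR h
  · exact .plus h
  · exact .tensL h
  · exact .tensR h

theorem Rule.reflTransGen {r : Head α} {i : ℕ} {Γ Φ Δ : Ctx α} {L : Bool → List (Formula α)}
    {D : Finset ℕ} (hr : Rule r i Γ Φ Δ L D) {ps : Bool → PreProof α}
    (hp : ∀ b, r.Branch b → T (ps b) (Ctx.push (L b) Δ)) {b : Bool} {p : PreProof α}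
    (h : r.Branch b → ReflTransGen (TypedStep (Ctx.push (L b) Δ)) (ps b) p) :
    ReflTransGen (TypedStep Γ) (r.mk i D ps) (r.mk i D (Function.update ps b p)) := by
  by_cases hb : r.Branch b
  · replace h := h hb
    have hT : ∀ p, T p (Ctx.push (L b) Δ) → T (r.mk i D (Function.update ps b p)) Γ := by
      intro p hT
      refine hr.typed fun b' hb' => ?_
      by_cases e : b' = b
      · subst e; rwa [Function.update_self]
      · rw [Function.update_of_ne e]; exact hp b' hb'
    have := ReflTransGen.lift (r := TypedStep (Ctx.push (L b) Δ)) (p := TypedStep Γ)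
      (fun p => r.mk i D (Function.update ps b p))
      (fun p q hpq => ⟨r.inContext_mk i D hb hpq.1, hT _ hpq.2.1, hT _ hpq.2.2⟩) _ _ h
    simpa [Function.onFun] using this
  · have : r.mk i D (Function.update ps b p) = r.mk i D ps := by
      refine Head.mk_congr fun b' hb' => ?_
      rw [Function.update_of_ne]
      rintro rfl; exact hb hb'
    rw [this]

/-- Return from the uniform inductive relation to sequences of actual commutations, with all
intermediate trees correct cut-free proofs of `Γ`. -/
theorem CommEquiv.reflTransGen {Γ : Ctx α} {p q : PreProof α} (h : CommEquiv Γ p q) :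
    ReflTransGen (TypedStep Γ) p q := by
  have hsymm : ∀ (Γ : Ctx α) (p q : PreProof α), TypedStep Γ p q → TypedStep Γ q p := by
    rintro Γ p q ⟨h, hp, hq⟩
    refine ⟨?_, hq, hp⟩
    clear hp hq
    induction h with
    | root h => exact .root ⟨h.1.symm, h.2.2, h.2.1⟩
    | cutL _ ih => exact .cutL ih
    | cutR _ ih => exact .cutR ih
    | tensL _ ih => exact .tensL ih
    | tensR _ ih => exact .tensR ih
    | parr _ ih => exact .parr ih
    | bot _ ih => exact .bot ih
    | wthL _ ih => exact .wthL ih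
    | wthR _ ih => exact .wthR ih
    | plus _ ih => exact .plus ih
  induction h with
  | refl h => exact .refl
  | @symm Γ p q _ ih =>
    have : Std.Symm (TypedStep Γ) := ⟨hsymm Γ⟩
    exact ReflTransGen.stdSymm.symm _ _ ih
  | trans _ _ ih ih' => exact ih.trans ih'
  | @mk r i Γ Φ Δ L D ps ps' h hp ih =>
    -- A step acts on one sub-proof, so the premises are changed one after the other; for an index
    -- that is not a branch nothing happens.
    refine (h.reflTransGen (b := false) (fun b hb => (hp b hb).typed.1) (ih false)).trans ?_
    refine (h.reflTransGen (b := true) (p := ps' true) (fun b hb => ?_) (fun hb => ?_)).trans ?_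
    · cases b
      · rw [Function.update_self]; exact (hp _ hb).typed.2
      · rw [Function.update_of_ne (by simp)]; exact (hp _ hb).typed.1
    · rw [Function.update_of_ne (by simp)]; exact ih true hb
    · rw [Head.mk_congr (ps' := ps')]
      rintro (_ | _) - <;> simp
  | @comm r s i j Γ Φ Ψ Y Z Δ L M D₁ D₂ D ps hr hs' hs hp =>
    -- The sets of names are determined by the sequents, which gives them the form required by
    -- `commRoot_or`.
    have hD₁ : D₁ = insert j (s.fixed ∪ D) := by
      rw [← Finset.insert_union]
      exact hr.dom.unique (Ctx.Split.dom hs'.split hs.own.dom hs'.dom)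
    have hr' := hr.exchange hs' hs
    have hD₂ : D₂ = insert i (r.fixed ∪ D) := by
      rw [← Finset.insert_union]
      exact hs.dom.unique (Ctx.Split.dom hr'.split hr.own.dom hr'.dom)
    have hl := comm_left hr hs' hp
    have hr := comm_right hr hs' hs hp
    refine .single ⟨.root ⟨commRoot_or r s i j D ps ?_ ?_, hl.cf, hr.cf⟩, hl, hr⟩
    · rw [hD₁]
    · rw [hD₂]

/-! ### Symmetry of the elimination of a cut, up to rule commutations -/

theorem Ctx.Ren.img_eq {f : ℕ → ℕ} {Γ Γ' : Ctx α} (h : Ren f Γ Γ') : img f Γ = Γ' :=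
  (img_ren h.inj).unique h

theorem Ctx.img_add (k : ℕ) (Γ : Ctx α) : img (· + k) Γ = sh k Γ := (ren_sh k Γ).img_eq

theorem IsSide.rename {p : PreProof α} {A : Formula α} {Γ Γ' : Ctx α} {r : Head α} {i : ℕ}
    {D : Finset ℕ} {ps : Bool → PreProof α} {Φ Δ : Ctx α} {L : Bool → List (Formula α)}
    (h : IsSide p A Γ r i D ps Φ Δ L) {f : ℕ → ℕ} (hf : Ren f Γ Γ') :
    IsSide (p.rename (lift f)) A Γ' (r.rename f) (f i) (D.image f)
      (fun b => (ps b).rename (lift (liftN r.k f))) (img f Φ) (img f Δ) L := by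
  obtain ⟨rfl, hr, hp⟩ := h
  refine ⟨Head.rename_mk0 _ _ _ _ _, hr.rename hf, fun b hb => ?_⟩
  rw [Head.branch_rename] at hb
  have := (hp b hb).rename ((((hf.split hr.split).2.1).push (L b)).cons A)
  rwa [hr.own.length b] at this

theorem IsSide.shift {p : PreProof α} {A : Formula α} {Γ : Ctx α} {r : Head α} {i : ℕ}
    {D : Finset ℕ} {ps : Bool → PreProof α} {Φ Δ : Ctx α} {L : Bool → List (Formula α)}
    (h : IsSide p A Γ r i D ps Φ Δ L) (k : ℕ) :
    IsSide (p.shift k) A (sh k Γ) (r.rename (· + k)) (i + k) (D.image (· + k))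
      (fun b => (ps b).rename (lift (liftN r.k (· + k)))) (sh k Φ) (sh k Δ) L := by
  rw [← img_add k Φ, ← img_add k Δ]
  exact h.rename (ren_sh k Γ)

theorem Ctx.IsDom.push {D : Finset ℕ} {Γ : Ctx α} (h : IsDom D Γ) (L : List (Formula α)) {k : ℕ}
    (hk : L.length = k) : IsDom (up k D) (Ctx.push L Γ) := by
  subst hk
  intro n
  rw [mem_up, push_apply]
  split_ifs with hn
  · simp [hn]
  · simp only [hn, false_or, h _]; simp; omega

theorem up_union (k : ℕ) (D E : Finset ℕ) : up k (D ∪ E) = E.image (· + k) ∪ up k D := by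
  ext n
  simp only [mem_up, Finset.mem_union, Finset.mem_image]
  constructor
  · rintro (h | ⟨h, h' | h'⟩)
    · exact .inr (.inl h)
    · exact .inr (.inr ⟨h, h'⟩)
    · exact .inl ⟨_, h', by omega⟩
  · rintro (⟨m, h, rfl⟩ | h | ⟨h, h'⟩)
    · right; simp [h]
    · exact .inl h
    · exact .inr ⟨h, .inl h'⟩

/-- The set of names of the context above a rule, for a premise that also contains `A`. -/
theorem IsSide.up_dom {p : PreProof α} {A : Formula α} {Γ : Ctx α} {r : Head α} {i : ℕ}
    {D : Finset ℕ} {ps : Bool → PreProof α} {Φ Δ : Ctx α} {L : Bool → List (Formula α)}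
    (h : IsSide p A Γ r i D ps Φ Δ L) {b : Bool} (hb : r.Branch b) :
    down 1 (ps b).names = up r.k D :=
  (h.prem b hb).dom_down.unique (h.rule.dom.push _ (h.rule.own.length b))

/-- A rule of the right premise that does not introduce the cut formula goes below the cut. -/
theorem elim_side_right {A : Formula α} {Γ Δ Θ : Ctx α} {p q : PreProof α} {s : Head α} {j : ℕ}
    {E : Finset ℕ} {qs : Bool → PreProof α} {Ψ X : Ctx α} {M : Bool → List (Formula α)}
    (hp : T p (cons A Δ)) (h' : IsSide q A.dual Θ s j E qs Ψ X M) (hs : Γ.Split Δ Θ) :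
    CommEquiv Γ (elim A p q)
      (s.mk j (E ∪ down 1 p.names) fun b => elim A (p.shift s.k) (qs b)) := by
  have hT : T (elim A p q) Γ := hp.elim h'.typed hs
  induction hn : p.sz using Nat.strong_induction_on
    generalizing Γ Δ Θ p q s j E qs Ψ X M with | _ n ih
  subst hn
  rcases hp.cases_zero with ⟨i, rfl, rfl⟩ | ⟨r, i, D, ps, Φ, Y, L, h⟩ | hp'
  · rw [elim_ax_left] at hT ⊢
    simp only [ax_shift, elim_ax_left]
    rw [h'.eq, Head.mk0_rename_contract] at hT ⊢
    exact .refl hT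
  · obtain ⟨hΓ, hYΘ⟩ := hs.assoc h.rule.split
    obtain ⟨hΘ, hXY⟩ := hYΘ.symm.assoc h'.rule.split
    have hr : Rule r i Γ Φ (Y.join Θ) L (D ∪ down 1 q.names) :=
      h.rule.join hs h'.typed.dom_down
    have hs' : Rule s j (Y.join Θ) Ψ (X.join Y) M (D ∪ E) := by
      rw [Finset.union_comm]; exact h'.rule.join hYΘ.symm h.rule.dom
    have hs₁ : Rule s j Γ Ψ (X.join Δ) M (E ∪ down 1 p.names) := h'.rule.join hs.symm hp.dom_down
    have hsplit : ∀ a b, (push (M b) (push (L a) (X.join Y))).Split (sh s.k (push (L a) Y))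
        (push (M b) (sh r.k X)) := fun a b =>
      (hXY.symm.push_left (L a) (h.rule.own.length a)).push_right (M b) (h'.rule.own.length b)
    have hps : ∀ a, r.Branch a → T ((ps a).shift s.k) (cons A (sh s.k (push (L a) Y))) :=
      fun a ha => (h.prem a ha).shift _
    have hqs : ∀ b, s.Branch b → T ((qs b).rename (lift (liftN s.k (· + r.k))))
        (cons A.dual (push (M b) (sh r.k X))) := fun b hb =>
      (h'.shift r.k).prem b (by rwa [Head.branch_rename])
    rw [h.elim] at hT ⊢
    -- `elim` moves `r`, the last rule of `p`, below the cut. By induction `s` comes below the cut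
    -- in each premise of `r`. It then remains to commute `r` with `s`.
    refine .trans (.mk hr (ps' := fun a => (s.rename (· + r.k)).mk (j + r.k) (up r.k (D ∪ E))
      fun b => elim A ((ps a).shift s.k) ((qs b).rename (lift (liftN s.k (· + r.k)))))
      fun a ha => ?_) ?_
    · have hsa := hYΘ.push_left (L a) (h.rule.own.length a)
      have := ih _ (h.sz ha) (h.prem a ha) (h'.shift r.k) hsa
        ((h.prem a ha).elim (h'.typed.shift _) hsa) rfl
      rw [h.up_dom ha, ← up_union, Head.k_rename] at this
      exact this
    · have := CommEquiv.comm hr hs' hs₁ (ps := fun a b =>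
        elim A ((ps a).shift s.k) ((qs b).rename (lift (liftN s.k (· + r.k)))))
        fun a b ha hb => (hps a ha).elim (hqs b hb) (hsplit a b)
      -- After the commutation `r` is above `s`; reading the equation of `elim` backwards puts it
      -- back into the left premise `p.shift s.k`. The exchange of names made by the commutation is
      -- absorbed by `elim_rename`.
      convert this using 1
      refine Head.mk_congr fun b hb => ?_
      rw [(h.shift s.k).elim, h'.up_dom hb, ← up_union, Finset.union_comm E]
      refine Head.mk_congr fun a ha => ?_
      rw [Head.branch_rename] at ha
      rw [PreProof.swap, elim_rename (hps a ha) (hqs b hb) (hsplit a b).disjoint, PreProof.shift,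
        PreProof.shift, PreProof.rename_rename, PreProof.rename_rename, lift_comp, lift_comp]
      congr 3 <;> funext n <;> simp only [Function.comp, swapBlocks, liftN, Head.k_rename] <;>
        split_ifs <;> omega
  · have e := h'.eq
    rw [e, elim_other_mk0 hp'.view h'.zero_mem] at hT ⊢
    exact .refl hT

/-- The two premises of a cut may be permuted. -/
theorem elim_symm {A : Formula α} {Γ Δ Θ : Ctx α} {p q : PreProof α} (hp : T p (cons A Δ))
    (hq : T q (cons A.dual Θ)) (hs : Γ.Split Δ Θ) :
    CommEquiv Γ (elim A p q) (elim A.dual q p) := by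
  have hp₀ := hp
  refine elim_induction (P := fun A Δ Θ p q => T p (cons A Δ) → ∀ Γ, Γ.Split Δ Θ →
    CommEquiv Γ (elim A p q) (elim A.dual q p)) ?_ ?_ ?_ ?_ ?_ hp hq hp₀ Γ hs
  · intro A Δ p j hp _ Γ hs
    rw [elim_ax_left, elim_ax_right]
    exact .refl (hp.rename (ren_contract hs.symm))
  · intro A Θ q i hq _ Γ hs
    rw [elim_ax_left, elim_ax_right]
    exact .refl (hq.rename (ren_contract hs))
  · intro A Δ Θ p q r i D ps Φ X L h hq ih hp Γ hs
    have h₂ : IsSide p A.dual.dual Δ r i D ps Φ X L := by rwa [Formula.dual_dual]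
    -- The last rule of the left premise is, after permutation, a rule of the right premise. This is
    -- the only case where rule commutations occur.
    refine .trans ?_ (elim_side_right hq h₂ hs.symm).symm
    rw [h.elim]
    exact .mk (h.rule.join hs hq.dom_down) fun b hb => ih b hb (h.prem b hb) _
      ((hs.assoc h.rule.split).2.push_left _ (h.rule.own.length b))
  · intro A Δ Θ p q r i D qs Φ X L hp h ih _ Γ hs
    have e := elim_other_mk0 (A := A) (D := D) (i := i) hp.view h.zero_mem
    rw [h.elim, h.eq, e]
    exact .mk (h.rule.join hs.symm hp.typed.dom_down) fun b hb => ih b hb (hp.typed.shift _) _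
      ((hs.symm.assoc h.rule.split).2.push_left _ (h.rule.own.length b)).symm
  · intro A Δ Θ p q hp hq ih hp₀ Γ hs
    have hT := hp₀.elim hq.typed hs
    rcases hp.keyCase hq with h | h
    · rw [h.shape.elim_swap]; exact .refl hT
    · have := h.shape.elim_swap
      rw [Formula.dual_dual] at this
      rw [← this]; exact .refl hT

theorem Princ.rename {A : Formula α} {Γ Γ' : Ctx α} {p : PreProof α} {f : ℕ → ℕ}
    (h : Princ A Γ p) (hf : Ren f Γ Γ') : Princ A Γ' (p.rename (lift f)) := by
  cases h with
  | tens h h₁ h₂ =>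
    obtain ⟨h₃, h₄, h₅⟩ := hf.split h
    simp only [PreProof.rename, shift_one_rename]
    exact .tens h₅ (h₁.rename (h₃.cons _)) (h₂.rename (h₄.cons _))
  | parr h =>
    simp only [PreProof.rename, rename_lift_lift_succ_rename]
    exact .parr (h.rename ((hf.cons _).cons _))
  | one =>
    have : Γ' = fun _ => none := by
      funext n
      by_contra hc
      obtain ⟨A, hA⟩ := Option.ne_none_iff_exists'.1 hc
      obtain ⟨m, hm, -⟩ := hf.back hA
      simp at hm
    subst this
    exact .one
  | bot h =>
    simp only [PreProof.rename, rename_succ_rename]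
    exact .bot (h.rename hf)
  | wth h₁ h₂ =>
    simp only [PreProof.rename, shift_one_rename]
    exact .wth (h₁.rename (hf.cons _)) (h₂.rename (hf.cons _))
  | plus₁ h =>
    simp only [PreProof.rename, shift_one_rename]
    exact .plus₁ (h.rename (hf.cons _))
  | plus₂ h =>
    simp only [PreProof.rename, shift_one_rename]
    exact .plus₂ (h.rename (hf.cons _))
  | @top _ D h =>
    have : (D.image (· + 1)).image (lift f) = (D.image f).image (· + 1) := by
      rw [Finset.image_image, Finset.image_image]; rfl
    simp only [PreProof.rename, this]
    exact .top (hf.dom h)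

theorem Princ.shift {A : Formula α} {Γ : Ctx α} {p : PreProof α} (h : Princ A Γ p) (k : ℕ) :
    Princ A (sh k Γ) (p.shift k) := h.rename (ren_sh k Γ)

theorem Head.mk_eq_mk0 (s : Head α) (n : ℕ) (D : Finset ℕ) (ps : Bool → PreProof α) :
    (s.rename (· + 1)).mk (n + 1) (up 1 D) ps = s.mk0 n D fun b => (ps b).swap s.k 1 := by
  rw [mk0]; simp only [swap_swap]

/-! ### Compatibility of the elimination of a cut with rule commutations -/

/-- A cut on the occurrence `0` commutes with the elimination of cuts on `A`. -/
def Congr (A : Formula α) : Prop :=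
  ∀ ⦃Γ Δ Θ : Ctx α⦄ ⦃p p' q : PreProof α⦄, CommEquiv (cons A Δ) p p' → T q (cons A.dual Θ) →
    Γ.Split Δ Θ → CommEquiv Γ (elim A p q) (elim A p' q)

/-- Successive cuts applied to a premise of a rule that introduces a cut formula. -/
inductive Op (α : Type u) : Type u
  | nil
  | one (B : Formula α) (c : PreProof α)
  | two (B : Formula α) (c : PreProof α) (B' : Formula α) (c' : PreProof α)
  -- With `two`, both cut formulas are occurrences of the premise. With `shiftTwo`, the second one
  -- is an occurrence of `c`, and the premise is shifted to make room for it.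
  | shiftTwo (B : Formula α) (c : PreProof α) (B' : Formula α) (c' : PreProof α)

namespace Op

/-- Performs the cuts. -/
noncomputable def run : Op α → PreProof α → PreProof α
  | .nil, x => x
  | .one B c, x => elim B x c
  | .two B c B' c', x => elim B' (elim B x c) c'
  | .shiftTwo B c B' c', x => elim B' (elim B (x.shift 1) c) c'

/-- Renaming of the context. -/
def rename (f : ℕ → ℕ) : Op α → Op α
  | .nil => .nil
  | .one B c => .one B (c.rename (lift f))
  | .two B c B' c' => .two B (c.rename (lift (lift f))) B' (c'.rename (lift f))
  | .shiftTwo B c B' c' => .shiftTwo B (c.rename (lift (lift f))) B' (c'.rename (lift f))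

/-- The cut formulas have size less than `n`. -/
def Small (n : ℕ) : Op α → Prop
  | .nil => True
  | .one B _ => B.size < n
  | .two B _ B' _ => B.size < n ∧ B'.size < n
  | .shiftTwo B _ B' _ => B.size < n ∧ B'.size < n

/-- The cuts replace the occurrences `L` by the context `Ξ`. -/
inductive Typed : Op α → List (Formula α) → Ctx α → Prop
  | nil : Typed .nil [] fun _ => none
  | one {B c Ξ} (h : T c (cons B.dual Ξ)) : Typed (.one B c) [B] Ξ
  | two {B c B' c' Ξ Ξ₁ Ξ₂} (h : T c (cons B.dual (sh 1 Ξ₁))) (h' : T c' (cons B'.dual Ξ₂))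
      (hs : Ξ.Split Ξ₁ Ξ₂) : Typed (.two B c B' c') [B, B'] Ξ
  | shiftTwo {B c B' c' Ξ Ξ₁ Ξ₂} (h : T c (cons B.dual (cons B' Ξ₁)))
      (h' : T c' (cons B'.dual Ξ₂)) (hs : Ξ.Split Ξ₁ Ξ₂) : Typed (.shiftTwo B c B' c') [B] Ξ

/-- `Γ = (X, Ξ₁), Ξ₂` -/
theorem _root_.MALL.Ctx.Split.assoc' {Γ X Ξ Ξ₁ Ξ₂ : Ctx α} (h : Γ.Split X Ξ) (h' : Ξ.Split Ξ₁ Ξ₂) :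
    (X.join Ξ₁).Split X Ξ₁ ∧ Γ.Split (X.join Ξ₁) Ξ₂ := by
  constructor <;> intro n <;> have h₁ := h n <;> have h₂ := h' n <;> simp only [join] <;> grind

theorem Typed.run {op : Op α} {L : List (Formula α)} {Γ X Ξ : Ctx α} (h : op.Typed L Ξ)
    (hs : Γ.Split X Ξ) {x : PreProof α} (hx : T x (push L X)) : T (op.run x) Γ := by
  cases h with
  | nil =>
    have : X = Γ := by funext n; have := hs n; grind
    rwa [← this]
  | one h => exact T.elim hx h hs
  | two h h' hs' =>
    obtain ⟨h₁, h₂⟩ := hs.assoc' hs'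
    exact T.elim (T.elim hx h (h₁.push_left [_] rfl)) h' h₂
  | shiftTwo h h' hs' =>
    obtain ⟨h₁, h₂⟩ := hs.assoc' hs'
    exact T.elim (T.elim (T.shift hx 1) h (h₁.push_right [_] rfl)) h' h₂

theorem Typed.run_congr {op : Op α} {L : List (Formula α)} {Γ X Ξ : Ctx α} (h : op.Typed L Ξ)
    (hs : Γ.Split X Ξ) {n : ℕ} (hn : op.Small n) (hc : ∀ B : Formula α, B.size < n → Congr B)
    {x x' : PreProof α} (hx : CommEquiv (push L X) x x') : CommEquiv Γ (op.run x) (op.run x') := by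
  cases h with
  | nil =>
    have : X = Γ := by funext n; have := hs n; grind
    rwa [← this]
  | one h => exact hc _ hn hx h hs
  | two h h' hs' =>
    obtain ⟨h₁, h₂⟩ := hs.assoc' hs'
    exact hc _ hn.2 (hc _ hn.1 hx h (h₁.push_left [_] rfl)) h' h₂
  | shiftTwo h h' hs' =>
    obtain ⟨h₁, h₂⟩ := hs.assoc' hs'
    exact hc _ hn.2 (hc _ hn.1 (hx.rename ((ren_sh 1 X).cons _)) h
      (h₁.push_right [_] rfl)) h' h₂

/-- The cuts commute with a rule of the premise. -/
theorem Typed.run_rule {op : Op α} {L : List (Formula α)} {Γ Δ Ξ Ψ X : Ctx α} (h : op.Typed L Ξ)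
    {k : ℕ} (hk : L.length = k) (hs : Γ.Split Δ Ξ) {s : Head α} {j : ℕ} {D E : Finset ℕ}
    {M : Bool → List (Formula α)} (hr : Rule s j Δ Ψ X M D) {ps : Bool → PreProof α}
    (hp : ∀ b, s.Branch b → T (ps b) (push (M b) (push L X))) (hE : IsDom E (X.join Ξ)) :
    op.run ((s.rename (· + k)).mk (j + k) (up k D) ps) =
      s.mk j E fun b => (op.rename (· + s.k)).run ((ps b).swap s.k k) := by
  subst hk
  have hl := hr.own.length
  cases h with
  | nil =>
    have hX : X.join (fun _ => none) = X := by
      funext n; simp only [join]; split_ifs <;> simp_all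
    rw [hX] at hE
    have hid : (fun n : ℕ => n + ([] : List (Formula α)).length) = id := rfl
    rw [hid, Head.rename_id, List.length_nil, up_zero, hE.unique hr.dom]
    exact Head.mk_congr fun b _ => (swap_zero_right _ _).symm
  | @one B c _ h =>
    have hp' : ∀ b, s.Branch b → T ((ps b).swap s.k 1) (cons B (push (M b) X)) := fun b hb =>
      (hp b hb).swap (M := [B]) (hl b) rfl
    simp only [Op.run, List.length_singleton]
    rw [Head.mk_eq_mk0, elim_mk0 _ fun b hb => ((hp' b hb).names 0).2 (by simp),
      hE.unique (Ctx.Split.dom (hs.assoc hr.split).2 hr.dom h.dom_down)]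
    rfl
  | @two B c B' c' _ Ξ₁ Ξ₂ h h' hs' =>
    obtain ⟨h₁, h₂⟩ := hs.assoc' hs'
    have hp' : ∀ b, s.Branch b → T ((ps b).swap s.k 1) (cons B (push (M b) (cons B' X))) :=
      fun b hb => (hp b hb).swap (L := M b) (M := [B]) (hl b) rfl
    obtain ⟨h₃, h₄⟩ := h₁.assoc hr.split
    have hsb : ∀ b, (push (M b) (cons B' (X.join Ξ₁))).Split (push (M b) (cons B' X))
        (sh s.k (sh 1 Ξ₁)) := fun b =>
      (h₄.push_left [B'] rfl).push_left (M b) (hl b)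
    have he : ∀ b, s.Branch b → T (elim B ((ps b).swap s.k 1) (c.shift s.k))
        (push (M b) (push [B'] (X.join Ξ₁))) := fun b hb => (hp' b hb).elim (h.shift s.k) (hsb b)
    have he' : ∀ b, s.Branch b → T ((elim B ((ps b).swap s.k 1) (c.shift s.k)).swap s.k 1)
        (cons B' (push (M b) (X.join Ξ₁))) := fun b hb =>
      (he b hb).swap (M := [B']) (hl b) rfl
    have hD : up 1 D ∪ down 1 c.names = up 1 (D ∪ down 1 (down 1 c.names)) := by
      ext n
      rcases n with _ | n
      · simp
      · simp
    have e₁ : (s.rename (· + 2)).mk (j + 2) (up 2 D) ps =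
        (s.rename (· + 1)).mk0 (j + 1) (up 1 D) fun b => (ps b).swap s.k 1 := by
      have h₁ := Head.mk_eq_mk0 (s.rename (· + 1)) (j + 1) (up 1 D) ps
      rw [Head.rename_rename, Head.k_rename] at h₁
      rw [← h₁]
      congr 1
      ext n
      rcases n with _ | _ | n <;> simp
    have hdom : D ∪ down 1 (down 1 c.names) ∪ down 1 c'.names = E := by
      refine IsDom.unique (Γ := X.join Ξ) ?_ hE
      have : IsDom (down 1 (down 1 c.names)) Ξ₁ := by
        intro n
        rw [mem_down, h.dom_down]; simp [sh]
      have := (h₄.dom hr.dom this)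
      have := Ctx.Split.dom (h₂.assoc h₃).2 this h'.dom_down
      have e : (X.join Ξ₁).join Ξ₂ = X.join Ξ := by
        rw [← join_split hs']
        funext n; simp only [join]; split_ifs <;> simp_all
      rwa [e] at this
    simp only [Op.run, List.length_cons, List.length_nil, zero_add, Nat.reduceAdd]
    -- The rule `s` goes below the first cut, then below the second. Both times it ends the left
    -- premise, hence an equality; the rest compares renamings.
    rw [e₁, elim_mk0 _ fun b hb => ((hp' b (by simpa using hb)).names 0).2 (by simp), hD,
      Head.mk_eq_mk0, elim_mk0 _ fun b hb => ?_, hdom]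
    · refine Head.mk_congr fun b hb => ?_
      simp only [Op.rename, Head.k_rename]
      rw [PreProof.swap, elim_rename (hp' b hb) (h.shift s.k) (hsb b).disjoint]
      congr 2
      · rw [PreProof.swap, PreProof.swap, PreProof.rename_rename]
        congr 1
        funext n
        rw [lift_eq_liftN]
        simp only [Function.comp, swapBlocks, liftN]
        split_ifs <;> omega
      · rw [PreProof.shift, PreProof.rename_rename, lift_comp]
        refine h.rename_eq ?_
        rintro (_ | _ | n) A hA
        · rfl
        · simp [sh] at hA
        · simp [lift, swapBlocks]; omega
    · rw [Head.k_rename]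
      exact ((he' b hb).names 0).2 (by simp)
  | @shiftTwo B c B' c' _ Ξ₁ Ξ₂ h h' hs' =>
    obtain ⟨h₁, h₂⟩ := hs.assoc' hs'
    have hp' : ∀ b, s.Branch b → T ((ps b).swap s.k 1) (cons B (push (M b) X)) :=
      fun b hb => (hp b hb).swap (L := M b) (M := [B]) (hl b) rfl
    have hp'' : ∀ b, s.Branch b → T (((ps b).swap s.k 1).rename (lift (liftN s.k (· + 1))))
        (cons B (push (M b) (sh 1 X))) := fun b hb => (hp' b hb).rename (by
      have := ((ren_sh 1 X).push (M b)).cons B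
      rwa [hl b] at this)
    obtain ⟨h₃, h₄⟩ := h₁.assoc hr.split
    have hsb : ∀ b, (push (M b) (cons B' (X.join Ξ₁))).Split (push (M b) (sh 1 X))
        (sh s.k (cons B' Ξ₁)) := fun b =>
      (h₄.push_right [B'] rfl).push_left (M b) (hl b)
    have he : ∀ b, s.Branch b → T (elim B (((ps b).swap s.k 1).rename (lift (liftN s.k (· + 1))))
        (c.shift s.k)) (push (M b) (push [B'] (X.join Ξ₁))) := fun b hb =>
      (hp'' b hb).elim (h.shift s.k) (hsb b)
    have he' : ∀ b, s.Branch b → T ((elim B (((ps b).swap s.k 1).rename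
        (lift (liftN s.k (· + 1)))) (c.shift s.k)).swap s.k 1)
        (cons B' (push (M b) (X.join Ξ₁))) := fun b hb =>
      (he b hb).swap (M := [B']) (hl b) rfl
    have hD : D.image (· + 1) ∪ down 1 c.names = up 1 (D ∪ down 1 (down 1 c.names)) := by
      ext n
      rcases n with _ | n
      · simp [h.names 1]
      · simp
    have hdom : D ∪ down 1 (down 1 c.names) ∪ down 1 c'.names = E := by
      refine IsDom.unique (Γ := X.join Ξ) ?_ hE
      have : IsDom (down 1 (down 1 c.names)) Ξ₁ := by
        intro n
        rw [mem_down, h.dom_down]; simp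
      have := (h₄.dom hr.dom this)
      have := Ctx.Split.dom (h₂.assoc h₃).2 this h'.dom_down
      have e : (X.join Ξ₁).join Ξ₂ = X.join Ξ := by
        rw [← join_split hs']
        funext n; simp only [join]; split_ifs <;> simp_all
      rwa [e] at this
    simp only [Op.run, List.length_cons, List.length_nil, zero_add]
    rw [Head.mk_eq_mk0, PreProof.shift, Head.rename_mk0,
      elim_mk0 _ fun b hb => ((hp'' b (by simpa using hb)).names 0).2 (by simp), hD,
      Head.mk_eq_mk0, elim_mk0 _ fun b hb => ?_, hdom]
    · refine Head.mk_congr fun b hb => ?_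
      simp only [Op.rename, Head.k_rename]
      rw [PreProof.swap, elim_rename (hp'' b hb) (h.shift s.k) (hsb b).disjoint]
      congr 2
      · rw [PreProof.shift, PreProof.rename_rename, lift_comp]
        congr 2
        funext n
        simp only [Function.comp, swapBlocks, liftN]
        split_ifs <;> omega
      · rw [PreProof.shift, PreProof.rename_rename, lift_comp]
        congr 2
        funext n
        rcases n with _ | n <;> simp [lift, swapBlocks]
        omega
    · rw [Head.k_rename]
      exact ((he' b hb).names 0).2 (by simp)

end Op

/-- The rule `r` introduces `A`, and a cut between this rule and `q` becomes the cuts `op` on the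
premise `a`, which replace the occurrences `L a` by the context `Ξ`. -/
inductive HeadCut : Formula α → Head α → (Bool → List (Formula α)) → Ctx α → PreProof α → Bool →
    Op α → Prop
  | parr {A B Ξ Ξ₁ Ξ₂ q₁ q₂} (h : Ξ.Split Ξ₁ Ξ₂) (h₂ : T q₂ (cons A.dual Ξ₁))
      (h₁ : T q₁ (cons B.dual Ξ₂)) :
      HeadCut (.parr A B) .parr (fun _ => [A, B]) Ξ (.tens 0 (q₁.shift 1) (q₂.shift 1)) false
        (.two A (q₂.shift 1) B q₁)
  | bot : HeadCut .bot .bot (fun _ => []) (fun _ => none) (.one 0) false .nil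
  | wth₁ {A B Ξ q} (h : T q (cons B.dual Ξ)) :
      HeadCut (.wth A B) .wth (fun b => cond b [B] [A]) Ξ (.plus .fst 0 (q.shift 1)) true (.one B q)
  | wth₂ {A B Ξ q} (h : T q (cons A.dual Ξ)) :
      HeadCut (.wth A B) .wth (fun b => cond b [B] [A]) Ξ (.plus .snd 0 (q.shift 1)) false
        (.one A q)
  | plus₁ {A B Ξ q₁ q₂} (h₁ : T q₁ (cons B.dual Ξ)) (h₂ : T q₂ (cons A.dual Ξ)) :
      HeadCut (.plus A B) (.plus .fst) (fun _ => [A]) Ξ (.wth 0 (q₁.shift 1) (q₂.shift 1)) false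
        (.one A q₂)
  | plus₂ {A B Ξ q₁ q₂} (h₁ : T q₁ (cons B.dual Ξ)) (h₂ : T q₂ (cons A.dual Ξ)) :
      HeadCut (.plus A B) (.plus .snd) (fun _ => [B]) Ξ (.wth 0 (q₁.shift 1) (q₂.shift 1)) false
        (.one B q₁)
  | tensL {A B Ξ Ξ₁ Ξ₂ t q} (h : Ξ.Split Ξ₁ Ξ₂) (ht : T t (cons B Ξ₁))
      (hq : T q (cons B.dual (cons A.dual Ξ₂))) :
      HeadCut (.tens A B) (.tensL (t.shift 1)) (fun _ => [A]) Ξ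
        (.parr 0 (q.rename (lift (lift (· + 1))))) false (.one A (elim B (t.shift 1) q))
  | tensR {A B Ξ Ξ₁ Ξ₂ t q} (h : Ξ.Split Ξ₁ Ξ₂) (ht : T t (cons A Ξ₂))
      (hq : T q (cons B.dual (cons A.dual Ξ₁))) :
      HeadCut (.tens A B) (.tensR (t.shift 1)) (fun _ => [B]) Ξ
        (.parr 0 (q.rename (lift (lift (· + 1))))) false (.shiftTwo B q A.dual t)

/-- Both sides introduce the cut formula, so the cut turns into cuts on subformulas, applied to a
single premise of `r`. For a `⊗`-rule the context of the fixed premise goes to `Ξ`. A `⊤`-rule is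
impossible, as no rule introduces its dual. -/
theorem Rule.exists_headCut {r : Head α} {A : Formula α} {Γ Δ Θ Φ Y : Ctx α}
    {L : Bool → List (Formula α)} {D : Finset ℕ} {q : PreProof α} (h : Rule r 0 (cons A Δ) Φ Y L D)
    (hq : Princ A.dual Θ q) (hs : Γ.Split Δ Θ) :
    ∃ Ξ a op, HeadCut A r L Ξ q a op ∧ Γ.Split (fun n => Y (n + 1)) Ξ ∧ Y 0 = none := by
  obtain ⟨ho, hs', hd⟩ := h
  have hY : Y 0 = none := by
    obtain ⟨B, hB⟩ := ho.ne_none; have := hs' 0; grind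
  have key : ∀ C, Φ = single 0 C → A = C ∧ (fun n => Y (n + 1)) = Δ := by
    rintro C rfl
    have h₁ := Rule.single_apply hs'
    have h₂ := Rule.erase_single hs'
    refine ⟨by simpa using h₁, ?_⟩
    funext n; rw [← h₂]; simp [erase]
  cases r with
  | parr =>
    obtain ⟨B, C, rfl, rfl⟩ := ho
    obtain ⟨rfl, e⟩ := key _ rfl
    rw [e]
    simp only [Formula.dual] at hq
    cases hq with
    | tens h h₁ h₂ => exact ⟨_, _, _, .parr h.symm h₂ h₁, hs, hY⟩
  | bot =>
    obtain ⟨rfl, rfl⟩ := ho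
    obtain ⟨rfl, e⟩ := key _ rfl
    rw [e]
    simp only [Formula.dual] at hq
    cases hq with
    | one => exact ⟨_, _, _, .bot, hs, hY⟩
  | wth =>
    obtain ⟨B, C, rfl, rfl⟩ := ho
    obtain ⟨rfl, e⟩ := key _ rfl
    rw [e]
    simp only [Formula.dual] at hq
    cases hq with
    | plus₁ h => exact ⟨_, _, _, .wth₁ h, hs, hY⟩
    | plus₂ h => exact ⟨_, _, _, .wth₂ h, hs, hY⟩
  | plus k =>
    cases k
    all_goals
      obtain ⟨B, C, rfl, rfl⟩ := ho
      obtain ⟨rfl, e⟩ := key _ rfl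
      rw [e]
      simp only [Formula.dual] at hq
      cases hq with
      | wth h₁ h₂ => first | exact ⟨_, _, _, .plus₁ h₁ h₂, hs, hY⟩ | exact ⟨_, _, _, .plus₂ h₁ h₂, hs, hY⟩
  | top =>
    obtain ⟨rfl, rfl⟩ := ho
    obtain ⟨rfl, e⟩ := key _ rfl
    simp only [Formula.dual] at hq
    cases hq
  | tensL t | tensR t =>
    obtain ⟨B, C, h, h', rfl⟩ := ho
    have hA : A = B.tens C := by have := hs' 0; simp only [cons_zero] at this; grind
    subst hA
    obtain ⟨t', ht', rfl⟩ := T.shift_of h' (by simp [erase])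
    have hs₁ : Δ.Split (fun n => Y (n + 1)) (fun n => Φ.erase 0 (n + 1)) := by
      intro n
      have := hs' (n + 1)
      simp only [erase, cons_succ] at this ⊢
      grind
    obtain ⟨h₁, h₂⟩ := hs.assoc hs₁
    simp only [Formula.dual] at hq
    cases hq with
    | parr hq =>
      first
      | exact ⟨_, _, _, .tensL h₂ ht' hq, h₁, hY⟩
      | exact ⟨_, _, _, .tensR h₂.symm ht' hq, h₁, hY⟩

/-- A variant of `elim_symm`. -/
theorem elim_symm_dual {A : Formula α} {Γ Δ Θ : Ctx α} {p q : PreProof α}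
    (hp : T p (cons A.dual Δ)) (hq : T q (cons A Θ)) (hs : Γ.Split Δ Θ) :
    CommEquiv Γ (elim A.dual p q) (elim A q p) := (elim_symm hq hp hs.symm).symm

namespace HeadCut

variable {A : Formula α} {r : Head α} {L : Bool → List (Formula α)} {Ξ : Ctx α} {q : PreProof α}
  {a : Bool} {op : Op α}

theorem branch (h : HeadCut A r L Ξ q a op) : r.Branch a := by
  cases h <;> simp [Head.Branch]

theorem small (h : HeadCut A r L Ξ q a op) : op.Small A.size := by
  cases h <;> simp [Op.Small, Formula.size]

theorem typed (h : HeadCut A r L Ξ q a op) : op.Typed (L a) Ξ := by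
  cases h with
  | parr h h₂ h₁ => exact .two (h₂.shift 1) h₁ h
  | bot => exact .nil
  | wth₁ h => exact .one h
  | wth₂ h => exact .one h
  | plus₁ h₁ h₂ => exact .one h₂
  | plus₂ h₁ h₂ => exact .one h₁
  | @tensL A B _ _ _ _ _ h ht hq =>
    exact .one ((ht.shift 1).elim hq (h.push_right [A.dual] rfl))
  | tensR h ht hq => exact .shiftTwo hq (by rwa [Formula.dual_dual]) h

theorem rename (h : HeadCut A r L Ξ q a op) {f : ℕ → ℕ} {Ξ' : Ctx α} (hf : Ren f Ξ Ξ') :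
    HeadCut A (r.rename (lift f)) L Ξ' (q.rename (lift f)) a (op.rename f) := by
  cases h with
  | parr h h₂ h₁ =>
    obtain ⟨h₃, h₄, h₅⟩ := hf.split h
    simp only [PreProof.rename, Op.rename, shift_one_rename]
    exact .parr h₅ (h₂.rename (h₃.cons _)) (h₁.rename (h₄.cons _))
  | bot =>
    have : Ξ' = fun _ => none := by
      funext n
      by_contra hc
      obtain ⟨A, hA⟩ := Option.ne_none_iff_exists'.1 hc
      obtain ⟨m, hm, -⟩ := hf.back hA
      simp at hm
    subst this
    exact .bot
  | wth₁ h =>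
    simp only [PreProof.rename, Op.rename, shift_one_rename]
    exact .wth₁ (h.rename (hf.cons _))
  | wth₂ h =>
    simp only [PreProof.rename, Op.rename, shift_one_rename]
    exact .wth₂ (h.rename (hf.cons _))
  | plus₁ h₁ h₂ =>
    simp only [PreProof.rename, Op.rename, shift_one_rename]
    exact .plus₁ (h₁.rename (hf.cons _)) (h₂.rename (hf.cons _))
  | plus₂ h₁ h₂ =>
    simp only [PreProof.rename, Op.rename, shift_one_rename]
    exact .plus₂ (h₁.rename (hf.cons _)) (h₂.rename (hf.cons _))
  | @tensL A B _ _ _ _ _ h ht hq =>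
    obtain ⟨h₃, h₄, h₅⟩ := hf.split h
    simp only [PreProof.rename, Op.rename, Head.rename, shift_one_rename,
      rename_lift_lift_succ_rename, elim_rename (ht.shift 1) hq
        (h.push_right [A.dual] rfl).disjoint]
    exact .tensL h₅ (ht.rename (h₃.cons _)) (hq.rename ((h₄.cons _).cons _))
  | tensR h ht hq =>
    obtain ⟨h₃, h₄, h₅⟩ := hf.split h
    simp only [PreProof.rename, Op.rename, Head.rename, shift_one_rename,
      rename_lift_lift_succ_rename]
    exact .tensR h₅ (ht.rename (h₄.cons _)) (hq.rename ((h₃.cons _).cons _))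

/-- A key case may put the premise of `r` on the right of the new cuts, while `op` always keeps it
on the left, so that rules of this premise go below by equality (`Op.Typed.run_rule`). The symmetry
of cuts makes up the difference, hence the result only up to commutations. In the `⅋` case the
symmetry is also used under the outer cut, whence the hypothesis on smaller formulas. -/
theorem elim (h : HeadCut A r L Ξ q a op) (hc : ∀ B : Formula α, B.size < A.size → Congr B)
    {Γ X : Ctx α} (hs : Γ.Split X Ξ) (D : Finset ℕ) {x : Bool → PreProof α}
    (hx : ∀ b, r.Branch b → T (x b) (push (L b) X)) :
    CommEquiv Γ (elim A (r.mk 0 D fun b => (x b).rename (liftN r.k (· + 1))) q)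
      (op.run (x a)) := by
  have ha := hx a h.branch
  have hT := h.typed.run hs ha
  cases h with
  | @parr A B _ _ _ q₁ q₂ h h₂ h₁ =>
    have e := KeyShape.elim_swap (KeyShape.tens_parr (A := B.dual) (B := A.dual) (p₁ := q₁) (p₂ := q₂)
      (p₃ := x false))
    simp only [Formula.dual, Formula.dual_dual, elim_tens_parr] at e
    simp only [Head.mk, Head.k, liftN_two, Op.run]
    rw [e]
    obtain ⟨h₃, h₄⟩ := hs.assoc' h
    have hs' := h₃.push_left [B] rfl
    have h₅ := elim_symm_dual (A := A) (h₂.shift 1) ha hs'.symm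
    have h₆ := elim_symm_dual (A := B) h₁ h₅.typed.1 h₄.symm
    exact h₆.trans (hc B (by simp [Formula.size]) h₅ h₁ h₄)
  | bot =>
    have e := KeyShape.elim_swap (KeyShape.one_bot (p := x false))
    simp only [Formula.dual, elim_one_bot] at e
    simp only [Head.mk, Head.k, liftN_zero]
    rw [e]
    exact .refl hT
  | @wth₁ A B _ q h =>
    simp only [Head.mk, Head.k, liftN_one]
    have e := elim_wth_plus₁ A B (x false) (x true) q
    simp only [PreProof.shift] at e ⊢
    rw [e]
    exact .refl hT
  | @wth₂ A B _ q h =>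
    simp only [Head.mk, Head.k, liftN_one]
    have e := elim_wth_plus₂ A B (x false) (x true) q
    simp only [PreProof.shift] at e ⊢
    rw [e]
    exact .refl hT
  | @plus₁ A B _ q₁ q₂ h₁ h₂ =>
    have e := KeyShape.elim_swap (KeyShape.wth_plus₁ (A := B.dual) (B := A.dual) (p₁ := q₁) (p₂ := q₂)
      (p₃ := x false))
    simp only [Formula.dual, Formula.dual_dual, elim_wth_plus₁] at e
    simp only [Head.mk, Head.k, liftN_one]
    rw [PreProof.shift] at e
    rw [e]
    exact elim_symm_dual h₂ ha hs.symm
  | @plus₂ A B _ q₁ q₂ h₁ h₂ =>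
    have e := KeyShape.elim_swap (KeyShape.wth_plus₂ (A := B.dual) (B := A.dual) (p₁ := q₁) (p₂ := q₂)
      (p₃ := x false))
    simp only [Formula.dual, Formula.dual_dual, elim_wth_plus₂] at e
    simp only [Head.mk, Head.k, liftN_one]
    rw [PreProof.shift] at e
    rw [e]
    exact elim_symm_dual h₁ ha hs.symm
  | @tensL A B _ _ _ t q h ht hq =>
    have e := elim_tens_parr A B (x false) t q
    simp only [Head.mk, Head.k, liftN_one]
    simp only [PreProof.shift] at e hT ⊢
    rw [e]
    exact .refl hT
  | @tensR A B _ _ _ t q h ht hq =>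
    have e := elim_tens_parr A B t (x false) q
    simp only [Head.mk, Head.k, liftN_one]
    simp only [Op.run]
    rw [← PreProof.shift, e]
    obtain ⟨h₃, h₄⟩ := hs.assoc' h
    exact elim_symm ht (T.elim (T.shift ha 1) hq (h₃.push_right [_] rfl)) h₄.symm

end HeadCut

theorem Rule.elim_side {r : Head α} {n : ℕ} {A : Formula α} {Δ Φ Y : Ctx α}
    {L : Bool → List (Formula α)} {D : Finset ℕ} {ps : Bool → PreProof α}
    (h : Rule r (n + 1) (cons A Δ) Φ Y L D) (h0 : Φ 0 = none)
    (hp : ∀ b, r.Branch b → T (ps b) (Ctx.push (L b) Y)) (q : PreProof α) :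
    elim A (r.mk (n + 1) D ps) q = (r.rename Nat.pred).mk n (down 1 D ∪ down 1 q.names) fun b =>
      elim A ((ps b).swap r.k 1) (q.shift r.k) := by
  have := (IsRule.side ⟨rfl, h, hp⟩ h0).elim A q
  rwa [Head.k_rename] at this

/-- A cut on `A` with `q` in the fixed premise. -/
noncomputable def Head.cutFixed (A : Formula α) (q : PreProof α) : Head α → Head α
  | .tensL t => .tensL (elim A (t.swap 1 1) (q.shift 1))
  | .tensR t => .tensR (elim A (t.swap 1 1) (q.shift 1))
  | r => r

@[simp] theorem Head.k_cutFixed (A : Formula α) (q : PreProof α) (r : Head α) :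
    (r.cutFixed A q).k = r.k := by cases r <;> rfl

@[simp] theorem Head.branch_cutFixed (A : Formula α) (q : PreProof α) (r : Head α) (b : Bool) :
    (r.cutFixed A q).Branch b ↔ r.Branch b := by cases r <;> rfl

/-- The rule is a `⊗`-rule with the cut formula in its fixed premise: the cut moves into that
premise, and the other one only loses the name `0`. A `⊗`-rule ignores its set of names, so `D'` is
arbitrary. -/
theorem Rule.elim_fixed {r : Head α} {n : ℕ} {A : Formula α} {Δ Φ Y : Ctx α}
    {L : Bool → List (Formula α)} {D : Finset ℕ} {ps : Bool → PreProof α}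
    (h : Rule r (n + 1) (cons A Δ) Φ Y L D) (h0 : Φ 0 = some A)
    (hp : ∀ b, r.Branch b → T (ps b) (Ctx.push (L b) Y)) (q : PreProof α) (D' : Finset ℕ) :
    elim A (r.mk (n + 1) D ps) q =
      (r.cutFixed A q).mk n D' fun b => (ps b).rename (liftN r.k Nat.pred) := by
  have hY : Y 0 = none := by have := h.split 0; grind
  obtain ⟨ho, hs, hd⟩ := h
  rcases ho.zero h0 (by omega) with ⟨t, rfl⟩ | ⟨t, rfl⟩
  all_goals
    obtain ⟨B, C, h, h', rfl⟩ := ho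
    obtain ⟨p, hp', e⟩ := T.shift_of (Γ := Y) (hp false rfl) hY
    have hm : 0 ∈ (t.swap 1 1).names := by
      rw [PreProof.swap, names_rename, Finset.mem_image]
      exact ⟨1, (h'.names 1).2 (by simp [erase, h0]), rfl⟩
    simp only [Head.mk, Head.cutFixed, Head.k, e, liftN_one, rename_lift_pred_shift]
  · have := elim_mk0 (A := A) (r := .tensR p) (i := n) (D := ∅) (ps := fun _ => t.swap 1 1) q
      fun _ _ => hm
    simp only [Head.mk0, Head.mk, Head.rename, Head.k, swap_swap] at this
    exact this
  · have := elim_mk0 (A := A) (r := .tensL p) (i := n) (D := ∅) (ps := fun _ => t.swap 1 1) q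
      fun _ _ => hm
    simp only [Head.mk0, Head.mk, Head.rename, Head.k, swap_swap] at this
    exact this

theorem Rule.cutFixed {r : Head α} {n : ℕ} {A : Formula α} {Γ Δ Θ Φ Y : Ctx α}
    {L : Bool → List (Formula α)} {D : Finset ℕ} {q : PreProof α}
    (h : Rule r (n + 1) (cons A Δ) Φ Y L D) (h0 : Φ 0 = some A) (hq : T q (cons A.dual Θ))
    (hΓ : Γ.Split Δ Θ) :
    Rule (r.cutFixed A q) n Γ (Ctx.join (fun n => Φ (n + 1)) Θ) (fun n => Y (n + 1)) L
      (down 1 D) := by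
  obtain ⟨ho, hs, hd⟩ := h
  refine ⟨?_, fun m => ?_, fun m => by rw [mem_down, hd]⟩
  · rcases ho.zero h0 (by omega) with ⟨t, rfl⟩ | ⟨t, rfl⟩
    all_goals
      obtain ⟨B, C, h, h', rfl⟩ := ho
      refine ⟨B, C, by simp [Ctx.join, h], ?_, rfl⟩
      have hs' : (Ctx.erase (Ctx.join (fun n => Φ (n + 1)) Θ) n).Split
          (Ctx.erase (fun n => Φ (n + 1)) n) Θ := by
        intro m
        have h₁ := hs (m + 1)
        have h₂ := hΓ m
        simp only [Ctx.join, erase, cons_succ] at h₁ ⊢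
        grind
      have e : Φ.erase (n + 1) = cons A (Ctx.erase (fun n => Φ (n + 1)) n) := by
        funext m
        rcases m with _ | m <;> simp [erase, h0]
      rw [e] at h'
      first
      | exact T.elim (T.swap (L := [C]) (M := [A]) (a := 1) (b := 1) h' rfl rfl) (hq.shift 1)
          (hs'.push_left [C] rfl)
      | exact T.elim (T.swap (L := [B]) (M := [A]) (a := 1) (b := 1) h' rfl rfl) (hq.shift 1)
          (hs'.push_left [B] rfl)
  · have h₁ := hs (m + 1)
    have h₂ := hΓ m
    simp only [Ctx.join, cons_succ] at h₁ ⊢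
    grind

theorem Rule.cutFixed_rename {r : Head α} {n : ℕ} {A : Formula α} {Γ Δ Θ Φ Y : Ctx α}
    {L : Bool → List (Formula α)} {D : Finset ℕ} {q : PreProof α}
    (h : Rule r (n + 1) (cons A Δ) Φ Y L D) (h0 : Φ 0 = some A) (hq : T q (cons A.dual Θ))
    (hΓ : Γ.Split Δ Θ) (f : ℕ → ℕ) :
    (r.rename (lift f)).cutFixed A (q.rename (lift f)) = (r.cutFixed A q).rename f := by
  obtain ⟨ho, hs, hd⟩ := h
  rcases ho.zero h0 (by omega) with ⟨t, rfl⟩ | ⟨t, rfl⟩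
  all_goals
    obtain ⟨B, C, h, h', rfl⟩ := ho
    have hs' : (Ctx.erase (Ctx.join (fun n => Φ (n + 1)) Θ) n).Split
        (Ctx.erase (fun n => Φ (n + 1)) n) Θ := by
      intro m
      have h₁ := hs (m + 1)
      have h₂ := hΓ m
      simp only [Ctx.join, erase, cons_succ] at h₁ ⊢
      grind
    have e : Φ.erase (n + 1) = cons A (Ctx.erase (fun n => Φ (n + 1)) n) := by
      funext m
      rcases m with _ | m <;> simp [erase, h0]
    rw [e] at h'
    simp only [Head.rename, Head.cutFixed]
    congr 1
  · rw [elim_rename (T.swap (L := [C]) (M := [A]) (a := 1) (b := 1) h' rfl rfl) (hq.shift 1)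
      (hs'.push_left [C] rfl).disjoint, shift_one_rename, ← liftN_one, ← liftN_one, swap_rename]
  · rw [elim_rename (T.swap (L := [B]) (M := [A]) (a := 1) (b := 1) h' rfl rfl) (hq.shift 1)
      (hs'.push_left [B] rfl).disjoint, shift_one_rename, ← liftN_one, ← liftN_one, swap_rename]

theorem HeadCut.elim_mk {A : Formula α} {r : Head α} {L : Bool → List (Formula α)}
    {Ξ Γ Y : Ctx α} {q : PreProof α} {a : Bool} {op : Op α} (h : HeadCut A r L Ξ q a op)
    (hc : ∀ B : Formula α, B.size < A.size → Congr B) (hs : Γ.Split (fun n => Y (n + 1)) Ξ)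
    (hY : Y 0 = none) (D : Finset ℕ) {ps : Bool → PreProof α}
    (hl : ∀ b, (L b).length = r.k) (hp : ∀ b, r.Branch b → T (ps b) (push (L b) Y)) :
    CommEquiv Γ (MALL.elim A (r.mk 0 D ps) q)
      (op.run ((ps a).rename (liftN r.k Nat.pred))) := by
  have := h.elim hc hs D (x := fun b => (ps b).rename (liftN r.k Nat.pred)) fun b hb => by
    have := (hp b hb).rename ((ren_pred hY).push (L b))
    rwa [hl b] at this
  convert this using 2
  refine Head.mk_congr fun b hb => ?_
  obtain ⟨p', hp', e⟩ := T.exists_rename_succ (hp b hb) hY (hl b)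
  rw [e, PreProof.rename_rename, PreProof.rename_rename]
  congr 1
  funext n
  simp only [Function.comp, liftN]
  split_ifs <;> first | omega | simp

/-- Induction on rule commutations, with a hypothesis on all renamings of the premises. -/
theorem CommEquiv.rename_induction {P : Ctx α → PreProof α → PreProof α → Prop}
    (refl : ∀ {Γ p}, T p Γ → P Γ p p) (symm : ∀ {Γ p q}, P Γ p q → P Γ q p)
    (trans : ∀ {Γ p q r}, P Γ p q → P Γ q r → P Γ p r)
    (mk : ∀ {r : Head α} {i Γ Φ Δ L D ps ps'}, Rule r i Γ Φ Δ L D →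
      (∀ b, r.Branch b → CommEquiv (push (L b) Δ) (ps b) (ps' b)) →
      (∀ b, r.Branch b → ∀ {f Γ'}, Ren f (push (L b) Δ) Γ' →
        P Γ' ((ps b).rename f) ((ps' b).rename f)) →
      P Γ (r.mk i D ps) (r.mk i D ps'))
    (comm : ∀ {r s : Head α} {i j Γ Φ Ψ Y Z Δ L M D₁ D₂ D} {ps : Bool → Bool → PreProof α},
      Rule r i Γ Φ Y L D₁ → Rule s j Y Ψ Δ M D → Rule s j Γ Ψ Z M D₂ →
      (∀ a b, r.Branch a → s.Branch b → T (ps a b) (push (M b) (push (L a) Δ))) →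
      P Γ (r.mk i D₁ fun a => (s.rename (· + r.k)).mk (j + r.k) (up r.k D) (ps a))
        (s.mk j D₂ fun b => (r.rename (· + s.k)).mk (i + s.k) (up s.k D)
          fun a => (ps a b).swap s.k r.k))
    {Γ : Ctx α} {p q : PreProof α} (h : CommEquiv Γ p q) : P Γ p q := by
  -- Moving a rule below a cut renames its premises, so an induction hypothesis on the premises
  -- alone would not apply. The statement is proved for all renamings together.
  suffices ∀ f Γ', Ren f Γ Γ' → P Γ' (p.rename f) (q.rename f) by
    have := this id Γ (Ren.id_of Γ fun _ _ _ => rfl)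
    rwa [PreProof.rename_id, PreProof.rename_id] at this
  induction h with
  | refl h => exact fun f Γ' hf => refl (h.rename hf)
  | symm _ ih => exact fun f Γ' hf => symm (ih f Γ' hf)
  | trans _ _ ih ih' => exact fun f Γ' hf => trans (ih f Γ' hf) (ih' f Γ' hf)
  | @mk r i Γ Φ Δ L D ps ps' h hp ih =>
    intro f Γ' hf
    rw [Head.rename_mk, Head.rename_mk]
    have hΔ := (hf.split h.split).2.1
    refine mk (h.rename hf) (fun b hb => ?_) fun b hb g Γ'' hg => ?_ <;>
      rw [Head.branch_rename] at hb
    · rw [← h.own.length b]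
      exact (hp b hb).rename (hΔ.push _)
    · rw [PreProof.rename_rename, PreProof.rename_rename, ← h.own.length b]
      exact ih b hb _ _ ((hΔ.push _).comp hg)
  | @comm r s i j Γ Φ Ψ Y Z Δ L M D₁ D₂ D ps hr hs' hs hp =>
    intro f Γ' hf
    have hY := (hf.split hr.split).2.1
    have hΔ := (hY.split hs'.split).2.1
    have := comm (hr.rename hf) (hs'.rename hY) (hs.rename hf)
      (ps := fun a b => (ps a b).rename (liftN s.k (liftN r.k f))) (fun a b ha hb => by
        rw [Head.branch_rename] at ha hb
        have e := (hp a b ha hb).rename ((hΔ.push (L a)).push (M b))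
        rwa [hr.own.length a, hs.own.length b] at e)
    simp only [Head.rename_mk, Head.rename_add_rename_liftN, image_liftN_up, Head.k_rename,
      swap_rename] at this ⊢
    have e : ∀ i k, liftN k f (i + k) = f i + k := by intro i k; simp [liftN]
    rw [e, e]
    exact this

/-- Commutations above the last rule. If the rule introduces `A`, the cuts on smaller formulas
respect them. If `A` lies in the premises, the rule goes below the cut and the hypothesis on
premises applies. If `A` lies in a fixed premise, the commuted premises are merely renamed. -/
theorem elim_mk_congr {A : Formula α} (hc : ∀ B : Formula α, B.size < A.size → Congr B)
    {Γ Δ Θ Φ Y : Ctx α} {q : PreProof α} {r : Head α} {i : ℕ} {L : Bool → List (Formula α)}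
    {D : Finset ℕ} {ps ps' : Bool → PreProof α} (hr : Rule r i (cons A Δ) Φ Y L D)
    (hp : ∀ b, r.Branch b → CommEquiv (push (L b) Y) (ps b) (ps' b)) (hq : Princ A.dual Θ q)
    (hs : Γ.Split Δ Θ)
    (ih : ∀ b, r.Branch b → ∀ {f Δ' Θ' Γ' q'}, Ren f (push (L b) Y) (cons A Δ') →
      Princ A.dual Θ' q' → Γ'.Split Δ' Θ' →
      CommEquiv Γ' (elim A ((ps b).rename f) q') (elim A ((ps' b).rename f) q')) :
    CommEquiv Γ (elim A (r.mk i D ps) q) (elim A (r.mk i D ps') q) := by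
  have hl := hr.own.length
  rcases i with _ | n
  · obtain ⟨Ξ, a, op, h, hΓ, hY⟩ := hr.exists_headCut hq hs
    have hX := (hp a h.branch).rename ((ren_pred hY).push (L a))
    rw [hl] at hX
    exact ((h.elim_mk hc hΓ hY D hl fun b hb => (hp b hb).typed.1).trans
      (h.typed.run_congr hΓ h.small hc hX)).trans
      (h.elim_mk hc hΓ hY D hl fun b hb => (hp b hb).typed.2).symm
  · cases h0 : Φ 0 with
    | none =>
      rw [hr.elim_side h0 fun b hb => (hp b hb).typed.1,
        hr.elim_side h0 fun b hb => (hp b hb).typed.2]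
      obtain ⟨h₁, h₂, -, -⟩ := hr.uncons h0
      refine .mk (h₁.join hs hq.typed.dom_down) fun b hb => ?_
      rw [Head.branch_rename] at hb
      have hf := ren_swap (L b) [A] fun n => Y (n + 1)
      rw [hl b] at hf
      simp only [push, h₂, List.length_singleton] at hf
      exact ih b hb hf (hq.shift r.k) ((hs.assoc h₁.split).2.push_left _ (hl b))
    | some C =>
      obtain rfl : C = A := by have := hr.split 0; simp only [cons_zero] at this; grind
      have hY : Y 0 = none := by have := hr.split 0; grind
      rw [hr.elim_fixed h0 (fun b hb => (hp b hb).typed.1) q (down 1 D),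
        hr.elim_fixed h0 (fun b hb => (hp b hb).typed.2) q (down 1 D)]
      refine .mk (hr.cutFixed h0 hq.typed hs) fun b hb => ?_
      rw [Head.branch_cutFixed] at hb
      rw [← hl b]
      exact (hp b hb).rename ((ren_pred hY).push (L b))

theorem Head.mk_swap_one (s : Head α) (k m : ℕ) (D : Finset ℕ) (ps : Bool → PreProof α) :
    (((s.rename (· + 1)).rename (· + k)).mk (m + 1 + k) (up k (up 1 D)) ps).swap k 1 =
      (s.rename (· + k)).mk0 (m + k) (up k D) fun b => (ps b).swap (s.k + k) 1 := by
  rw [PreProof.swap, Head.rename_mk, Head.mk0, Head.rename_rename, Head.rename_rename,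
    Head.rename_rename]
  have h₁ : swapBlocks k 1 (m + 1 + k) = m + k + 1 := by
    simp only [swapBlocks]; split_ifs <;> omega
  have h₂ : (up k (up 1 D)).image (swapBlocks k 1) = up 1 (up k D) := by
    ext n
    simp only [Finset.mem_image, mem_up, swapBlocks]
    constructor
    · rintro ⟨m, hm, rfl⟩
      split_ifs
      · omega
      · omega
      · right
        rcases hm with hm | ⟨hm, hm' | ⟨hm', h⟩⟩
        · omega
        · omega
        · exact ⟨by omega, .inr ⟨by omega, by convert h using 1; omega⟩⟩
    · rintro (hn | ⟨hn, hn' | ⟨hn', h⟩⟩)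
      · exact ⟨k, by omega, by split_ifs <;> omega⟩
      · exact ⟨n - 1, by omega, by split_ifs; omega⟩
      · exact ⟨n, .inr ⟨by omega, .inr ⟨by omega, by convert h using 1; omega⟩⟩,
          by split_ifs <;> omega⟩
  have h₃ : (swapBlocks k 1 ∘ fun n => n + k) ∘ (fun n => n + 1) =
      (fun n => n + 1) ∘ fun n => n + k := by
    funext n; simp only [Function.comp, swapBlocks]; split_ifs <;> omega
  rw [h₁, h₂, h₃, Head.rename_rename]
  congr 1
  funext b
  simp only [PreProof.swap, PreProof.rename_rename, Head.k_rename]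
  congr 1
  funext n
  simp only [Function.comp, swapBlocks, liftN]
  split_ifs <;> omega

theorem up_union_down (k : ℕ) (D : Finset ℕ) (q : PreProof α) :
    up k (D ∪ down 1 q.names) = up k D ∪ down 1 (q.shift k).names := by
  rw [PreProof.shift, ← image_down_names, Finset.union_comm D, up_union, Finset.union_comm]
  ext n
  simp only [Finset.mem_union, Finset.mem_image, mem_up]
  grind

section comm

variable {A : Formula α} {Γ Δ Θ Φ Ψ X Y Z : Ctx α} {q : PreProof α} {r s : Head α} {n m : ℕ}
  {L M : Bool → List (Formula α)} {D₁ D₂ D : Finset ℕ} {ps : Bool → Bool → PreProof α}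

/-- Neither rule consumes the cut formula: both go below the cut, in either order, and commute
there. -/
theorem elim_comm_side (hr : Rule r (n + 1) (cons A Δ) Φ Y L D₁) (hs' : Rule s (m + 1) Y Ψ X M D)
    (hs : Rule s (m + 1) (cons A Δ) Ψ Z M D₂)
    (hp : ∀ a b, r.Branch a → s.Branch b → T (ps a b) (push (M b) (push (L a) X)))
    (hq : T q (cons A.dual Θ)) (hΓ : Γ.Split Δ Θ) (hΦ : Φ 0 = none) (hΨ : Ψ 0 = none) :
    CommEquiv Γ
      (elim A (r.mk (n + 1) D₁ fun a => (s.rename (· + r.k)).mk (m + 1 + r.k) (up r.k D) (ps a)) q)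
      (elim A (s.mk (m + 1) D₂ fun b => (r.rename (· + s.k)).mk (n + 1 + s.k) (up s.k D)
        fun a => (ps a b).swap s.k r.k) q) := by
  have hr' := hr.exchange hs' hs
  have hl := hr.own.length
  have hm := hs.own.length
  have hpl := fun a ha => (hs'.push (L a) (hl a)).typed fun b hb =>
    hp a b ha (by simpa using hb)
  have hpr := fun b hb => (hr'.push (M b) (hm b)).typed (ps := fun a => (ps a b).swap s.k r.k)
    fun a ha => (hp a b (by simpa using ha) hb).swap (hm b) (hl a)
  obtain ⟨hr₀, hY, -, -⟩ := hr.uncons hΦ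
  obtain ⟨hs₀, hZ, -, -⟩ := hs.uncons hΨ
  rw [← hY] at hs'
  rw [← hZ] at hr'
  obtain ⟨hs₀', hX, hD, hse⟩ := hs'.uncons hΨ
  obtain ⟨hr₀', -, -, hre⟩ := hr'.uncons hΦ
  have hsY := (hΓ.assoc hr₀.split).2
  have hsX := (hsY.assoc hs₀'.split).2
  have hps : ∀ a b, r.Branch a → s.Branch b → T ((ps a b).swap (s.k + r.k) 1)
      (cons A (push (M b) (push (L a) fun n => X (n + 1)))) := by
    intro a b ha hb
    have h₁ := hp a b ha hb
    rw [← hX] at h₁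
    have e : ∀ Ξ : Ctx α, push (M b) (push (L a) Ξ) = push (M b ++ L a) Ξ := by
      intro Ξ
      induction M b with
      | nil => rfl
      | cons B N ih => simp only [push, List.cons_append, ih]
    rw [e] at h₁ ⊢
    exact T.swap (M := [A]) h₁ (by simp [hl, hm]) rfl
  have hsp : ∀ a b, (push (M b) (push (L a) (Ctx.join (fun n => X (n + 1)) Θ))).Split
      (push (M b) (push (L a) fun n => X (n + 1))) (sh s.k (sh r.k Θ)) := fun a b =>
    (hsX.push_left (L a) (hl a)).push_left (M b) (hm b)
  have hq₂ := (hq.shift r.k).shift s.k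
  have h := CommEquiv.comm (hr₀.join hΓ hq.dom_down) (hs₀'.join hsY hq.dom_down)
    (hs₀.join hΓ hq.dom_down)
    (ps := fun a b => elim A ((ps a b).swap (s.k + r.k) 1) ((q.shift r.k).shift s.k))
    fun a b ha hb => by
      rw [Head.branch_rename] at ha hb
      exact (hps a b ha hb).elim hq₂ (hsp a b)
  rw [hr.elim_side hΦ, hs.elim_side hΨ]
  · convert h using 1
    · refine Head.mk_congr fun a ha => ?_
      rw [Head.branch_rename] at ha
      have e := Head.mk_swap_one (s.rename Nat.pred) r.k m (down 1 D) (ps a)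
      rw [hse, hD] at e
      simp only [Head.k_rename]
      rw [e, elim_mk0 _ fun b hb => ?_, up_union_down]
      · simp only [Head.k_rename]
      · rw [Head.branch_rename, Head.branch_rename] at hb
        rw [Head.k_rename]
        exact ((hps a b ha hb).names 0).2 (by simp)
    · refine Head.mk_congr fun b hb => ?_
      rw [Head.branch_rename] at hb
      have e := Head.mk_swap_one (r.rename Nat.pred) s.k n (down 1 D)
        (fun a => (ps a b).swap s.k r.k)
      rw [hre, hD] at e
      have e' : ∀ a, ((ps a b).swap s.k r.k).swap (r.k + s.k) 1 =
          ((ps a b).swap (s.k + r.k) 1).rename (lift (swapBlocks s.k r.k)) := by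
        intro a
        simp only [PreProof.swap, PreProof.rename_rename]
        congr 1
        funext n
        rw [lift_eq_liftN]
        simp only [Function.comp, swapBlocks, liftN]
        split_ifs <;> omega
      simp only [Head.k_rename]
      rw [e, elim_mk0 _ fun a ha => ?_, up_union_down]
      · refine Head.mk_congr fun a ha => ?_
        rw [Head.branch_rename, Head.branch_rename] at ha
        simp only [Head.k_rename]
        rw [e', show ∀ x : PreProof α, x.swap s.k r.k = x.rename (swapBlocks s.k r.k) from fun _ => rfl,
          elim_rename (hps a b ha hb) hq₂ (hsp a b).disjoint]
        congr 1
        simp only [PreProof.shift, PreProof.rename_rename, lift_comp]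
        congr 2
        funext n
        simp only [Function.comp, swapBlocks]
        split_ifs <;> omega
      · rw [Head.branch_rename, Head.branch_rename] at ha
        rw [Head.k_rename, e']
        exact zero_mem_names_rename_lift (((hps a b ha hb).names 0).2 (by simp)) _
  · exact hpr
  · exact hpl

end comm

theorem Ctx.ren_swap_sh (L : List (Formula α)) (Γ : Ctx α) :
    Ren (swapBlocks L.length 1) (push L (sh 1 Γ)) (sh 1 (push L Γ)) := by
  have hinv : ∀ a b n, swapBlocks b a (swapBlocks a b n) = n := by
    intro a b n; unfold swapBlocks; split_ifs <;> omega
  refine Ren.of_injective (fun n m e => ?_) (fun n => ?_) (fun m h => ?_)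
  · rw [← hinv L.length 1 n, e, hinv]
  · simp only [push_apply, sh, swapBlocks]
    split_ifs <;> first | omega | (congr 1; omega) | rfl
  · exact (h _ (hinv 1 L.length m)).elim

theorem Ctx.sh_one_eta {Γ : Ctx α} (h : Γ 0 = none) : sh 1 (fun n => Γ (n + 1)) = Γ := by
  funext n
  rcases n with _ | n <;> simp [sh, h]

theorem lift_add_eq_swapBlocks (k : ℕ) : swapBlocks k 1 ∘ (· + k) = lift (· + k) := by
  funext n
  rcases n with _ | n
  · simp [swapBlocks, lift]
  · simp only [Function.comp, swapBlocks, lift]; split_ifs <;> omega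

theorem Head.mk_add_swap (r : Head α) (k i : ℕ) (D : Finset ℕ) (ps : Bool → PreProof α) :
    ((r.rename (· + k)).mk (i + k) D ps).swap k 1 =
      (r.rename (lift (· + k))).mk (lift (· + k) i) (D.image (swapBlocks k 1)) fun a =>
        (ps a).rename (liftN r.k (swapBlocks k 1)) := by
  rw [PreProof.swap, Head.rename_mk, Head.rename_rename, lift_add_eq_swapBlocks, Head.k_rename,
    ← lift_add_eq_swapBlocks]
  rfl

theorem Head.mk_add_rename_pred (s : Head α) (k m : ℕ) (D : Finset ℕ) (ps : Bool → PreProof α) :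
    ((s.rename (· + k)).mk (m + 1 + k) (up k D) ps).rename (liftN k Nat.pred) =
      ((s.rename Nat.pred).rename (· + k)).mk (m + k) (up k (D.image Nat.pred)) fun b =>
        (ps b).rename (liftN s.k (liftN k Nat.pred)) := by
  rw [Head.rename_mk, Head.rename_add_rename_liftN, image_liftN_up, Head.k_rename]
  congr 1
  simp [liftN]

theorem T.swap_rename_pred {p : PreProof α} {L M : List (Formula α)} {X : Ctx α} {k l : ℕ}
    (h : T p (push M (push L X))) (hX : X 0 = none) (hk : L.length = k) (hl : M.length = l) :
    ((p.swap l k).rename (liftN k (swapBlocks l 1))).rename (liftN k Nat.pred) =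
      (p.rename (liftN l (liftN k Nat.pred))).swap l k := by
  subst hk hl
  simp only [PreProof.swap, PreProof.rename_rename]
  refine h.rename_eq fun n B hB => ?_
  have hn : n ≠ M.length + L.length := by
    rintro rfl
    rw [push_apply, if_neg (by omega), push_apply, if_neg (by omega)] at hB
    simp [hX] at hB
  simp only [Function.comp, swapBlocks, liftN, Nat.pred_eq_sub_one]
  split_ifs <;> omega

section comm

variable {A : Formula α} {Γ Δ Θ Φ Ψ X Y Z : Ctx α} {q : PreProof α} {r s : Head α} {i n m : ℕ}
  {L M : Bool → List (Formula α)} {D₁ D₂ D : Finset ℕ} {ps : Bool → Bool → PreProof α}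

/-- The cut formula lies in the fixed premise of `r`. The cut is absorbed into that premise, giving
an operation `r.cutFixed A q` of the same shape, which commutes with `s`. -/
theorem elim_comm_fixed (hr : Rule r (n + 1) (cons A Δ) Φ Y L D₁) (hs' : Rule s (m + 1) Y Ψ X M D)
    (hs : Rule s (m + 1) (cons A Δ) Ψ Z M D₂)
    (hp : ∀ a b, r.Branch a → s.Branch b → T (ps a b) (push (M b) (push (L a) X)))
    (hq : T q (cons A.dual Θ)) (hΓ : Γ.Split Δ Θ) (hΦ : Φ 0 = some A) :
    CommEquiv Γ
      (elim A (r.mk (n + 1) D₁ fun a => (s.rename (· + r.k)).mk (m + 1 + r.k) (up r.k D) (ps a)) q)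
      (elim A (s.mk (m + 1) D₂ fun b => (r.rename (· + s.k)).mk (n + 1 + s.k) (up s.k D)
        fun a => (ps a b).swap s.k r.k) q) := by
  have hr' := hr.exchange hs' hs
  have hl := hr.own.length
  have hm := hs.own.length
  have hY : Y 0 = none := by have := hr.split 0; grind
  have hΨ : Ψ 0 = none := by have := hs'.split 0; grind
  have hX : X 0 = none := by have := hs'.split 0; grind
  have hpl := fun a ha => (hs'.push (L a) (hl a)).typed fun b hb =>
    hp a b ha (by simpa using hb)
  have hps := fun b hb a ha => (hp a b ha hb).swap (hm b) (hl a)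
  have hpr := fun b hb => (hr'.push (M b) (hm b)).typed (ps := fun a => (ps a b).swap s.k r.k)
    fun a ha => hps b hb a (by simpa using ha)
  obtain ⟨hs₀, hZ, -, -⟩ := hs.uncons hΨ
  have hs₀' := hs'.rename (ren_pred hY)
  rw [(ren_pred hX).img_eq, (ren_pred hΨ).img_eq, Nat.pred_succ] at hs₀'
  have hr₀ := hr.cutFixed hΦ hq hΓ
  have hr₀' : Rule (r.cutFixed A q) n (Ctx.join (fun n => Z (n + 1)) Θ) _ _ L _ :=
    hr₀.exchange hs₀' (hs₀.join hΓ hq.dom_down)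
  have h := CommEquiv.comm hr₀ hs₀' (hs₀.join hΓ hq.dom_down)
    (ps := fun a b => (ps a b).rename (liftN s.k (liftN r.k Nat.pred))) fun a b ha hb => by
      rw [Head.branch_rename] at hb
      rw [Head.branch_cutFixed] at ha
      have := (hp a b ha hb).rename (((ren_pred hX).push (L a)).push (M b))
      rwa [hl, hm] at this
  rw [hr.elim_fixed hΦ hpl q (down 1 D₁), hs.elim_side hΨ hpr]
  convert h using 1
  · refine Head.mk_congr fun a ha => ?_
    rw [Head.mk_add_rename_pred, Head.k_cutFixed]
  · refine Head.mk_congr fun b hb => ?_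
    rw [Head.branch_rename] at hb
    have hf : Ren (swapBlocks s.k 1) (push (M b) Z) (cons A (push (M b) fun n => Z (n + 1))) := by
      have := ren_swap (M b) [A] fun n => Z (n + 1)
      simp only [push, hZ, hm, List.length_singleton] at this
      exact this
    have hr'' := (hr'.push (M b) (hm b)).rename hf
    have hf' := hf.split (hr'.push (M b) (hm b)).split
    have h0 := hf'.1.map (n := s.k) (A := A) (by simp [sh, hΦ])
    have e₀ : swapBlocks s.k 1 s.k = 0 := by simp [swapBlocks]
    have e₁ : swapBlocks s.k 1 (n + 1 + s.k) = n + s.k + 1 := by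
      simp only [swapBlocks]; split_ifs <;> omega
    rw [e₀] at h0
    rw [Head.rename_rename, lift_add_eq_swapBlocks, e₁] at hr''
    simp only [Head.k_rename]
    rw [Head.mk_add_swap]
    have e := hr''.elim_fixed h0 (ps := fun a =>
      ((ps a b).swap s.k r.k).rename (liftN r.k (swapBlocks s.k 1))) (fun a ha => by
        have := (hps b hb a (by simpa using ha)).rename (hf'.2.1.push (L a))
        rwa [hl] at this) (q.shift s.k) (up s.k (D.image Nat.pred))
    refine e.trans ?_
    rw [PreProof.shift, hr.cutFixed_rename hΦ hq hΓ, Head.k_cutFixed, Head.k_rename]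
    refine Head.mk_congr fun a ha => ?_
    rw [Head.branch_rename, Head.branch_cutFixed] at ha
    exact (hp a b ha hb).swap_rename_pred hX (hl a) (hm b)

/-- The rule `r` introduces the cut formula and disappears. With `r` below, the cuts `op` meet `s`
and let it go down. With `s` below, it goes down first, and the key case then yields the renamed
`op` above it. Both ways end with `s` below the same cuts, up to commutations. -/
theorem elim_comm_princ (hc : ∀ B : Formula α, B.size < A.size → Congr B)
    (hr : Rule r 0 (cons A Δ) Φ Y L D₁) (hs' : Rule s (m + 1) Y Ψ X M D)
    (hs : Rule s (m + 1) (cons A Δ) Ψ Z M D₂)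
    (hp : ∀ a b, r.Branch a → s.Branch b → T (ps a b) (push (M b) (push (L a) X)))
    (hq : Princ A.dual Θ q) (hΓ : Γ.Split Δ Θ) :
    CommEquiv Γ
      (elim A (r.mk 0 D₁ fun a => (s.rename (· + r.k)).mk (m + 1 + r.k) (up r.k D) (ps a)) q)
      (elim A (s.mk (m + 1) D₂ fun b => (r.rename (· + s.k)).mk (0 + s.k) (up s.k D)
        fun a => (ps a b).swap s.k r.k) q) := by
  have hr' := hr.exchange hs' hs
  have hl := hr.own.length
  have hm := hs.own.length
  obtain ⟨Ξ, a₀, op, hh, hΓ', hY⟩ := hr.exists_headCut hq hΓ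
  have hΨ : Ψ 0 = none := by have := hs'.split 0; grind
  have hX : X 0 = none := by have := hs'.split 0; grind
  have hpl := fun a ha => (hs'.push (L a) (hl a)).typed fun b hb =>
    hp a b ha (by simpa using hb)
  have hps := fun b hb a ha => (hp a b ha hb).swap (hm b) (hl a)
  have hpr := fun b hb => (hr'.push (M b) (hm b)).typed (ps := fun a => (ps a b).swap s.k r.k)
    fun a ha => hps b hb a (by simpa using ha)
  obtain ⟨hs₀, hZ, -, -⟩ := hs.uncons hΨ
  have hs₀' := hs'.rename (ren_pred hY)
  rw [(ren_pred hX).img_eq, (ren_pred hΨ).img_eq, Nat.pred_succ] at hs₀'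
  have hs₁ := hs₀.join hΓ hq.typed.dom_down
  have hsX := hΓ'.assoc hs₀'.split
  have hXZ : Ctx.join (fun n => Z (n + 1)) Θ = Ctx.join (fun n => X (n + 1)) Ξ := by
    funext n
    have h₁ := hs₁.split n
    have h₂ := hsX.1 n
    grind
  have hd := hs₁.dom
  rw [hXZ] at hd hs₁
  refine (hh.elim_mk hc hΓ' hY D₁ hl hpl).trans ?_
  rw [Head.mk_add_rename_pred, hh.typed.run_rule (hl a₀) hΓ' hs₀' (fun b hb => ?_) hd,
    hs.elim_side hΨ hpr]
  · refine .mk hs₁ fun b hb => ?_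
    rw [Head.branch_rename] at hb
    have hf := ren_swap_sh (M b) fun n => X (n + 1)
    rw [sh_one_eta hX, hm] at hf
    have e := (hh.rename (ren_sh s.k Ξ)).elim_mk hc (Y := sh 1 (push (M b) fun n => X (n + 1)))
      (Γ := push (M b) (Ctx.join (fun n => X (n + 1)) Ξ)) (hsX.2.push_left (M b) (hm b)) rfl
      ((up s.k D).image (swapBlocks s.k 1))
      (ps := fun a => ((ps a b).swap s.k r.k).rename (liftN r.k (swapBlocks s.k 1)))
      (by simpa using hl) fun a ha => by
        have := (hps b hb a (by simpa using ha)).rename (hf.push (L a))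
        rwa [hl] at this
    simp only [Head.k_rename]
    rw [Head.mk_add_swap]
    rw [Head.k_rename, (hp a₀ b hh.branch hb).swap_rename_pred hX (hl a₀) (hm b)] at e
    exact e.symm
  · have := (hp a₀ b hh.branch (by simpa using hb)).rename (((ren_pred hX).push (L a₀)).push (M b))
    rwa [hl, hm] at this

theorem elim_comm_congr (hc : ∀ B : Formula α, B.size < A.size → Congr B) {j : ℕ}
    (hr : Rule r i (cons A Δ) Φ Y L D₁) (hs' : Rule s j Y Ψ X M D)
    (hs : Rule s j (cons A Δ) Ψ Z M D₂)
    (hp : ∀ a b, r.Branch a → s.Branch b → T (ps a b) (push (M b) (push (L a) X)))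
    (hq : Princ A.dual Θ q) (hΓ : Γ.Split Δ Θ) :
    CommEquiv Γ
      (elim A (r.mk i D₁ fun a => (s.rename (· + r.k)).mk (j + r.k) (up r.k D) (ps a)) q)
      (elim A (s.mk j D₂ fun b => (r.rename (· + s.k)).mk (i + s.k) (up s.k D)
        fun a => (ps a b).swap s.k r.k) q) := by
  have hr' := hr.exchange hs' hs
  have hps := fun b a hb ha => (hp a b ha hb).swap (hs.own.length b) (hr.own.length a)
  have hA : ∀ Ξ Ξ' C, (cons A Δ).Split Ξ Ξ' → Ξ 0 = some C → C = A := by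
    intro Ξ Ξ' C h h'
    have := h 0
    simp only [cons_zero] at this
    grind
  rcases i with _ | n <;> rcases j with _ | m
  -- The two rules cannot both introduce the occurrence `0`, since they consume disjoint parts.
  · obtain ⟨B, hB⟩ := hr.own.ne_none
    obtain ⟨C, hC⟩ := hs.own.ne_none
    have h₁ := hr.split 0
    have h₂ := hs'.split 0
    grind
  · exact elim_comm_princ hc hr hs' hs hp hq hΓ
  · have := elim_comm_princ hc hs hr' hr hps hq hΓ
    simp only [swap_swap] at this
    exact this.symm
  · cases hΦ : Φ 0 with
    | some C =>
      obtain rfl := hA _ _ _ hr.split hΦ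
      exact elim_comm_fixed hr hs' hs hp hq.typed hΓ hΦ
    | none =>
      cases hΨ : Ψ 0 with
      | some C =>
        obtain rfl := hA _ _ _ hs.split hΨ
        have := elim_comm_fixed hs hr' hr hps hq.typed hΓ hΨ
        simp only [swap_swap] at this
        exact this.symm
      | none => exact elim_comm_side hr hs' hs hp hq.typed hΓ hΦ hΨ

end comm

/-- The essential case of `congr`: the right premise stays blocked on the cut formula, so everything
is decided by the rules of the left premise. -/
theorem CommEquiv.elim_princ {A : Formula α} (hc : ∀ B : Formula α, B.size < A.size → Congr B)
    {Γ Δ Θ : Ctx α} {p p' q : PreProof α} (h : CommEquiv (cons A Δ) p p') (hq : Princ A.dual Θ q)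
    (hs : Γ.Split Δ Θ) : CommEquiv Γ (elim A p q) (elim A p' q) := by
  refine h.rename_induction (P := fun Γ₀ p p' => ∀ Γ Δ Θ q, Γ₀ = cons A Δ → Princ A.dual Θ q →
    Γ.Split Δ Θ → CommEquiv Γ (MALL.elim A p q) (MALL.elim A p' q)) ?_ ?_ ?_ ?_ ?_ Γ Δ Θ q rfl hq hs
  · rintro _ p hp Γ Δ Θ q rfl hq hs
    exact .refl (hp.elim hq.typed hs)
  · intro _ p p' ih Γ Δ Θ q e hq hs
    exact (ih Γ Δ Θ q e hq hs).symm
  · intro _ p p' p'' ih ih' Γ Δ Θ q e hq hs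
    exact (ih Γ Δ Θ q e hq hs).trans (ih' Γ Δ Θ q e hq hs)
  · rintro r i _ Φ Y L D ps ps' hr hp ih Γ Δ Θ q rfl hq hs
    exact elim_mk_congr hc hr hp hq hs fun b hb f Δ' Θ' Γ' q' hf => ih b hb hf Γ' Δ' Θ' q' rfl
  · rintro r s i j _ Φ Ψ Y Z X L M D₁ D₂ D ps hr hs' hs hp Γ Δ Θ q rfl hq hΓ
    exact elim_comm_congr hc hr hs' hs hp hq hΓ

/-- The elimination of cuts is compatible with rule commutations. -/
theorem congr (A : Formula α) : Congr A := by
  induction hn : A.size using Nat.strong_induction_on generalizing A with | _ n ihA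
  have hc : ∀ B : Formula α, B.size < A.size → Congr B := fun B hB => ihA _ (hn ▸ hB) B rfl
  intro Γ Δ Θ p p' q h hq hs
  -- For a fixed cut formula, the inner induction consumes the right premise until it is an axiom or
  -- introduces the cut formula.
  induction hk : q.sz using Nat.strong_induction_on generalizing Γ Δ Θ p p' q with | _ k ih
  rcases hq.cases_zero with ⟨i, rfl, rfl⟩ | ⟨s, j, E, qs, Ψ, X, M, hq'⟩ | hq'
  · rw [elim_ax_right, elim_ax_right]
    rw [Formula.dual_dual] at hs
    exact h.rename (ren_contract hs.symm)
  -- The last rule of `q` goes below both cuts. The two resulting rules carry the same set of names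
  -- because `p` and `p'` prove the same sequent.
  · have e : p.names = p'.names := h.typed.1.names.unique h.typed.2.names
    refine (elim_side_right h.typed.1 hq' hs).trans
      (.trans ?_ (elim_side_right h.typed.2 hq' hs).symm)
    rw [e]
    refine .mk (hq'.rule.join hs.symm h.typed.2.dom_down) fun b hb => ?_
    exact ih _ (hk ▸ hq'.sz hb) (h.rename ((ren_sh s.k Δ).cons A)) (hq'.prem b hb)
      ((hs.symm.assoc hq'.rule.split).2.push_left _ (hq'.rule.own.length b)).symm rfl
  · exact h.elim_princ hc hq' hs

/-- `congr` varies the left premise; the right one is varied by permuting the cut, applying `congr`,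
and permuting back. -/
theorem CommEquiv.elim {A : Formula α} {Γ Δ Θ : Ctx α} {p p' q q' : PreProof α}
    (hp : CommEquiv (cons A Δ) p p') (hq : CommEquiv (cons A.dual Θ) q q') (hs : Γ.Split Δ Θ) :
    CommEquiv Γ (elim A p q) (MALL.elim A p' q') := by
  have h := congr A.dual hq (Θ := Δ) (by rw [Formula.dual_dual]; exact hp.typed.2) hs.symm
  exact (congr A hp hq.typed.1 hs).trans
    (.trans (elim_symm hp.typed.2 hq.typed.1 hs)
      (h.trans (elim_symm hp.typed.2 hq.typed.2 hs).symm))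

/-! ### Exchange of two successive cuts -/

theorem Ctx.Split.sh {Γ Δ Θ : Ctx α} (h : Γ.Split Δ Θ) (k : ℕ) :
    (Ctx.sh k Γ).Split (Ctx.sh k Δ) (Ctx.sh k Θ) := by
  intro n
  have := h (n - k)
  simp only [Ctx.sh]
  split_ifs <;> simp_all

/-- Cuts of `p` with `q` on `B` and with `r` on `A` may be exchanged. -/
def CutExchange (A B : Formula α) (Δ Θ Ξ : Ctx α) (p q r : PreProof α) : Prop :=
  T p (cons B (cons A Δ)) → T q (cons B.dual Θ) → T r (cons A.dual Ξ) →
    ∀ ⦃Γ X : Ctx α⦄, Γ.Split Δ X → X.Split Θ Ξ →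
      CommEquiv Γ (elim A (elim B p (q.shift 1)) r) (elim B (elim A (p.swap 1 1) (r.shift 1)) q)

section

variable {A B : Formula α} {Γ Δ Θ Ξ X : Ctx α} {p q r : PreProof α}

theorem T.swap_one (hp : T p (cons B (cons A Δ))) : T (p.swap 1 1) (cons A (cons B Δ)) :=
  T.swap (L := [B]) (M := [A]) hp rfl rfl

/-- The property is symmetric under exchanging the roles of `(A, r)` and `(B, q)`, so each case
below is treated for one of the two cuts. -/
theorem CutExchange.symm (h : CutExchange A B Δ Θ Ξ p q r) :
    CutExchange B A Δ Ξ Θ (p.swap 1 1) r q := by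
  intro hp hr hq Γ X hs hs'
  have hp' := hp.swap_one
  rw [swap_swap] at hp' ⊢
  exact (h hp' hq hr hs hs'.symm).symm

theorem T.elim_shift (hp : T p (cons B (cons A Δ))) (hq : T q (cons B.dual Θ))
    (hs : Γ.Split Δ Θ) : T (MALL.elim B p (q.shift 1)) (cons A Γ) :=
  hp.elim (hq.shift 1) (hs.push_left [A] rfl)

theorem T.elim_elim (hp : T p (cons B (cons A Δ))) (hq : T q (cons B.dual Θ))
    (hr : T r (cons A.dual Ξ)) (hs : Γ.Split Δ X) (hs' : X.Split Θ Ξ) :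
    T (MALL.elim A (MALL.elim B p (q.shift 1)) r) Γ := by
  obtain ⟨h₁, h₂⟩ := hs.assoc' hs'
  exact (hp.elim_shift hq h₁).elim hr h₂

/-- The cut against the axiom is a renaming, which commutes with the other cut by `elim_rename`. -/
theorem cutExchange_ax (j : ℕ) : CutExchange A B Δ Θ Ξ p (.ax s(0, j + 1)) r := by
  intro hp hq hr Γ X hs hs'
  have hT := hp.elim_elim hq hr hs hs'
  have e : elim B (elim A (p.swap 1 1) (r.shift 1)) (.ax s(0, j + 1)) =
      elim A (elim B p ((PreProof.ax s(0, j + 1)).shift 1)) r := by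
    rw [ax_shift, elim_ax_right, elim_ax_right, elim_rename hp.swap_one (hr.shift 1)
      ((hs.assoc' hs'.symm).1.push_left [B] rfl).disjoint]
    simp only [PreProof.swap, PreProof.shift, PreProof.rename_rename, lift_comp]
    congr 1
    · congr 1
      funext n
      rcases n with _ | _ | n <;> simp [swapBlocks, lift, contract]
    · convert PreProof.rename_id r
      funext n
      rcases n with _ | n <;> simp [lift, contract]
  rw [e]
  exact .refl hT

/-- The last rule `s` of `q` goes below both cuts. On the left-hand side it first passes the inner
cut, under the outer one (hence `congr`), and then ends the left premise of the outer cut, which it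
passes by an equality. -/
theorem cutExchange_side {s : Head α} {j : ℕ} {E : Finset ℕ} {qs : Bool → PreProof α}
    {Ψ Y : Ctx α} {M : Bool → List (Formula α)} (h : IsSide q B.dual Θ s j E qs Ψ Y M)
    (ih : ∀ b, s.Branch b → CutExchange A B (sh s.k Δ) (push (M b) Y) (sh s.k Ξ)
      (p.rename (lift (lift (· + s.k)))) (qs b) (r.shift s.k)) :
    CutExchange A B Δ Θ Ξ p q r := by
  intro hp hq hr Γ X hs hs'
  have hm := h.rule.own.length
  obtain ⟨h₁, h₂⟩ := hs.assoc' hs'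
  obtain ⟨h₃, h₄⟩ := hs.assoc' hs'.symm
  have hZ := hp.swap_one.elim_shift hr h₃
  have hpk : T (p.rename (lift (lift (· + s.k)))) (cons B (cons A (sh s.k Δ))) :=
    hp.rename (((ren_sh s.k Δ).cons A).cons B)
  obtain ⟨h₅, h₆⟩ := h₁.symm.assoc h.rule.split
  have hW : ∀ b, s.Branch b →
      T (elim B (p.rename (lift (lift (· + s.k)))) ((qs b).shift 1))
        (cons A (push (M b) (Y.join Δ))) := fun b hb =>
    hpk.elim_shift (h.prem b hb) (h₆.push_left (M b) (hm b)).symm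
  have hsym := h₄.symm.assoc h.rule.split
  have hD : E.image (· + 1) ∪ down 1 p.names = up 1 (E ∪ down 1 (down 1 p.names)) := by
    ext n
    rcases n with _ | n
    · simp [hp.names 1]
    · simp
  have hR := h.rule.join h₄.symm hZ.dom_down
  have hside := (h.rule.join h₁.symm (E := down 1 (down 1 p.names)) fun n => by
    rw [mem_down, hp.dom_down, cons_succ])
  have hL := hside.join h₂ hr.dom_down
  have hctx : Ctx.join (Y.join Δ) Ξ = Y.join (Δ.join Ξ) := by
    funext n
    have e₁ := hL.split n
    have e₂ := hR.split n
    grind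
  rw [hctx] at hL
  refine (congr A (elim_side_right hp (h.shift 1) (h₁.push_left [A] rfl)) hr h₂).trans
    (.trans ?_ (elim_side_right hZ h h₄).symm)
  have e₁ := Head.mk_eq_mk0 s j (E ∪ down 1 (down 1 p.names)) fun b =>
    elim B (p.shift s.k) ((qs b).rename (lift (liftN s.k (· + 1))))
  have e₂ : ∀ b, s.Branch b →
      (elim B (p.shift s.k) ((qs b).rename (lift (liftN s.k (· + 1))))).swap s.k 1 =
        elim B (p.rename (lift (lift (· + s.k)))) ((qs b).shift 1) := by
    intro b hb
    have := (h.shift 1).prem b (by rwa [Head.branch_rename])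
    have hs₁ : (push (M b) (cons A (Y.join Δ))).Split (sh s.k (cons A Δ)) (push (M b) (sh 1 Y)) :=
      ((h₆.symm.push_left [A] rfl).push_right (M b) (hm b))
    rw [show ∀ x : PreProof α, x.swap s.k 1 = x.rename (swapBlocks s.k 1) from fun _ => rfl,
      elim_rename (hp.shift s.k) this hs₁.disjoint]
    simp only [PreProof.shift, PreProof.rename_rename, lift_comp]
    congr 3 <;> funext n
    · rcases n with _ | n <;> simp only [Function.comp, swapBlocks, lift] <;> split_ifs <;> omega
    · simp only [Function.comp, swapBlocks, liftN]; split_ifs <;> omega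
  have e₃ : (elim A (p.swap 1 1) (r.shift 1)).shift s.k =
      elim A ((p.rename (lift (lift (· + s.k)))).swap 1 1) ((r.shift s.k).shift 1) := by
    rw [PreProof.shift, elim_rename hp.swap_one (hr.shift 1) (h₃.push_left [B] rfl).disjoint,
      shift_one_rename, ← liftN_one, ← liftN_one, swap_rename]
    simp only [liftN_one]
    rfl
  rw [Head.k_rename, hD, e₁, elim_mk0 _ fun b hb => ?_, hL.dom.unique hR.dom]
  · refine .mk hR fun b hb => ?_
    rw [e₂ b hb, e₃]
    refine ih b hb hpk (h.prem b hb) (hr.shift _) (X := (push (M b) (Y.join Ξ))) ?_ ?_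
    · refine Ctx.Split.push_right (fun n => ?_) (M b) (hm b)
      have e₁ := hsym.2 n
      have e₂ := h₃ n
      simp only [Ctx.join] at e₁ e₂ ⊢
      grind
    · refine Ctx.Split.push_left (fun n => ?_) (M b) (hm b)
      have e₁ := hsym.2 n
      have e₂ := h₃ n
      simp only [Ctx.join] at e₁ e₂ ⊢
      grind
  · rw [e₂ b hb]
    exact ((hW b hb).names 0).2 (by simp)

/-- The formulas `A` and `B` are the two sides of one axiom: each order of the cuts leaves the cut
between `q` and `r`, in one of its two orientations. -/
theorem cutExchange_ax_left : CutExchange A B Δ Θ Ξ (.ax s(0, 1)) q r := by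
  intro hp hq hr Γ X hs hs'
  obtain ⟨rfl, rfl⟩ : A = B.dual ∧ Δ = fun _ => none := by
    rcases hp.cases_zero with ⟨i, e, h⟩ | ⟨t, i, D, ps, Φ, Y, L, h⟩ | h
    · obtain rfl : i = 0 := by
        have := congrFun h 0
        by_contra hi
        simp [single, Ne.symm hi] at this
      have := congrFun h 0
      refine ⟨by simpa [single] using this, funext fun n => ?_⟩
      have := congrFun h (n + 1)
      simpa [single] using this
    · have := h.eq
      cases t <;> simp [Head.mk0, Head.mk, Head.rename] at this
    · have := h.view
      rw [view_ax] at this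
      cases this
  obtain rfl : X = Γ := by
    funext n
    have := hs n
    grind
  have e : swap 1 1 (.ax s(0, 1) : PreProof α) = .ax s(0, 1) := by
    simp [PreProof.swap, PreProof.rename, swapBlocks, Sym2.eq_swap]
  have e' : ∀ x : PreProof α, (x.shift 1).rename (contract 0) = x := by
    intro x
    rw [PreProof.shift, PreProof.rename_rename]
    convert PreProof.rename_id x
    funext n
    rcases n with _ | n <;> simp [lift, contract]
  have h := elim_ax_left B (q.shift 1) 0
  have h' := elim_ax_left B.dual (r.shift 1) 0
  rw [zero_add, e'] at h h'
  rw [e, h, h']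
  rw [Formula.dual_dual] at hr
  exact elim_symm_dual hq hr hs'

theorem elim_tens_left {C : Formula α} {a b : PreProof α} {n : ℕ} (ha : T a (cons B (cons C Δ)))
    (q : PreProof α) :
    elim B (.tens (n + 1) (a.swap 1 1) (b.shift 1)) q = .tens n (elim B a (q.shift 1)) b :=
  elim_mk0 (r := .tensL b) (D := ∅) (ps := fun _ => a) q fun _ _ => (ha.names 0).2 (by simp)

theorem elim_tens_right {C : Formula α} {a b : PreProof α} {n : ℕ} (hb : T b (cons B (cons C Δ)))
    (q : PreProof α) :
    elim B (.tens (n + 1) (a.shift 1) (b.swap 1 1)) q = .tens n a (elim B b (q.shift 1)) :=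
  elim_mk0 (r := .tensR a) (D := ∅) (ps := fun _ => b) q fun _ _ => (hb.names 0).2 (by simp)

/-- The tensor rule with `B` in its left premise `a` and `A` in its right premise `b`. -/
def tensTwo (n : ℕ) (a b : PreProof α) : PreProof α :=
  .tens (n + 2) ((a.rename (lift (lift (· + 1)))).swap 1 1) ((b.swap 1 1).shift 1)

theorem tensTwo_swap (n : ℕ) (a b : PreProof α) : (tensTwo n a b).swap 1 1 =
    .tens (n + 2) ((a.swap 1 1).shift 1) ((b.rename (lift (lift (· + 1)))).swap 1 1) := by
  simp only [tensTwo, PreProof.swap, PreProof.rename, PreProof.shift, PreProof.rename_rename]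
  congr 2 <;> funext n <;> rcases n with _ | _ | n <;> simp [swapBlocks, lift]

theorem elim_rename_shift (hp : T p (cons B (cons A Δ))) (hq : T q (cons B.dual Θ))
    (hd : ∀ n, Δ n = none ∨ Θ n = none) :
    elim B (p.rename (lift (lift (· + 1)))) ((q.shift 1).shift 1) =
      (elim B p (q.shift 1)).shift 1 := by
  have hd' : ∀ n, cons A Δ n = none ∨ sh 1 Θ n = none := by
    rintro (_ | n)
    · right; rfl
    · exact hd n
  have h := elim_rename hp (hq.shift 1) hd' (lift (· + 1))
  rw [shift_one_rename] at h
  exact h.symm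

/-- The two cuts act on different premises of the `⊗`-rule, so both orders give the same proof. -/
theorem cutExchange_tens {C D : Formula α} {a b : PreProof α} {n : ℕ} {Δ₁ Δ₂ : Ctx α}
    (ha : T a (cons B (cons C Δ₁))) (hb : T b (cons A (cons D Δ₂)))
    (hd : ∀ n, Δ n = none → Δ₁ n = none ∧ Δ₂ n = none) :
    CutExchange A B Δ Θ Ξ (tensTwo n a b) q r := by
  intro hp hq hr Γ X hs hs'
  have hT := hp.elim_elim hq hr hs hs'
  have hd₁ : ∀ n, Δ₁ n = none ∨ Θ n = none := by
    intro n
    rcases (hs.assoc' hs').1.disjoint n with h | h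
    · exact .inl (hd n h).1
    · exact .inr h
  have hd₂ : ∀ n, Δ₂ n = none ∨ Ξ n = none := by
    intro n
    rcases (hs.assoc' hs'.symm).1.disjoint n with h | h
    · exact .inl (hd n h).2
    · exact .inr h
  have e₁ : elim A (elim B (tensTwo n a b) (q.shift 1)) r =
      .tens n (elim B a (q.shift 1)) (elim A b (r.shift 1)) := by
    rw [tensTwo, elim_tens_left (ha.rename (((ren_sh 1 Δ₁).cons C).cons B)), elim_rename_shift ha hq hd₁,
      elim_tens_right hb]
  have e₂ : elim B (elim A ((tensTwo n a b).swap 1 1) (r.shift 1)) q =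
      .tens n (elim B a (q.shift 1)) (elim A b (r.shift 1)) := by
    rw [tensTwo_swap, elim_tens_right (hb.rename (((ren_sh 1 Δ₂).cons D).cons A)), elim_rename_shift hb hr hd₂,
      elim_tens_left ha]
  rw [e₂, ← e₁]
  exact .refl hT

/-- The rule `t` introducing `n` with the occurrences `0` and `1` in its premises. -/
def Head.mk00 (t : Head α) (n : ℕ) (D : Finset ℕ) (P : Bool → PreProof α) : PreProof α :=
  (t.rename (· + 2)).mk (n + 2) (up 2 D) fun b => (P b).swap 2 t.k

theorem Head.mk00_swap (t : Head α) (n : ℕ) (D : Finset ℕ) (P : Bool → PreProof α) :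
    (t.mk00 n D P).swap 1 1 = t.mk00 n D fun b => (P b).swap 1 1 := by
  rw [mk00, PreProof.swap, Head.rename_mk, mk00, Head.rename_rename, Head.k_rename]
  have h₁ : swapBlocks 1 1 ∘ (fun n => n + 2) = fun n => n + 2 := by
    funext n; simp [swapBlocks]
  have h₂ : (up 2 D).image (swapBlocks 1 1) = up 2 D := by
    ext n
    simp only [Finset.mem_image, mem_up]
    constructor
    · rintro ⟨m, hm, rfl⟩
      simp only [swapBlocks]
      split_ifs
      · omega
      · omega
      · exact hm
    · intro hn
      rcases n with _ | _ | n
      · exact ⟨1, by omega, rfl⟩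
      · exact ⟨0, by omega, rfl⟩
      · exact ⟨n + 2, hn, by simp [swapBlocks]⟩
  rw [h₁, h₂]
  congr 1
  funext b
  simp only [PreProof.swap, PreProof.rename_rename]
  congr 1
  funext n
  simp only [Function.comp, swapBlocks, liftN]
  split_ifs <;> omega

theorem Head.elim_mk00 {t : Head α} {n : ℕ} {D : Finset ℕ} {P : Bool → PreProof α}
    {L : Bool → List (Formula α)} {Y : Ctx α} (hl : ∀ b, (L b).length = t.k)
    (hP : ∀ b, t.Branch b → T (P b) (cons B (cons A (push (L b) Y))))
    (hq : T q (cons B.dual Θ)) (hd : ∀ n, Y n = none ∨ Θ n = none) :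
    elim B (t.mk00 n D P) (q.shift 1) = t.mk0 n (D ∪ down 1 q.names) fun b =>
      elim B (P b) ((q.shift t.k).shift 1) := by
  have e₁ : t.mk00 n D P = (t.rename (· + 1)).mk0 (n + 1) (up 1 D) fun b =>
      (P b).rename (lift (swapBlocks 1 t.k)) := by
    rw [mk00, mk0, Head.rename_rename, Head.k_rename]
    have h₂ : up 2 D = up 1 (up 1 D) := by
      ext n
      rcases n with _ | _ | n <;> simp
    rw [h₂]
    congr 1
    funext b
    simp only [PreProof.swap, PreProof.rename_rename]
    congr 1
    funext n
    rw [lift_eq_liftN]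
    simp only [Function.comp, swapBlocks, liftN]
    split_ifs <;> omega
  rw [e₁, elim_mk0 _ fun b hb => ?_, mk0, up_union_down, Head.k_rename]
  · refine mk_congr fun b hb => ?_
    rw [Head.branch_rename] at hb
    have hn : ∀ n, cons A (push (L b) Y) n = none ∨ sh 1 (sh t.k Θ) n = none := by
      rintro (_ | n)
      · right; rfl
      · simp only [cons_succ, sh, push_apply, hl b]
        by_cases h : n < t.k
        · right; simp [h]
        · simpa [h] using hd (n - t.k)
    rw [PreProof.swap, elim_rename (hP b hb) ((hq.shift t.k).shift 1) hn]
    congr 1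
    simp only [PreProof.shift, PreProof.rename_rename, lift_comp]
    congr 2
    funext n
    simp only [Function.comp, swapBlocks]
    split_ifs <;> omega
  · rw [Head.branch_rename] at hb
    exact zero_mem_names_rename_lift (((hP b hb).names 0).2 (by simp)) _

/-- The last rule of `p` introduces neither cut formula and has both of them in its premises: it
goes below the two cuts, which are then exchanged above it. -/
theorem cutExchange_mk00 {t : Head α} {n : ℕ} {D : Finset ℕ} {P : Bool → PreProof α}
    {L : Bool → List (Formula α)} {Φ Y : Ctx α} (ht : Rule t n Δ Φ Y L D)
    (hP : ∀ b, t.Branch b → T (P b) (cons B (cons A (push (L b) Y))))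
    (ih : ∀ b, t.Branch b → CutExchange A B (push (L b) Y) (sh t.k Θ) (sh t.k Ξ) (P b)
      (q.shift t.k) (r.shift t.k)) :
    CutExchange A B Δ Θ Ξ (t.mk00 n D P) q r := by
  intro hp hq hr Γ X hs hs'
  have hl := ht.own.length
  obtain ⟨h₁, h₂⟩ := hs.assoc' hs'
  obtain ⟨h₃, h₄⟩ := hs.assoc' hs'.symm
  obtain ⟨h₅, h₆⟩ := h₁.assoc ht.split
  obtain ⟨h₇, h₈⟩ := h₃.assoc ht.split
  obtain ⟨h₉, hX⟩ := hs.assoc ht.split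
  have hR := (ht.join h₁ hq.dom_down).join h₂ hr.dom_down
  have hYX : Ctx.join (Y.join Θ) Ξ = Y.join X := by
    funext n
    have e₁ := hR.split n
    have e₂ := h₉ n
    grind
  rw [hYX] at hR
  rw [Head.mk00_swap, Head.elim_mk00 hl hP hq h₆.disjoint,
    Head.elim_mk00 hl (fun b hb => (hP b hb).swap_one) hr h₈.disjoint, elim_mk0 _ fun b hb => ?_,
    elim_mk0 _ fun b hb => ?_, Finset.union_assoc, Finset.union_assoc,
    Finset.union_comm (down 1 r.names), ← Finset.union_assoc]
  · exact .mk hR fun b hb => ih b hb (hP b hb) (hq.shift t.k) (hr.shift t.k)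
      (X := sh t.k X) (hX.push_left (L b) (hl b)) (hs'.sh t.k)
  · exact (((hP b hb).swap_one.elim_shift (hr.shift t.k)
      (h₈.push_left (L b) (hl b))).names 0).2 (by simp)
  · exact (((hP b hb).elim_shift (hq.shift t.k)
      (h₆.push_left (L b) (hl b))).names 0).2 (by simp)

end

theorem Ctx.Split.four {Γ X Y Ξ Ξ₁ Ξ₂ Θ : Ctx α} (hs : Γ.Split Y X) (hs' : X.Split Ξ Θ)
    (h : Ξ.Split Ξ₁ Ξ₂) : Γ.Split (Y.join Ξ₁) (Ξ₂.join Θ) ∧ (Ξ₂.join Θ).Split Ξ₂ Θ ∧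
      (Y.join Ξ₁).Split Y Ξ₁ ∧ (Y.join (Ξ₁.join Θ)).Split Y (Ξ₁.join Θ) ∧
      (Ξ₁.join Θ).Split Ξ₁ Θ ∧ Γ.Split (Y.join (Ξ₁.join Θ)) Ξ₂ := by
  refine ⟨?_, ?_, ?_, ?_, ?_, ?_⟩ <;> intro n <;> have e₁ := hs n <;> have e₂ := hs' n <;>
    have e₃ := h n <;> simp only [join] <;> grind

theorem IsRule.rename {p : PreProof α} {Γ Γ' : Ctx α} {r : Head α} {i : ℕ} {D : Finset ℕ}
    {ps : Bool → PreProof α} {Φ Δ : Ctx α} {L : Bool → List (Formula α)} {f : ℕ → ℕ}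
    (h : IsRule p Γ r i D ps Φ Δ L) (hf : Ren f Γ Γ') :
    IsRule (p.rename f) Γ' (r.rename f) (f i) (D.image f)
      (fun b => (ps b).rename (liftN r.k f)) (img f Φ) (img f Δ) L := by
  refine ⟨by rw [h.eq, Head.rename_mk], h.rule.rename hf, fun b hb => ?_⟩
  rw [Head.branch_rename] at hb
  have := (h.prem b hb).rename ((hf.split h.rule.split).2.1.push (L b))
  rwa [h.rule.own.length b] at this

section

variable {A B : Formula α} {Γ Δ Θ Ξ X Y : Ctx α} {p q r : PreProof α}

/-- The cuts on smaller formulas that replace a cut commute with another cut. -/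
theorem Op.Typed.cut_run {op : Op α} {L : List (Formula α)} {n : ℕ} (h : op.Typed L Ξ)
    (hn : op.Small n)
    (hc : ∀ B : Formula α, B.size < n → ∀ Δ Θ Ξ p q r, CutExchange A B Δ Θ Ξ p q r)
    {x : PreProof α} (hx : T x (cons A (push L Y))) (hr : T r (cons A.dual Θ))
    (hs : Γ.Split Y X) (hs' : X.Split Ξ Θ) {k : ℕ} (hk : L.length = k) :
    CommEquiv Γ (elim A ((op.rename (· + 1)).run (x.swap 1 k)) r)
      (op.run (elim A x (r.shift k))) := by
  obtain ⟨h₁, h₂⟩ := hs.assoc' hs'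
  obtain ⟨h₃, h₄⟩ := hs.assoc' hs'.symm
  subst hk
  have hres : T (op.run (elim A x (r.shift L.length))) Γ :=
    h.run h₄ (hx.elim (hr.shift L.length) (h₃.push_left L rfl))
  cases h with
  | nil =>
    have e : r.shift 0 = r := by
      rw [PreProof.shift]
      convert PreProof.rename_id r
      funext n
      rcases n with _ | n <;> rfl
    have e' : x.swap 1 0 = x := swap_zero_right 1 x
    simp only [Op.rename, Op.run, List.length_nil, e, e'] at hres ⊢
    exact .refl hres
  | @one B c _ h =>
    have := hc B hn Y Ξ Θ (x.swap 1 1) c r hx.swap_one h hr hs hs'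
    rwa [swap_swap] at this
  | @two B c C c' _ Ξ₁ Ξ₂ h h' hsp =>
    obtain ⟨s₁, s₂, s₃, s₄, s₅, s₆⟩ := hs.four hs' hsp
    have ec : ∀ f : ℕ → ℕ, (∀ n, f (n + 2) = n + 3) → f 0 = 0 → c.rename f = c.shift 1 := by
      refine fun f hf h0 => h.rename_eq ?_
      rintro (_ | _ | n) D hD
      · exact h0
      · simp [sh] at hD
      · exact hf n
    have hx₁ : T (x.swap 1 2) (push [B, C] (push [A] Y)) :=
      T.swap (L := [A]) (M := [B, C]) hx rfl rfl
    have hx₂ : T (x.swap 1 1) (cons B (cons A (cons C Y))) := hx.swap_one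
    have s₃' := (s₃.push_left [A] rfl).push_left [C] rfl
    have hy : T (MALL.elim B (x.swap 1 2) (c.shift 1)) (cons C (cons A (Y.join Ξ₁))) :=
      hx₁.elim (h.shift 1) s₃'
    have ey : (MALL.elim B (x.swap 1 2) (c.shift 1)).swap 1 1 =
        MALL.elim B (x.swap 1 1) (c.shift 1) := by
      rw [PreProof.swap, elim_rename hx₁ (h.shift 1) s₃'.disjoint]
      congr 1
      · simp only [PreProof.swap, PreProof.rename_rename]
        congr 1
        funext n
        rw [lift_eq_liftN]
        simp only [Function.comp, swapBlocks, liftN]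
        split_ifs <;> omega
      · rw [PreProof.shift, PreProof.rename_rename]
        exact ec _ (fun n => by simp [lift, swapBlocks]) rfl
    -- The cut on `A` moves above the second cut of `op`, then above the first one; the latter
    -- exchange takes place under the cut on `C`, whence the use of `congr` at the end.
    have e₁ := hc C hn.2 _ _ _ _ _ _ hy h' hr s₁ s₂
    have e₂ := hc B hn.1 _ _ _ _ _ _ hx₂ h (hr.shift 1) (s₄.push_left [C] rfl) (s₅.sh 1)
    have er : (r.shift 1).shift 1 = r.shift 2 := by
      simp only [PreProof.shift, PreProof.rename_rename, lift_comp]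
      rfl
    rw [ey] at e₁
    rw [swap_swap, er] at e₂
    simp only [Op.rename, Op.run]
    rw [ec _ (fun n => by simp [lift]) rfl]
    exact e₁.trans (congr C e₂ h' s₆)
  | @shiftTwo B c C c' _ Ξ₁ Ξ₂ h h' hsp =>
    obtain ⟨s₁, s₂, s₃, s₄, s₅, s₆⟩ := hs.four hs' hsp
    have hx' : T (x.rename (lift (lift (· + 1)))) (cons A (cons B (sh 1 Y))) :=
      hx.rename (((ren_sh 1 Y).cons B).cons A)
    have hc' : T (c.rename (lift (lift (· + 1)))) (cons B.dual (cons C (sh 1 Ξ₁))) :=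
      h.rename (((ren_sh 1 Ξ₁).cons C).cons B.dual)
    have s₃' := (s₃.push_left [A] rfl).push_right [C] rfl
    have hx₁ : T (x.swap 1 1) (cons B (cons A Y)) := hx.swap_one
    have hy : T (MALL.elim B ((x.swap 1 1).shift 1) (c.rename (lift (lift (· + 1)))))
        (cons C (cons A (Y.join Ξ₁))) := (hx₁.shift 1).elim hc' s₃'
    have ey : (MALL.elim B ((x.swap 1 1).shift 1) (c.rename (lift (lift (· + 1))))).swap 1 1 =
        MALL.elim B ((x.rename (lift (lift (· + 1)))).swap 1 1) (c.shift 1) := by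
      rw [PreProof.swap, elim_rename (hx₁.shift 1) hc' s₃'.disjoint]
      simp only [PreProof.swap, PreProof.shift, PreProof.rename_rename]
      congr 2 <;> funext n <;> rcases n with _ | _ | n <;> simp [swapBlocks, lift]
    have e₁ := hc C hn.2 _ _ _ _ _ _ hy h' hr s₁ s₂
    have e₂ := hc B hn.1 _ _ _ _ _ _ hx'.swap_one h (hr.shift 1) (s₄.push_right [C] rfl)
      (s₅.push_left [C] rfl)
    rw [ey] at e₁
    rw [swap_swap, elim_rename_shift hx hr h₃.disjoint] at e₂
    exact e₁.trans (congr C e₂ h' s₆)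

/-- The rule that introduces `B` does not introduce `A`; for a `⊗`-rule, the fixed premise is chosen
to be the one without `A`. -/
theorem Princ.isSide (hp : Princ B (cons A Δ) p) :
    ∃ t D ps Φ Y L, IsSide (p.swap 1 1) A (cons B Δ) t 0 D ps Φ Y L := by
  obtain ⟨t, D, ps, Φ, Y, L, h, h1⟩ : ∃ t D ps Φ Y L,
      IsRule p (cons B (cons A Δ)) t 0 D ps Φ Y L ∧ Φ 1 = none := by
    rcases hp.typed.cases with ⟨i, j, C, rfl, -⟩ | ⟨i, rfl, hi, hn⟩ |
      ⟨t, i, D, ps, Φ, Y, L, h⟩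
    · obtain ⟨Γ₀, hΓ⟩ : ∃ Γ₀, Γ₀ = cons A Δ := ⟨_, rfl⟩
      rw [← hΓ] at hp
      cases hp
    · have h₀ := hn 0
      have h₁ := hn 1
      simp only [cons_zero, cons_succ, reduceCtorEq, imp_false] at h₀ h₁
      have h₁' : cons B (cons A Δ) 1 = some A := rfl
      grind
    · have hi : ∀ {Γ₀ p}, Princ B Γ₀ p → p = t.mk i D ps → i = 0 := by
        intro Γ₀ p hp e
        cases hp <;> cases t <;> simp [Head.mk] at e <;> omega
      obtain rfl := hi hp h.eq
      cases h1 : Φ 1 with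
      | none => exact ⟨_, _, _, _, _, _, h, h1⟩
      | some C =>
        obtain ⟨r', D', ps', Φ', Δ', L', hr', h1'⟩ := h.flip h1 (by omega)
        exact ⟨_, _, _, _, _, _, hr', h1'⟩
  have hf : Ren (swapBlocks 1 1) (cons B (cons A Δ)) (cons A (cons B Δ)) := ren_swap [B] [A] Δ
  have h' := h.rename hf
  refine ⟨_, _, _, _, _, _, h'.side (i := 0) ?_⟩
  by_contra hc
  obtain ⟨C, hC⟩ := Option.ne_none_iff_exists'.1 hc
  obtain ⟨n, hn, e⟩ := (hf.split h.rule.split).1.back hC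
  obtain rfl : n = 1 := by
    simp only [swapBlocks] at e
    split_ifs at e <;> omega
  simp [h1] at hn

/-- In one order, the key case on `B` gives the cuts `op` on a premise, followed by the cut on `A`.
In the other order, the rule introducing `B` first passes below the cut on `A`, and the same `op` is
then performed after that cut. The two agree because cuts on formulas smaller than `B` may be
exchanged with the cut on `A`. -/
theorem cutExchange_princ
    (hc : ∀ B' : Formula α, B'.size < B.size → ∀ Δ Θ Ξ p q r, CutExchange A B' Δ Θ Ξ p q r)
    (hp : Princ B (cons A Δ) p) (hq : Princ B.dual Θ q) : CutExchange A B Δ Θ Ξ p q r := by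
  intro hpT hqT hr Γ X hs hs'
  obtain ⟨h₁, h₂⟩ := hs.assoc' hs'
  obtain ⟨h₃, h₄⟩ := hs.assoc' hs'.symm
  obtain ⟨t, D, ps, Φ, Y, L, h⟩ := hp.isSide
  obtain ⟨Ξ₀, a, op, hh, hΔ, hY⟩ := h.rule.exists_headCut hq h₁
  have hl := h.rule.own.length
  obtain ⟨Y, rfl⟩ : ∃ Y', Y = sh 1 Y' := ⟨_, (sh_one_eta hY).symm⟩
  change (Δ.join Θ).Split Y Ξ₀ at hΔ
  have s₁ : Γ.Split (Y.join Ξ) Ξ₀ := by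
    intro n
    have e₁ := hΔ n
    have e₂ := h₂ n
    simp only [Ctx.join] at e₁ e₂ ⊢
    grind
  have s₂ : (Y.join Ξ).Split Y Ξ := by
    intro n
    have e₁ := hΔ n
    have e₂ := h₂ n
    simp only [Ctx.join] at e₁ e₂ ⊢
    grind
  have hsp : ∀ b, (push (L b) (sh 1 (Y.join Ξ))).Split (push (L b) (sh 1 Y))
      (sh t.k (sh 1 Ξ)) := fun b => (s₂.sh 1).push_left (L b) (hl b)
  have hrr := (hr.shift 1).shift t.k
  have hx : T ((ps a).rename (lift (liftN t.k Nat.pred))) (cons A (push (L a) Y)) := by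
    have := (h.prem a hh.branch).rename (((ren_pred (Γ := sh 1 Y) rfl).push (L a)).cons A)
    rwa [hl a] at this
  have eR := hh.elim_mk (fun B _ => congr B) (Y := sh 1 (Y.join Ξ)) s₁ rfl
    (D ∪ down 1 (r.shift 1).names) (ps := fun b => elim A (ps b) ((r.shift 1).shift t.k)) hl
    fun b hb => (h.prem b hb).elim hrr (hsp b)
  rw [← h.elim, elim_rename (h.prem a hh.branch) hrr (hsp a).disjoint] at eR
  have er : ((r.shift 1).shift t.k).rename (lift (liftN t.k Nat.pred)) = r.shift t.k := by
    simp only [PreProof.shift, PreProof.rename_rename, lift_comp]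
    congr 2
    funext n
    simp only [Function.comp, liftN, Nat.pred_eq_sub_one]
    split_ifs <;> omega
  rw [er] at eR
  have hps : ∀ b, t.Branch b → T (((ps b).swap 1 t.k).rename (liftN t.k (swapBlocks 1 1)))
      (push (L b) (sh 1 (cons A Y))) := by
    intro b hb
    have h₅ : T ((ps b).swap 1 t.k) (push (L b) (cons A (sh 1 Y))) :=
      T.swap (L := [A]) (h.prem b hb) rfl (hl b)
    have := h₅.rename ((ren_swap_sh [A] Y).push (L b))
    rwa [hl b] at this
  have eL := (hh.rename (ren_sh 1 Ξ₀)).elim_mk (fun B _ => congr B) (Γ := cons A (Δ.join Θ))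
    (Y := sh 1 (cons A Y)) (hΔ.push_left [A] rfl) rfl ((up 1 D).image (swapBlocks 1 1))
    (ps := fun b => ((ps b).swap 1 t.k).rename (liftN t.k (swapBlocks 1 1)))
    (by simpa using hl) fun b hb => hps b (by simpa using hb)
  have ep : p = (t.rename (lift (· + 1))).mk 0 ((up 1 D).image (swapBlocks 1 1)) fun b =>
      ((ps b).swap 1 t.k).rename (liftN t.k (swapBlocks 1 1)) := by
    rw [← swap_swap 1 1 p, h.eq, Head.mk0, Head.mk_add_swap]
    rfl
  have hsw := T.swap_rename_pred (L := L a) (M := [A]) (h.prem a hh.branch) rfl (hl a) rfl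
  rw [← ep, Head.k_rename] at eL
  simp only [List.length_singleton] at hsw
  rw [hsw, liftN_one] at eL
  refine (congr A eL hr h₂).trans (.trans ?_ eR.symm)
  refine hh.typed.cut_run hh.small hc hx hr (X := Ξ₀.join Ξ) ?_ ?_ (hl a)
  all_goals
    intro n
    have e₁ := hΔ n
    have e₂ := h₂ n
    simp only [Ctx.join] at e₁ e₂ ⊢
    grind

/-- The last rule of a proof, with respect to the occurrences `0` and `1`. -/
theorem T.cases_two (hp : T p (cons B (cons A Δ))) :
    p = .ax s(0, 1) ∨
    (∃ t n D P Φ Y L, p = Head.mk00 t n D P ∧ Rule t n Δ Φ Y L D ∧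
      ∀ b, t.Branch b → T (P b) (cons B (cons A (push (L b) Y)))) ∨
    (∃ n a b C D Δ₁ Δ₂, p = tensTwo n a b ∧ T a (cons B (cons C Δ₁)) ∧ T b (cons A (cons D Δ₂)) ∧
      ∀ n, Δ n = none → Δ₁ n = none ∧ Δ₂ n = none) ∨
    (∃ n a b C D Δ₁ Δ₂, p.swap 1 1 = tensTwo n a b ∧ T a (cons A (cons C Δ₁)) ∧
      T b (cons B (cons D Δ₂)) ∧ ∀ n, Δ n = none → Δ₁ n = none ∧ Δ₂ n = none) ∨
    Princ B (cons A Δ) p ∨ Princ A (cons B Δ) (p.swap 1 1) := by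
  rcases hp.cases_zero with ⟨i, rfl, h⟩ | ⟨t, i, D, ps, Φ, Y, L, h⟩ | h
  · left
    obtain rfl : i = 0 := by
      have := congrFun h 0
      by_contra hi
      simp [single, Ne.symm hi] at this
    rfl
  · rcases i with _ | n
    · have hf : Ren (swapBlocks 1 1) (cons B (cons A Δ)) (cons A (cons B Δ)) :=
        ren_swap [B] [A] Δ
      have h' := h.isRule.rename hf
      exact .inr (.inr (.inr (.inr (.inr h'.princ))))
    · have hl := h.rule.own.length
      cases h0 : Φ 0 with
      | none =>
        obtain ⟨h₁, h₂, h₃, h₄⟩ := h.rule.uncons h0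
        refine .inr (.inl ⟨_, n, _, fun b => (ps b).rename (lift (swapBlocks t.k 1)), _, _, _, ?_,
          h₁, fun b hb => ?_⟩)
        · rw [h.eq, Head.mk00, Head.mk0]
          have e₁ : up 2 (down 1 D) = up 1 D := by
            rw [← h₃]
            ext n
            rcases n with _ | _ | n <;> simp
          have e₂ := Head.rename_rename (· + 1) (· + 1) (t.rename Nat.pred)
          rw [h₄] at e₂
          rw [e₁, e₂, Head.k_rename]
          congr 1
          funext b
          simp only [PreProof.swap, PreProof.rename_rename]
          congr 1
          funext n
          rw [lift_eq_liftN]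
          simp only [Function.comp, swapBlocks, liftN]
          split_ifs <;> omega
        · rw [Head.branch_rename] at hb
          have hf := ren_swap (L b) [A] fun n => Y (n + 1)
          rw [hl b] at hf
          simp only [push, h₂, List.length_singleton] at hf
          exact (h.prem b hb).rename (hf.cons B)
      | some C =>
        obtain rfl : C = A := by
          have := h.rule.split 0; simp only [cons_zero] at this; grind
        have hY : Y 0 = none := by have := h.rule.split 0; grind
        have hd : ∀ n, Δ n = none → Y (n + 1) = none ∧ Φ (n + 1) = none := by
          intro n hn
          have := h.rule.split (n + 1)
          simp only [cons_succ, hn] at this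
          grind
        have e := h.eq
        have ho := h.rule.own
        rcases ho.zero h0 (by omega) with ⟨u, rfl⟩ | ⟨u, rfl⟩
        all_goals
          obtain ⟨E, F, hE, hu, rfl⟩ := ho
          obtain ⟨x, hx, ex⟩ := T.exists_rename_succ (L := [B, _]) (k := 2) (h.prem false rfl) hY rfl
          have eΦ : Φ.erase (n + 1) = cons C (Ctx.erase (fun n => Φ (n + 1)) n) := by
            funext m
            rcases m with _ | m <;> simp [erase, h0]
          rw [eΦ] at hu
          rw [liftN_two] at ex
          have hd' : ∀ m, Δ m = none →
              Y (m + 1) = none ∧ Ctx.erase (fun n => Φ (n + 1)) n m = none := by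
            intro m hm
            refine ⟨(hd m hm).1, ?_⟩
            simp [erase, (hd m hm).2]
        · refine .inr (.inr (.inl ⟨n, x, u.swap 1 1, _, _, _, _, ?_, hx, hu.swap_one, hd'⟩))
          rw [e, tensTwo, swap_swap, ← ex]
          rfl
        · refine .inr (.inr (.inr (.inl ⟨n, u.swap 1 1, x, _, _, _, _, ?_, hu.swap_one, hx,
            fun m hm => (hd' m hm).symm⟩)))
          rw [e, ← swap_swap 1 1 (tensTwo _ _ _), tensTwo_swap, swap_swap, ← ex]
          rfl
  · exact .inr (.inr (.inr (.inr (.inl h))))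

theorem Head.sz_mk00 (t : Head α) (n : ℕ) (D : Finset ℕ) (P : Bool → PreProof α) {b : Bool}
    (hb : t.Branch b) : (P b).sz < (t.mk00 n D P).sz := by
  have := sz_mk (t.rename (· + 2)) (n + 2) (up 2 D) (fun b => (P b).swap 2 t.k)
    ((branch_rename _ _ _).2 hb)
  rwa [PreProof.swap, sz_rename] at this

end

/-- Lexicographic induction on the total size of the cut formulas, then of the three proofs. The
last rule of the shared proof `p` leads. If it introduces neither formula, it goes below both cuts.
If it introduces `B`, the proof `q` is inspected: an axiom or a side rule of `q` is treated
directly, and otherwise there is a key case on `B`. If it introduces `A`, the same is done with `r`,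
by symmetry. -/
theorem cutExchange (A B : Formula α) (Δ Θ Ξ : Ctx α) (p q r : PreProof α) :
    CutExchange A B Δ Θ Ξ p q r := by
  induction hn : A.size + B.size using Nat.strong_induction_on
    generalizing A B Δ Θ Ξ p q r with | _ n ihn
  induction hm : p.sz + q.sz + r.sz using Nat.strong_induction_on
    generalizing Δ Θ Ξ p q r with | _ m ih
  intro hp hq hr
  have hB : ∀ B' : Formula α, B'.size < B.size → ∀ Δ Θ Ξ p q r, CutExchange A B' Δ Θ Ξ p q r :=
    fun B' hB' Δ Θ Ξ p q r => ihn _ (by omega) A B' Δ Θ Ξ p q r rfl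
  have hA : ∀ A' : Formula α, A'.size < A.size → ∀ Δ Θ Ξ p q r, CutExchange B A' Δ Θ Ξ p q r :=
    fun A' hA' Δ Θ Ξ p q r => ihn _ (by omega) B A' Δ Θ Ξ p q r rfl
  have hsw : ∀ {p : PreProof α}, CutExchange B A Δ Ξ Θ (p.swap 1 1) r q →
      CutExchange A B Δ Θ Ξ p q r := by
    intro p h
    have := h.symm
    rwa [swap_swap] at this
  have hsz : ∀ f : ℕ → ℕ, (p.rename f).sz = p.sz := fun f => sz_rename f p
  have hrside : (∃ i, r = .ax s(0, i + 1)) ∨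
      (∃ s j E qs Ψ Y M, IsSide r A.dual Ξ s j E qs Ψ Y M) → CutExchange A B Δ Θ Ξ p q r := by
    rintro (⟨i, rfl⟩ | ⟨s, j, E, qs, Ψ, Y, M, h⟩)
    · exact hsw (cutExchange_ax i)
    · refine hsw (cutExchange_side h fun b hb => ?_)
      have := (ih _ (by have := h.sz hb; simp; omega) (sh s.k Δ) (sh s.k Θ) (push (M b) Y)
        (p.rename (lift (lift (· + s.k)))) (q.shift s.k) (qs b) rfl).symm
      rwa [← liftN_one, ← liftN_one, ← swap_rename, liftN_one, liftN_one] at this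
  rcases hp.cases_two with rfl | ⟨t, n, D, P, Φ, Y, L, rfl, ht, hP⟩ |
    ⟨n, a, b, C, D, Δ₁, Δ₂, rfl, ha, hb, hd⟩ | ⟨n, a, b, C, D, Δ₁, Δ₂, e, ha, hb, hd⟩ | hp' | hp'
  · exact cutExchange_ax_left hp hq hr
  · refine cutExchange_mk00 ht hP (fun b hb => ?_) hp hq hr
    exact ih _ (by have := t.sz_mk00 n D P hb; simp; omega) _ _ _ _ _ _ rfl
  · exact cutExchange_tens ha hb hd hp hq hr
  · refine hsw ?_ hp hq hr
    rw [e]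
    exact cutExchange_tens ha hb hd
  · rcases hq.cases_zero with ⟨i, rfl, -⟩ | ⟨s, j, E, qs, Ψ, Y, M, h⟩ | hq'
    · exact cutExchange_ax i hp hq hr
    · refine cutExchange_side h (fun b hb => ?_) hp hq hr
      exact ih _ (by have := h.sz hb; simp; omega) _ _ _ _ _ _ rfl
    · exact cutExchange_princ hB hp' hq' hp hq hr
  · rcases hr.cases_zero with ⟨i, rfl, -⟩ | ⟨s, j, E, qs, Ψ, Y, M, h⟩ | hr'
    · exact hrside (.inl ⟨i, rfl⟩) hp hq hr
    · exact hrside (.inr ⟨s, j, E, qs, Ψ, Y, M, h⟩) hp hq hr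
    · exact hsw (cutExchange_princ hA hp' hr') hp hq hr

/-! ### Elimination of all cuts, and its behaviour under renaming -/

/-- The result of the elimination of all cuts. -/
noncomputable def nf : PreProof α → PreProof α
  | .ax e => .ax e
  | .cut A p q => elim A (nf p) (nf q)
  | .tens i p q => .tens i (nf p) (nf q)
  | .parr i p => .parr i (nf p)
  | .one i => .one i
  | .bot i p => .bot i (nf p)
  | .wth i p q => .wth i (nf p) (nf q)
  | .plus k i p => .plus k i (nf p)
  | .top i S => .top i S

theorem nf_eq_self {p : PreProof α} (h : p.CutFree) : nf p = p := by
  induction p with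
  | cut => exact h.elim
  | tens i p q ihp ihq => rw [nf, ihp h.1, ihq h.2]
  | wth i p q ihp ihq => rw [nf, ihp h.1, ihq h.2]
  | parr i p ih => rw [nf, ih h]
  | bot i p ih => rw [nf, ih h]
  | plus k i p ih => rw [nf, ih h]
  | _ => rfl

theorem Derives.nf {p : PreProof α} {Γ : Ctx α} (h : Derives p Γ) : T (nf p) Γ := by
  induction h with
  | ax hij hi hj h => exact ⟨.ax hij hi hj h, trivial⟩
  | cut h _ _ ihp ihq => exact ihp.elim ihq h
  | tens hi h _ _ ihp ihq => exact ⟨.tens hi h ihp.der ihq.der, ihp.cf, ihq.cf⟩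
  | parr hi _ ih => exact ⟨.parr hi ih.der, ih.cf⟩
  | one hi h => exact ⟨.one hi h, trivial⟩
  | bot hi _ ih => exact ⟨.bot hi ih.der, ih.cf⟩
  | wth hi _ _ ihp ihq => exact ⟨.wth hi ihp.der ihq.der, ihp.cf, ihq.cf⟩
  | plus₁ hi _ ih => exact ⟨.plus₁ hi ih.der, ih.cf⟩
  | plus₂ hi _ ih => exact ⟨.plus₂ hi ih.der, ih.cf⟩
  | top hi h => exact ⟨.top hi h, trivial⟩

theorem Derives.nf_rename {p : PreProof α} {Γ : Ctx α} (h : Derives p Γ) (f : ℕ → ℕ) :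
    MALL.nf (p.rename f) = (MALL.nf p).rename f := by
  induction h generalizing f with
  | cut h hp hq ihp ihq =>
    simp only [PreProof.rename, MALL.nf, ihp, ihq]
    exact (elim_rename hp.nf hq.nf h.disjoint f).symm
  | _ => simp only [PreProof.rename, MALL.nf, *]

/-- The steps of cut-elimination mention sub-proofs such as `p.shift 1`, known to be correct only
after renaming. A left inverse of the renaming recovers the correctness of `p` itself, which
`Derives.nf_rename` needs. -/
theorem Derives.of_rename {p : PreProof α} {Γ : Ctx α} {f g : ℕ → ℕ} (hg : ∀ n, g (f n) = n)
    (h : Derives (p.rename f) Γ) : Derives p fun n => Γ (f n) := by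
  have hn := h.names
  have hf : ∀ {n A}, Γ n = some A → ∃ m, f m = n := by
    intro n A hA
    have := (hn n).2 (by simp [hA])
    rw [names_rename, Finset.mem_image] at this
    obtain ⟨m, -, e⟩ := this
    exact ⟨m, e⟩
  have hr : Ren g Γ fun n => Γ (f n) := by
    refine ⟨?_, ?_, ?_⟩
    · intro n A hA
      obtain ⟨m, rfl⟩ := hf hA
      simp only [hg, hA]
    · exact fun {m A} hA => ⟨f m, hA, hg m⟩
    · intro n m A B hA hB e
      obtain ⟨n, rfl⟩ := hf hA
      obtain ⟨m, rfl⟩ := hf hB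
      rw [hg, hg] at e
      rw [e]
  have := h.rename hr
  rw [PreProof.rename_rename] at this
  convert this
  rw [show g ∘ f = id from funext hg, PreProof.rename_id]

theorem nf_rename_of_leftInverse {p : PreProof α} {Γ : Ctx α} {f g : ℕ → ℕ}
    (hg : ∀ n, g (f n) = n) (h : Derives (p.rename f) Γ) : nf (p.rename f) = (nf p).rename f :=
  (h.of_rename hg).nf_rename f

theorem lift_pred_lift_succ (n : ℕ) : lift Nat.pred (lift (· + 1) n) = n := by
  cases n <;> rfl

theorem nf_shift_one {p : PreProof α} {Γ : Ctx α} (h : Derives (p.shift 1) Γ) :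
    nf (p.shift 1) = (nf p).shift 1 := nf_rename_of_leftInverse lift_pred_lift_succ h

theorem nf_swap {p : PreProof α} {Γ : Ctx α} {a b : ℕ} (h : Derives (p.swap a b) Γ) :
    nf (p.swap a b) = (nf p).swap a b := by
  refine nf_rename_of_leftInverse (g := swapBlocks b a) (fun n => ?_) h
  unfold swapBlocks; split_ifs <;> omega

section congruence

variable {Γ Δ Θ : Ctx α} {A B : Formula α} {i : ℕ} {p p' q q' : PreProof α}

theorem CommEquiv.parr (hi : Γ i = some (.parr A B))
    (h : CommEquiv (cons A (cons B (Γ.erase i))) p p') : CommEquiv Γ (.parr i p) (.parr i p') :=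
  .mk (r := .parr) (ps := fun _ => p) (ps' := fun _ => p') (D := down 2 p.names)
    ⟨⟨A, B, rfl, rfl⟩, Rule.split_single hi, fun n => by rw [mem_down, h.typed.1.names]; rfl⟩
    fun _ _ => h

theorem CommEquiv.bot (hi : Γ i = some .bot) (h : CommEquiv (Γ.erase i) p p') :
    CommEquiv Γ (.bot i p) (.bot i p') :=
  .mk (r := .bot) (ps := fun _ => p) (ps' := fun _ => p') (D := p.names)
    ⟨⟨rfl, rfl⟩, Rule.split_single hi, h.typed.1.names⟩ fun _ _ => h

theorem CommEquiv.plus₁ (hi : Γ i = some (.plus A B)) (h : CommEquiv (cons A (Γ.erase i)) p p') :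
    CommEquiv Γ (.plus .fst i p) (.plus .fst i p') :=
  .mk (r := .plus .fst) (ps := fun _ => p) (ps' := fun _ => p') (D := down 1 p.names)
    ⟨⟨A, B, rfl, rfl⟩, Rule.split_single hi, h.typed.1.dom_down⟩ fun _ _ => h

theorem CommEquiv.plus₂ (hi : Γ i = some (.plus A B)) (h : CommEquiv (cons B (Γ.erase i)) p p') :
    CommEquiv Γ (.plus .snd i p) (.plus .snd i p') :=
  .mk (r := .plus .snd) (ps := fun _ => p) (ps' := fun _ => p') (D := down 1 p.names)
    ⟨⟨A, B, rfl, rfl⟩, Rule.split_single hi, h.typed.1.dom_down⟩ fun _ _ => h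

theorem CommEquiv.wth (hi : Γ i = some (.wth A B)) (h : CommEquiv (cons A (Γ.erase i)) p p')
    (h' : CommEquiv (cons B (Γ.erase i)) q q') : CommEquiv Γ (.wth i p q) (.wth i p' q') :=
  .mk (r := .wth) (ps := fun b => cond b q p) (ps' := fun b => cond b q' p') (D := down 1 p.names)
    ⟨⟨A, B, rfl, rfl⟩, Rule.split_single hi, h.typed.1.dom_down⟩ fun b _ => by
      cases b
      · exact h
      · exact h'

/-- As an operation, a `⊗`-rule has one variable premise: the left one is changed with the right one
fixed, and then conversely. -/
theorem CommEquiv.tens (hi : Γ i = some (.tens A B)) (hs : (Γ.erase i).Split Δ Θ)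
    (h : CommEquiv (cons A Δ) p p') (h' : CommEquiv (cons B Θ) q q') :
    CommEquiv Γ (.tens i p q) (.tens i p' q') := by
  have key : ∀ {Δ Θ : Ctx α}, (Γ.erase i).Split Δ Θ →
      Γ.Split (fun n => if n = i then Γ i else Θ n) Δ ∧
      Ctx.erase (fun n => if n = i then Γ i else Θ n) i = Θ := by
    intro Δ Θ hs
    constructor
    · intro n; have := hs n; simp only [Ctx.erase] at this ⊢; grind
    · funext n; have := hs n; simp only [Ctx.erase] at this ⊢; grind
  obtain ⟨h₁, h₂⟩ := key hs
  obtain ⟨h₃, h₄⟩ := key hs.symm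
  exact (CommEquiv.mk (r := .tensL q) (ps := fun _ => p) (ps' := fun _ => p')
    (D := down 1 p.names) ⟨⟨A, B, by simp [hi], by rw [h₂]; exact h'.typed.1, rfl⟩, h₁,
      h.typed.1.dom_down⟩ fun _ _ => h).trans
    (.mk (r := .tensR p') (ps := fun _ => q) (ps' := fun _ => q')
      (D := down 1 q.names) ⟨⟨A, B, by simp [hi], by rw [h₄]; exact h.typed.2, rfl⟩, h₃,
      h'.typed.1.dom_down⟩ fun _ _ => h')

end congruence

/-! ### Invariance of `nf` under cut-elimination, up to rule commutations -/

theorem PreProof.IsCut.nf {A : Formula α} {Γ : Ctx α} {p q c : PreProof α} (h : IsCut A p q c)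
    (hc : Derives c Γ) : ∃ Δ Θ, Γ.Split Δ Θ ∧ Derives p (cons A Δ) ∧ Derives q (cons A.dual Θ) ∧
      CommEquiv Γ (nf c) (elim A (MALL.nf p) (MALL.nf q)) := by
  cases h with
  | straight =>
    cases hc with
    | cut h hp hq => exact ⟨_, _, h, hp, hq, .refl (hp.nf.elim hq.nf h)⟩
  | switched =>
    cases hc with
    | cut h hq hp =>
      rw [Formula.dual_dual] at hp
      exact ⟨_, _, h.symm, hp, hq, elim_symm_dual hq.nf hp.nf h⟩

/-- With the cuts in their straight orientation, the key cases are the equations of `elim`, and the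
commutative cases other than `cut`-`cut` are instances of `elim_mk0`. Commutations come only from
the orientation of the cuts, through `IsCut.nf`, and from the `cut`-`cut` case, which is
`cutExchange`. -/
theorem PreProof.BetaRoot.commEquiv {Γ : Ctx α} {c c' : PreProof α} (h : BetaRoot c c')
    (hc : Derives c Γ) (hc' : Derives c' Γ) : CommEquiv Γ (nf c) (nf c') := by
  cases h with
  | @ax A i q _ h =>
    obtain ⟨Δ, Θ, hs, hp, hq, e⟩ := h.nf hc
    rw [hq.nf_rename]
    rwa [nf, elim_ax_left] at e
  | @tens_parr A B p₁ p₂ p₃ _ _ c₂ h h₂ h₁ =>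
    obtain ⟨Δ, Θ, hs, hp, hq, e⟩ := h.nf hc
    obtain ⟨Δ₁, Θ₁, hs₁, hp₁, hc₂, e₁⟩ := h₁.nf hc'
    obtain ⟨Δ₂, Θ₂, hs₂, hp₂, hp₃, e₂⟩ := h₂.nf hc₂
    rw [nf, nf, hp₃.nf_rename, nf_shift_one hp₂, show nf (p₁.shift 1) = (nf p₁).shift 1 from
      hp₁.nf_rename _, elim_tens_parr] at e
    rw [nf_shift_one hp₂] at e₂
    exact e.trans (.trans (.elim (.refl hp₁.nf) e₂.symm hs₁) e₁.symm)
  | @wth_plus₁ A B p₁ p₂ p₃ _ _ h h₁ =>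
    obtain ⟨Δ, Θ, hs, hp, hq, e⟩ := h.nf hc
    obtain ⟨Δ₁, Θ₁, hs₁, hp₂, hp₃, e₁⟩ := h₁.nf hc'
    cases hp with
    | wth hi hp hp' =>
      rw [nf, nf, nf_shift_one hp, nf_shift_one hp', show nf (p₃.shift 1) = (nf p₃).shift 1 from
        hp₃.nf_rename _, elim_wth_plus₁] at e
      exact e.trans e₁.symm
  | @wth_plus₂ A B p₁ p₂ p₃ _ _ h h₁ =>
    obtain ⟨Δ, Θ, hs, hp, hq, e⟩ := h.nf hc
    obtain ⟨Δ₁, Θ₁, hs₁, hp₂, hp₃, e₁⟩ := h₁.nf hc'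
    cases hp with
    | wth hi hp hp' =>
      rw [nf, nf, nf_shift_one hp, nf_shift_one hp', show nf (p₃.shift 1) = (nf p₃).shift 1 from
        hp₃.nf_rename _, elim_wth_plus₂] at e
      exact e.trans e₁.symm
  | @one_bot p _ h =>
    obtain ⟨Δ, Θ, hs, hp, hq, e⟩ := h.nf hc
    rwa [nf, nf, hc'.nf_rename, elim_one_bot] at e
  | @parr_cut A i p q _ c₁ h h₁ =>
    obtain ⟨Δ, Θ, hs, hp, hq, e⟩ := h.nf hc
    cases hc' with
    | parr hi hc₁ =>
      obtain ⟨Δ₁, Θ₁, hs₁, hp₁, hq₁, e₁⟩ := h₁.nf hc₁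
      have h0 := (hp₁.nf.names 0).2 (by simp)
      rw [nf_swap hp₁] at e₁ h0
      have := elim_mk0 (A := A) (r := .parr) (i := i) (D := ∅) (ps := fun _ => (nf p).swap 2 1)
        (nf q) fun _ _ => h0
      simp only [Head.mk0, Head.mk, Head.rename, Head.k, swap_swap] at this
      rw [nf, this] at e
      rw [show nf (q.shift 2) = (nf q).shift 2 from hq.nf_rename _] at e₁
      exact e.trans (.parr hi e₁.symm)
  | @tens_cut₁ A i p₁ p₂ q _ c₁ h h₁ =>
    obtain ⟨Δ, Θ, hs, hp, hq, e⟩ := h.nf hc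
    cases hp with
    | tens _ _ _ hp₂ =>
    cases hc' with
    | tens hi hsp hc₁ hp₂' =>
      obtain ⟨Δ₁, Θ₁, hs₁, hp₁, hq₁, e₁⟩ := h₁.nf hc₁
      have h0 := (hp₁.nf.names 0).2 (by simp)
      rw [nf_swap hp₁] at e₁ h0
      have := elim_mk0 (A := A) (r := .tensL (nf p₂)) (i := i) (D := ∅)
        (ps := fun _ => (nf p₁).swap 1 1) (nf q) fun _ _ => h0
      simp only [Head.mk0, Head.mk, Head.rename, Head.k, swap_swap] at this
      rw [nf, nf_shift_one hp₂, PreProof.shift, this] at e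
      rw [show nf (q.shift 1) = (nf q).shift 1 from hq.nf_rename _] at e₁
      exact e.trans (.tens hi hsp e₁.symm (.refl hp₂'.nf))
  | @tens_cut₂ A i p₁ p₂ q _ c₁ h h₁ =>
    obtain ⟨Δ, Θ, hs, hp, hq, e⟩ := h.nf hc
    cases hp with
    | tens _ _ hp₁ _ =>
    cases hc' with
    | tens hi hsp hp₁' hc₁ =>
      obtain ⟨Δ₁, Θ₁, hs₁, hp₂, hq₁, e₁⟩ := h₁.nf hc₁
      have h0 := (hp₂.nf.names 0).2 (by simp)
      rw [nf_swap hp₂] at e₁ h0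
      have := elim_mk0 (A := A) (r := .tensR (nf p₁)) (i := i) (D := ∅)
        (ps := fun _ => (nf p₂).swap 1 1) (nf q) fun _ _ => h0
      simp only [Head.mk0, Head.mk, Head.rename, Head.k, swap_swap] at this
      rw [nf, nf_shift_one hp₁, PreProof.shift, this] at e
      rw [show nf (q.shift 1) = (nf q).shift 1 from hq.nf_rename _] at e₁
      exact e.trans (.tens hi hsp (.refl hp₁'.nf) e₁.symm)
  | @wth_cut A i p₁ p₂ q _ c₁ c₂ h h₁ h₂ =>
    obtain ⟨Δ, Θ, hs, hp, hq, e⟩ := h.nf hc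
    cases hc' with
    | wth hi hc₁ hc₂ =>
      obtain ⟨Δ₁, Θ₁, hs₁, hp₁, hq₁, e₁⟩ := h₁.nf hc₁
      obtain ⟨Δ₂, Θ₂, hs₂, hp₂, hq₂, e₂⟩ := h₂.nf hc₂
      have h0 := (hp₁.nf.names 0).2 (by simp)
      have h0' := (hp₂.nf.names 0).2 (by simp)
      rw [nf_swap hp₁] at e₁ h0
      rw [nf_swap hp₂] at e₂ h0'
      have := elim_mk0 (A := A) (r := .wth) (i := i) (D := ∅)
        (ps := fun b => cond b ((nf p₂).swap 1 1) ((nf p₁).swap 1 1)) (nf q) fun b _ => by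
          cases b
          · exact h0
          · exact h0'
      simp only [Head.mk0, Head.mk, Head.rename, Head.k, cond_true, cond_false, swap_swap] at this
      rw [nf, this] at e
      rw [show nf (q.shift 1) = (nf q).shift 1 from hq.nf_rename _] at e₁ e₂
      exact e.trans (.wth hi e₁.symm e₂.symm)
  | @plus_cut A k i p q _ c₁ h h₁ =>
    obtain ⟨Δ, Θ, hs, hp, hq, e⟩ := h.nf hc
    have key : ∀ {Γ}, Derives c₁ Γ → ∃ W, elim A (nf (.plus k (i + 1) p)) (nf q) = .plus k i W ∧
        CommEquiv Γ W (nf c₁) := by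
      intro Γ hc₁
      obtain ⟨Δ₁, Θ₁, hs₁, hp₁, hq₁, e₁⟩ := h₁.nf hc₁
      have h0 := (hp₁.nf.names 0).2 (by simp)
      rw [nf_swap hp₁] at e₁ h0
      have := elim_mk0 (A := A) (r := .plus k) (i := i) (D := ∅)
        (ps := fun _ => (nf p).swap 1 1) (nf q) fun _ _ => h0
      simp only [Head.mk0, Head.mk, Head.rename, Head.k, swap_swap] at this
      rw [show nf (q.shift 1) = (nf q).shift 1 from hq.nf_rename _] at e₁
      exact ⟨_, this, e₁.symm⟩
    cases hc' with
    | plus₁ hi hc₁ =>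
      obtain ⟨W, h₁, h₂⟩ := key hc₁
      rw [h₁] at e
      exact e.trans (.plus₁ hi h₂)
    | plus₂ hi hc₁ =>
      obtain ⟨W, h₁, h₂⟩ := key hc₁
      rw [h₁] at e
      exact e.trans (.plus₂ hi h₂)
  | @bot_cut A i p q _ c₁ h h₁ =>
    obtain ⟨Δ, Θ, hs, hp, hq, e⟩ := h.nf hc
    cases hc' with
    | bot hi hc₁ =>
      obtain ⟨Δ₁, Θ₁, hs₁, hp₁, hq₁, e₁⟩ := h₁.nf hc₁
      have h0 := (hp₁.nf.names 0).2 (by simp)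
      have := elim_mk0 (A := A) (r := .bot) (i := i) (D := ∅) (ps := fun _ => nf p)
        (nf q) fun _ _ => h0
      have e₀ : (nf q).shift 0 = nf q := by
        rw [PreProof.shift]
        convert PreProof.rename_id (nf q)
        funext n
        rcases n with _ | n <;> rfl
      simp only [Head.mk0, Head.mk, Head.rename, Head.k, swap_zero_right, e₀] at this
      rw [nf, this] at e
      exact e.trans (.bot hi e₁.symm)
  | @top_cut A i S q _ h =>
    obtain ⟨Δ, Θ, hs, hp, hq, e⟩ := h.nf hc
    have := elim_mk0 (A := A) (r := .top) (i := i) (D := down 1 S) (ps := fun _ => .one 0)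
      (nf q) fun _ hb => hb.elim
    simp only [Head.mk0, Head.mk, Head.rename] at this
    -- The cut formula belongs to the context of the `⊤`-rule, so `0 ∈ S`.
    have hS : up 1 (down 1 S) = S := by
      cases hp with
      | top hi h =>
        ext n
        rcases n with _ | n
        · have := h 0
          simp [erase] at this
          simp [this]
        · simp
    rw [hS, hq.nf.names.unique hq.names] at this
    rw [nf, this] at e
    exact e
  | @cut_cut A B p₁ p₂ p₃ d _ c₁ _ hd h h₁ h₂ =>
    obtain ⟨X, Ξ, hs, hd', hp₃, e⟩ := h.nf hc
    obtain ⟨Δ, Θ, hs', hp₁, hp₂, e'⟩ := hd.nf hd'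
    obtain ⟨Δ₂, Θ₂, hs₂, hc₁, hp₂', e₂⟩ := h₂.nf hc'
    obtain ⟨Δ₁, Θ₁, hs₁, hp₁', hp₃', e₁⟩ := h₁.nf hc₁
    -- The name `1` does not occur in `p₂.shift 1`, so the formula `A` of the outer cut comes from
    -- `p₁`.
    have hΘ : Θ 0 = none := by
      by_contra hc
      exact one_not_mem_names_shift p₂ ((hp₂.names 1).2 hc)
    have hΔ : Δ 0 = some A := by
      have := hs' 0
      simp only [cons_zero] at this
      grind
    obtain ⟨Δ, rfl⟩ : ∃ Δ', Δ = cons A Δ' := ⟨_, (cons_eta hΔ).symm⟩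
    have hp₂'' : T (nf p₂) (cons B.dual fun n => Θ (n + 1)) := by
      have := (hp₂.of_rename lift_pred_lift_succ).nf
      convert this using 1
      funext n
      rcases n with _ | n <;> rfl
    rw [nf_shift_one hp₂] at e'
    rw [nf_swap hp₁', show nf (p₃.shift 1) = (nf p₃).shift 1 from hp₃.nf_rename _] at e₁
    refine (e.trans (congr A e' hp₃.nf hs)).trans
      (.trans ?_ (e₂.trans (congr B e₁ hp₂'.nf hs₂)).symm)
    have hX : X.Split Δ fun n => Θ (n + 1) := fun n => hs' (n + 1)
    obtain ⟨h₁, h₂⟩ := hs.assoc hX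
    exact cutExchange A B _ _ _ _ _ _ hp₁.nf hp₂'' hp₃.nf h₁ h₂

theorem Ctx.Split.unique {Γ Δ Θ Δ' Θ' : Ctx α} (h : Γ.Split Δ Θ) (h' : Γ.Split Δ' Θ')
    (hΘ : ∀ n, Θ n ≠ none ↔ Θ' n ≠ none) : Δ = Δ' ∧ Θ = Θ' := by
  constructor <;> funext n <;> have h₁ := h n <;> have h₂ := h' n <;> have h₃ := hΘ n <;> grind

/-- For a step inside one premise of a binary rule: the untouched premise has the same names before
and after, so by `Ctx.Split.unique` both typings split the context in the same way. -/
theorem Derives.dom_eq {p : PreProof α} {A B : Formula α} {Γ Δ : Ctx α} (h : Derives p (cons A Γ))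
    (h' : Derives p (cons B Δ)) (n : ℕ) : Γ n ≠ none ↔ Δ n ≠ none :=
  (h.names (n + 1)).symm.trans (h'.names (n + 1))

/-- Cut-elimination does not change the normal form up to rule commutations. -/
theorem PreProof.InContext.commEquiv {Γ : Ctx α} {p p' : PreProof α}
    (h : InContext BetaRoot p p') (hp : Derives p Γ) (hp' : Derives p' Γ) :
    CommEquiv Γ (nf p) (nf p') := by
  induction h generalizing Γ with
  | root h => exact h.commEquiv hp hp'
  | cutL _ ih =>
    cases hp with | cut h₁ h₂ h₃ =>
    cases hp' with | cut h₁' h₂' h₃' =>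
    obtain ⟨rfl, rfl⟩ := h₁.unique h₁' (h₃.dom_eq h₃')
    exact (ih h₂ h₂').elim (.refl h₃.nf) h₁
  | cutR _ ih =>
    cases hp with | cut h₁ h₂ h₃ =>
    cases hp' with | cut h₁' h₂' h₃' =>
    obtain ⟨rfl, rfl⟩ := h₁.symm.unique h₁'.symm (h₂.dom_eq h₂')
    exact CommEquiv.elim (.refl h₂.nf) (ih h₃ h₃') h₁
  | tensL _ ih =>
    cases hp with | tens hi h₁ h₂ h₃ =>
    cases hp' with | tens hi' h₁' h₂' h₃' =>
    obtain ⟨rfl, rfl⟩ : _ ∧ _ := by simpa [hi] using hi'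
    obtain ⟨rfl, rfl⟩ := h₁.unique h₁' (h₃.dom_eq h₃')
    exact .tens hi h₁ (ih h₂ h₂') (.refl h₃.nf)
  | tensR _ ih =>
    cases hp with | tens hi h₁ h₂ h₃ =>
    cases hp' with | tens hi' h₁' h₂' h₃' =>
    obtain ⟨rfl, rfl⟩ : _ ∧ _ := by simpa [hi] using hi'
    obtain ⟨rfl, rfl⟩ := h₁.symm.unique h₁'.symm (h₂.dom_eq h₂')
    exact .tens hi h₁ (.refl h₂.nf) (ih h₃ h₃')
  | parr _ ih =>
    cases hp with | parr hi h₁ =>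
    cases hp' with | parr hi' h₁' =>
    obtain ⟨rfl, rfl⟩ : _ ∧ _ := by simpa [hi] using hi'
    exact .parr hi (ih h₁ h₁')
  | bot _ ih =>
    cases hp with | bot hi h₁ =>
    cases hp' with | bot hi' h₁' =>
    exact .bot hi (ih h₁ h₁')
  | wthL _ ih =>
    cases hp with | wth hi h₁ h₂ =>
    cases hp' with | wth hi' h₁' h₂' =>
    obtain ⟨rfl, rfl⟩ : _ ∧ _ := by simpa [hi] using hi'
    exact .wth hi (ih h₁ h₁') (.refl h₂.nf)
  | wthR _ ih =>
    cases hp with | wth hi h₁ h₂ =>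
    cases hp' with | wth hi' h₁' h₂' =>
    obtain ⟨rfl, rfl⟩ : _ ∧ _ := by simpa [hi] using hi'
    exact .wth hi (.refl h₁.nf) (ih h₂ h₂')
  | plus _ ih =>
    cases hp with
    | plus₁ hi h₁ =>
      cases hp' with | plus₁ hi' h₁' =>
      obtain ⟨rfl, rfl⟩ : _ ∧ _ := by simpa [hi] using hi'
      exact .plus₁ hi (ih h₁ h₁')
    | plus₂ hi h₁ =>
      cases hp' with | plus₂ hi' h₁' =>
      obtain ⟨rfl, rfl⟩ : _ ∧ _ := by simpa [hi] using hi'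
      exact .plus₂ hi (ih h₁ h₁')

/-! ### Progress -/

theorem down_up (k : ℕ) (D : Finset ℕ) : down k (up k D) = D := by ext n; simp

theorem PreProof.shift_zero (p : PreProof α) : p.shift 0 = p := by
  rw [PreProof.shift]
  convert PreProof.rename_id p
  funext n
  cases n <;> rfl

/-- All commutative cases except `cut`-`cut`, in one statement; the latter is not needed for
progress, which looks at a topmost cut. -/
theorem PreProof.BetaRoot.side {A : Formula α} {r : Head α} {i : ℕ} {D : Finset ℕ}
    {ps : Bool → PreProof α} {q c : PreProof α} (h : IsCut A (r.mk0 i D ps) q c) :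
    BetaRoot c (r.mk i (D ∪ down 1 q.names) fun b => .cut A (ps b) (q.shift r.k)) := by
  have hs : ∀ b, IsCut A (((ps b).swap 1 r.k).swap r.k 1) (q.shift r.k)
      (.cut A (ps b) (q.shift r.k)) := fun b => by rw [swap_swap]; exact .straight
  cases r with
  | parr => exact .parr_cut h (hs false)
  | bot =>
    refine .bot_cut h ?_
    simp only [Head.k, shift_zero, swap_zero_right]
    exact .straight
  | wth => exact .wth_cut h (hs false) (hs true)
  | plus k => exact .plus_cut h (hs false)
  | top =>
    have := BetaRoot.top_cut h
    rwa [down_up] at this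
  | tensL q => exact .tens_cut₁ h (hs false)
  | tensR q => exact .tens_cut₂ h (hs false)

theorem IsSide.exists_betaRoot {p q c : PreProof α} {A : Formula α} {Γ Δ Θ : Ctx α} {r : Head α}
    {i : ℕ} {D : Finset ℕ} {ps : Bool → PreProof α} {Φ X : Ctx α} {L : Bool → List (Formula α)}
    (h : IsSide p A Δ r i D ps Φ X L) (hq : T q (cons A.dual Θ)) (hs : Γ.Split Δ Θ)
    (hc : IsCut A p q c) : ∃ c', BetaRoot c c' ∧ Derives c' Γ := by
  rw [h.eq] at hc
  exact ⟨_, .side hc, (h.rule.join hs hq.dom_down).derives fun b hb =>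
    .cut ((hs.assoc h.rule.split).2.push_left _ (h.rule.own.length b)) (h.prem b hb).der
      (hq.shift r.k).der⟩

theorem KeyCase.exists_betaRoot {p q c : PreProof α} {A : Formula α} {Γ Δ Θ : Ctx α}
    (h : KeyCase A Δ Θ p q) (hs : Γ.Split Δ Θ) (hc : IsCut A p q c) :
    ∃ c', BetaRoot c c' ∧ Derives c' Γ := by
  cases h with
  | tens_parr h h₁ h₂ h₃ =>
    obtain ⟨h₄, h₅⟩ := hs.assoc h
    exact ⟨_, .tens_parr hc .straight .straight,
      .cut h₄ h₁.der (.cut (h₅.push_right [_] (k := 1) rfl) (h₂.shift 1).der h₃.der)⟩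
  | wth_plus₁ h₁ h₂ h₃ => exact ⟨_, .wth_plus₁ hc .straight, .cut hs h₂.der h₃.der⟩
  | wth_plus₂ h₁ h₂ h₃ => exact ⟨_, .wth_plus₂ hc .straight, .cut hs h₁.der h₃.der⟩
  | one_bot h =>
    obtain rfl : Θ = Γ := by funext n; have := hs n; grind
    exact ⟨_, .one_bot hc, h.der⟩

theorem PreProof.IsCut.symm {A : Formula α} {p q c : PreProof α} (h : IsCut A p q c) :
    IsCut A.dual q p c := by
  cases h with
  | straight => simpa only [Formula.dual_dual] using IsCut.switched (A := A.dual) (p := q) (q := p)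
  | switched => exact .straight

theorem T.exists_betaRoot_of_ax {p q c : PreProof α} {A : Formula α} {Γ Δ Θ : Ctx α}
    (hq : T q (cons A.dual Θ)) (hs : Γ.Split Δ Θ) (hc : IsCut A p q c) {i : ℕ}
    (hp : p = .ax s(0, i + 1)) (hΔ : Δ = single i A.dual) : ∃ c', BetaRoot c c' ∧ Derives c' Γ := by
  subst hp hΔ
  exact ⟨_, .ax hc, (hq.rename (ren_contract hs)).der⟩

/-- A cut between proofs without `cut`-rule is not normal. -/
theorem T.exists_betaRoot {p q : PreProof α} {A : Formula α} {Γ Δ Θ : Ctx α}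
    (hp : T p (cons A Δ)) (hq : T q (cons A.dual Θ)) (hs : Γ.Split Δ Θ) :
    ∃ c', BetaRoot (.cut A p q) c' ∧ Derives c' Γ := by
  have hc : IsCut A p q (.cut A p q) := .straight
  have hp' : T p (cons A.dual.dual Δ) := by rwa [Formula.dual_dual]
  rcases hp.cases_zero with ⟨i, h₁, h₂⟩ | ⟨r, i, D, ps, Φ, X, L, h⟩ | h
  · exact hq.exists_betaRoot_of_ax hs hc h₁ h₂
  · exact h.exists_betaRoot hq hs hc
  rcases hq.cases_zero with ⟨i, h₁, h₂⟩ | ⟨r, i, D, ps, Φ, X, L, h'⟩ | h'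
  · exact hp'.exists_betaRoot_of_ax hs.symm hc.symm h₁ h₂
  · exact h'.exists_betaRoot hp' hs.symm hc.symm
  rcases h.keyCase h' with h | h
  · exact h.exists_betaRoot hs hc
  · exact h.exists_betaRoot hs.symm hc.symm

/-- A proof with a `cut`-rule is not normal. -/
theorem Derives.exists_beta {p : PreProof α} {Γ : Ctx α} (h : Derives p Γ) (hc : ¬ p.CutFree) :
    ∃ p', Derives p' Γ ∧ InContext BetaRoot p p' := by
  induction h with
  | ax | one | top => exact (hc trivial).elim
  | @cut Γ Δ Θ A p q hs hp hq ihp ihq =>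
    by_cases h₁ : p.CutFree
    · by_cases h₂ : q.CutFree
      -- A topmost cut, with cut-free premises; in all other cases the step is found inside a
      -- premise.
      · obtain ⟨c, h, h'⟩ := T.exists_betaRoot ⟨hp, h₁⟩ ⟨hq, h₂⟩ hs
        exact ⟨c, h', .root h⟩
      · obtain ⟨q', h, h'⟩ := ihq h₂
        exact ⟨_, .cut hs hp h, .cutR h'⟩
    · obtain ⟨p', h, h'⟩ := ihp h₁
      exact ⟨_, .cut hs h hq, .cutL h'⟩
  | @tens Γ Δ Θ A B i p q hi hs hp hq ihp ihq =>
    by_cases h₁ : p.CutFree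
    · obtain ⟨q', h, h'⟩ := ihq fun h₂ => hc ⟨h₁, h₂⟩
      exact ⟨_, .tens hi hs hp h, .tensR h'⟩
    · obtain ⟨p', h, h'⟩ := ihp h₁
      exact ⟨_, .tens hi hs h hq, .tensL h'⟩
  | parr hi _ ih =>
    obtain ⟨p', h, h'⟩ := ih hc
    exact ⟨_, .parr hi h, .parr h'⟩
  | bot hi _ ih =>
    obtain ⟨p', h, h'⟩ := ih hc
    exact ⟨_, .bot hi h, .bot h'⟩
  | @wth Γ A B i p q hi hp hq ihp ihq =>
    by_cases h₁ : p.CutFree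
    · obtain ⟨q', h, h'⟩ := ihq fun h₂ => hc ⟨h₁, h₂⟩
      exact ⟨_, .wth hi hp h, .wthR h'⟩
    · obtain ⟨p', h, h'⟩ := ihp h₁
      exact ⟨_, .wth hi h hq, .wthL h'⟩
  | plus₁ hi _ ih =>
    obtain ⟨p', h, h'⟩ := ih hc
    exact ⟨_, .plus₁ hi h, .plus h'⟩
  | plus₂ hi _ ih =>
    obtain ⟨p', h, h'⟩ := ih hc
    exact ⟨_, .plus₂ hi h, .plus h'⟩

/-! ### Typed proofs -/

namespace Proof

variable {Γ : List (Formula α)} {π τ ν : Proof Γ}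

theorem BetaEq.commEquiv (h : BetaEq π τ) : CommEquiv (ofList Γ) (nf π.1) (nf τ.1) := by
  induction h with
  | rel π τ h => exact InContext.commEquiv h π.2 τ.2
  | refl π => exact .refl π.2.nf
  | symm _ _ _ ih => exact ih.symm
  | trans _ _ _ _ _ ih ih' => exact ih.trans ih'

theorem IsNormalFormOf.cutFree (h : IsNormalFormOf ν π) : ν.1.CutFree := by
  by_contra hc
  obtain ⟨p, hp, h'⟩ := ν.2.exists_beta hc
  exact h.2 ⟨p, hp⟩ h'

theorem IsNormalFormOf.betaEq (h : IsNormalFormOf ν π) : BetaEq π ν :=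
  ReflTransGen.rec (.refl _) (fun _ h ih => .trans _ _ _ ih (.rel _ _ h)) h.1

/-- The typing kept in `TypedStep` makes every intermediate tree a proof of `Γ`, as `CommStep`
demands. -/
theorem commEq_of_commEquiv (h : CommEquiv (ofList Γ) π.1 τ.1) : CommEq π τ := by
  obtain ⟨p, hp⟩ := π
  have h' := h.reflTransGen
  clear h
  dsimp only at h'
  induction h' using ReflTransGen.head_induction_on with
  | refl => exact .refl
  | head h _ ih => exact ReflTransGen.head (b := (⟨_, h.2.2.der⟩ : Proof Γ)) (show CommStep _ _ from h.1) (ih _)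

end Proof

end MALL

theorem mainTheorem7 {α : Type*} (Γ : List (MALL.Formula α)) (π τ π' τ' : MALL.Proof Γ)
    (h : MALL.Proof.BetaEq π τ)
    (hπ : MALL.Proof.IsNormalFormOf π' π) (hτ : MALL.Proof.IsNormalFormOf τ' τ) :
    MALL.Proof.CommEq π' τ' := by
  have e := MALL.Proof.BetaEq.commEquiv
    (.trans _ _ _ (.symm _ _ hπ.betaEq) (.trans _ _ _ h hτ.betaEq))
  -- Normal forms are cut-free, hence fixed by `nf`: the commutations between their images under
  -- `nf` relate the normal forms themselves.
  rw [MALL.nf_eq_self hπ.cutFree, MALL.nf_eq_self hτ.cutFree] at e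
  exact MALL.Proof.commEq_of_commEquiv e
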